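/- Let $u\in C^1(\mathbb R;\mathbb R)$ with $\sin(u/2)\in L^1(\mathbb R)$ and $1-|\cos(u/2)|\in L^1(\mathbb R)$, and consider the scattering problem $$\Phi_x=\tfrac14\Big(z-\tfrac1z\Big)\cos\Big(\tfrac u2\Big)\begin{pmatrix}-i&0\\0&i\end{pmatrix}\Phi+\tfrac14\Big(z+\tfrac1z\Big)\sin\Big(\tfrac u2\Big)\begin{pmatrix}0&i\\i&0\end{pmatrix}\Phi,\qquad \Phi=(\phi_1,\phi_2)^T,\ z\in\mathbb C\setminus\{0\}.\tag{1}$$ A number $z\in\mathbb C\setminus\{0\}$ is an eigenvalue if (1) has a nonzero solution in $L^2(\mathbb R;\mathbb C^2)$. Suppose $u\to0$ as $x\to-\infty$ and $u\to2\pi Q$ as $x\to+\infty$ with $Q\in\{0,1\}$, and put $E(x,z)=\exp\big(\tfrac14(z-\tfrac1z)\int_0^x\cos(u/2)\,dy\,\begin{pmatrix}-i&0\\0&i\end{pmatrix}\big)$. For $\operatorname{Im}z>0$ the Jost solutions $\Psi(\cdot,z)$, $\Phi(\cdot,z)$ are the solutions of (1) with $\Psi\sim E(x,z)(1,0)^T$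 as $x\to-\infty$, and, as $x\to+\infty$, $\Phi\sim E(x,z)(1,0)^T$ if $Q=1$ and $\Phi\sim E(x,z)(0,1)^T$ if $Q=0$; for $\operatorname{Im}z<0$ the vectors $(1,0)^T$ and $(0,1)^T$ are interchanged. (Here $f\sim g$ means $|f-g|=o(|g|)$.) Let $W(z)=\psi_1\phi_2-\psi_2\phi_1$ be their Wronskian, which does not depend on $x$. A nonreal eigenvalue $z$ is called simple if the space of $L^2$ solutions of (1) is one-dimensional and $W$ is complex differentiable at $z$ with $W(z)=0$ and $W'(z)\neq0$. (i) If $u$ is monotone with $u(x)\to0$ as $x\to-\infty$ and $u(x)\to2\pi$ as $x\to+\infty$ (topological charge $Q=1$), then all eigenvalues of (1) are nonreal and simple. (ii) If $u\ge0$ has exactly one critical point, located at $x=0$, $u(x)\to0$ as $x\to\pm\infty$ (topological charge $Q=0$), and $u_0:=u(0)$ satisfies $0<u_0<\pi$, then every eigenvalue $z=r e^{i\theta}$ of (1) with $r>0$ and $0<\theta\le(\pi-u_0)/2$ is simple. In both cases, Jost solutions exist for every nonreal $z$, and $W$ is well defined there. -/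

import Mathlib

open MeasureTheory Filter Topology Matrix

noncomputable section

namespace SineGordon

/-- The matrix `τ₁ = diag(-i, i)`. -/
def tau1 : Matrix (Fin 2) (Fin 2) ℂ := !![-Complex.I, 0; 0, Complex.I]

/-- The matrix `τ₂`, with both off-diagonal entries equal to `i`. -/
def tau2 : Matrix (Fin 2) (Fin 2) ℂ := !![0, Complex.I; Complex.I, 0]

/-- The coefficient matrix of the scattering problem for the sine-Gordon equation in laboratory
coordinates, with stationary initial data (`u_t = 0`):
`(1/4) (z - 1/z) cos(u/2) τ₁ + (1/4) (z + 1/z) sin(u/2) τ₂`. -/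
def coeff (u : ℝ → ℝ) (z : ℂ) (x : ℝ) : Matrix (Fin 2) (Fin 2) ℂ :=
  ((1 / 4 : ℂ) * (z - 1 / z) * (Real.cos (u x / 2) : ℂ)) • tau1 +
    ((1 / 4 : ℂ) * (z + 1 / z) * (Real.sin (u x / 2) : ℂ)) • tau2

/-- `Φ = (φ₁, φ₂)ᵀ` solves the scattering problem on the whole line. -/
def IsSolution (u : ℝ → ℝ) (z : ℂ) (Φ : ℝ → Fin 2 → ℂ) : Prop :=
  ∀ x : ℝ, HasDerivAt Φ (coeff u z x *ᵥ Φ x) x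

/-- The space of square integrable solutions of the scattering problem with parameter `z`. -/
def eigenspace (u : ℝ → ℝ) (z : ℂ) : Submodule ℂ (ℝ → Fin 2 → ℂ) where
  carrier := {Φ | IsSolution u z Φ ∧ MemLp Φ 2 volume}
  add_mem' := by
    rintro Φ Ψ ⟨h1, h2⟩ ⟨h3, h4⟩
    refine ⟨fun x => ?_, h2.add h4⟩
    have h := (h1 x).add (h3 x)
    rw [← Matrix.mulVec_add] at h
    exact h
  zero_mem' := by
    refine ⟨fun x => ?_, MemLp.zero⟩
    simp
  smul_mem' := by
    rintro c Φ ⟨h1, h2⟩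
    refine ⟨fun x => ?_, h2.const_smul c⟩
    have h := (h1 x).const_smul c
    rw [← Matrix.mulVec_smul] at h
    exact h

/-- `z` is an eigenvalue: `z ≠ 0` and there is a nonzero square integrable solution. -/
def IsEigenvalue (u : ℝ → ℝ) (z : ℂ) : Prop :=
  z ≠ 0 ∧ ∃ Φ ∈ eigenspace u z, Φ ≠ 0

/-- The function `x ↦ exp((1/4) (z - 1/z) (∫₀ˣ cos(u/2)) τ₁) e`, written out with
`τ₁ = diag(-i, i)`. -/
def free (u : ℝ → ℝ) (z : ℂ) (e : Fin 2 → ℂ) (x : ℝ) : Fin 2 → ℂ :=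
  let s : ℂ := (1 / 4 : ℂ) * (z - 1 / z) * ((∫ y in (0 : ℝ)..x, Real.cos (u y / 2) : ℝ) : ℂ)
  ![Complex.exp (-Complex.I * s) * e 0, Complex.exp (Complex.I * s) * e 1]

theorem free_eq_exp (u : ℝ → ℝ) (z : ℂ) (e : Fin 2 → ℂ) (x : ℝ) :
    free u z e x =
      NormedSpace.exp (((1 / 4 : ℂ) * (z - 1 / z) *
        ((∫ y in (0 : ℝ)..x, Real.cos (u y / 2) : ℝ) : ℂ)) • tau1) *ᵥ e := by
  have h : ∀ s : ℂ, s • tau1 = Matrix.diagonal ![-Complex.I * s, Complex.I * s] := by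
    intro s
    ext i j
    fin_cases i <;> fin_cases j <;> simp [tau1, mul_comm]
  rw [h, Matrix.exp_diagonal]
  ext i
  fin_cases i <;> simp [free, Matrix.mulVec_diagonal, Complex.exp_eq_exp_ℂ]

/-- The direction of the decaying solution at `-∞` for a potential with `u → 0` there:
`(1, 0)ᵀ` in the upper half plane and `(0, 1)ᵀ` in the lower half plane. -/
def leftDir (z : ℂ) : Fin 2 → ℂ := if 0 < z.im then ![1, 0] else ![0, 1]

/-- The direction of the decaying solution at `+∞` for a potential with `u → 2πQ` there
(so `cos(u/2) → (-1)^Q`): in the upper half plane it is `(1, 0)ᵀ` for odd `Q` and `(0, 1)ᵀ` for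
even `Q`; in the lower half plane the two are exchanged. -/
def rightDir (Q : ℤ) (z : ℂ) : Fin 2 → ℂ :=
  if (0 < z.im ↔ Odd Q) then ![1, 0] else ![0, 1]

/-- The Jost solution normalised at `-∞`. -/
def IsLeftJost (u : ℝ → ℝ) (z : ℂ) (Ψ : ℝ → Fin 2 → ℂ) : Prop :=
  IsSolution u z Ψ ∧ Asymptotics.IsEquivalent atBot Ψ (free u z (leftDir z))

/-- The Jost solution normalised at `+∞`, for a potential of topological charge `Q`. -/
def IsRightJost (u : ℝ → ℝ) (Q : ℤ) (z : ℂ) (Φ : ℝ → Fin 2 → ℂ) : Prop :=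
  IsSolution u z Φ ∧ Asymptotics.IsEquivalent atTop Φ (free u z (rightDir Q z))

/-- The Wronskian `ψ₁ φ₂ - ψ₂ φ₁`. -/
def wronskian (Ψ Φ : ℝ → Fin 2 → ℂ) (x : ℝ) : ℂ := Ψ x 0 * Φ x 1 - Ψ x 1 * Φ x 0

/-- `W` is the Wronskian of the Jost solutions as a function of the spectral parameter: for every
nonreal `z` Jost solutions at both ends exist, and `W z` is their Wronskian, whatever the choice
of the solutions and of the point `x`. This determines `W` off the real axis. -/
def IsJostWronskian (u : ℝ → ℝ) (Q : ℤ) (W : ℂ → ℂ) : Prop :=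
  ∀ z : ℂ, z.im ≠ 0 →
    (∃ Ψ, IsLeftJost u z Ψ) ∧ (∃ Φ, IsRightJost u Q z Φ) ∧
    ∀ Ψ Φ, IsLeftJost u z Ψ → IsRightJost u Q z Φ → ∀ x, wronskian Ψ Φ x = W z

/-- `z` is a simple eigenvalue of the scattering problem for a potential of topological charge `Q`
(tending to `0` at `-∞`): it is a nonreal eigenvalue, its eigenspace is a line, and the Wronskian
of the Jost solutions is complex differentiable at `z` and vanishes there with nonzero
derivative. -/
structure IsSimpleEigenvalue (u : ℝ → ℝ) (Q : ℤ) (z : ℂ) : Prop where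
  isEigenvalue : IsEigenvalue u z
  im_ne_zero : z.im ≠ 0
  finrank_eq_one : Module.finrank ℂ (eigenspace u z) = 1
  wronskian_deriv : ∃ W : ℂ → ℂ, IsJostWronskian u Q W ∧
    W z = 0 ∧ ∃ d : ℂ, d ≠ 0 ∧ HasDerivAt W d z

/-- The regularity and decay assumptions on the potentials. -/
structure IsPotential (u : ℝ → ℝ) : Prop where
  contDiff : ContDiff ℝ 1 u
  integrable_cos : Integrable (fun x => 1 - |Real.cos (u x / 2)|) volume
  integrable_sin : Integrable (fun x => Real.sin (u x / 2)) volume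

/-- Monotone kinks of topological charge `1`. -/
structure IsMonotoneKink (u : ℝ → ℝ) : Prop extends IsPotential u where
  monotone : Monotone u
  tendsto_atBot : Tendsto u atBot (𝓝 0)
  tendsto_atTop : Tendsto u atTop (𝓝 (2 * Real.pi))

/-- Single-hump breather potentials: nonnegative, vanishing at both ends, whose only critical
point is `0`, with height `0 < u(0) < π`. -/
structure IsSingleHump (u : ℝ → ℝ) : Prop extends IsPotential u where
  nonneg : ∀ x, 0 ≤ u x
  critical : ∀ x, deriv u x = 0 ↔ x = 0
  tendsto_atBot : Tendsto u atBot (𝓝 0)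
  tendsto_atTop : Tendsto u atTop (𝓝 0)
  pos : 0 < u 0
  lt_pi : u 0 < Real.pi

end SineGordon

end

/-! Write a = (z - 1/z)/4, b = (z + 1/z)/4, c = cos(u/2), s = sin(u/2). The problem becomes y₁' =
-iac y₁ + ibs y₂, y₂' = ibs y₁ + iac y₂, and Im a > 0 in the upper half plane.

Jost solutions come from a Volterra equation, solved by contraction in a weighted sup norm
(`exists_reducedJost`), with Lipschitz dependence on (a, b). An L² solution is a multiple of the
Jost solution at either end, because the Wronskian of two solutions is constant and vanishes when
both are square integrable near that end. So eigenspaces are lines, and at an eigenvalue the two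
Jost solutions are proportional, with factor l say.

Comparing solutions at two nearby parameters (`hasDerivAt_wronskian`) gives, with y the right Jost
solution, W' = l ∫ (a'·(-2ic y₁y₂) + b'·is(y₂² - y₁²)). Since z a' = b and z b' = a, it must be
shown that a bilinear integral does not vanish. This is read off from the Hermitian Krein form K = ∫
(Im a · s(|y₁|² + |y₂|²) - 2 Re b · c · Im(y₁ȳ₂)), in three steps.

Positivity: adding the derivative of a regularisation of cot(u/2)|y₂|² completes the density to
squares on a half-line where u increases (`krein_pointwise`). Symmetries of the system cover the
other half-lines, and the cut is placed where both boundary terms have the right sign. Hence K > 0.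

Location: put t = (|z|² - 1)/(|z|² + 1). The density times -t is the derivative of Re(y₁ȳ₂), which
vanishes at both ends. So tK = 0, whence t = 0 and |z| = 1.

Conclusion: now a is imaginary and b is real, so (ȳ₁, -ȳ₂) solves the same system and equals k y for
a constant k. This turns the bilinear integral into the Hermitian one: k z W' = l K ≠ 0.

Eigenvalues in the lower half plane are reached by z ↦ 1/z with the components exchanged, and real
ones are excluded because |y|² is then constant. -/

noncomputable section

namespace SineGordon

open Set

/-! ### Exponential convolution on a half-line -/

section Volterra

theorem hasDerivAt_setIntegral_Iic {E : Type*} [NormedAddCommGroup E] [NormedSpace ℝ E]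
    [CompleteSpace E] {g : ℝ → E} (hg : Continuous g) (hi : ∀ x, IntegrableOn g (Iic x)) (x : ℝ) :
    HasDerivAt (fun x => ∫ y in Iic x, g y) (g x) x := by
  have h : (fun x => ∫ y in Iic x, g y) =
      fun x => (∫ y in Iic (0 : ℝ), g y) + ∫ y in (0 : ℝ)..x, g y := by
    funext x
    rw [← intervalIntegral.integral_Iic_sub_Iic (hi 0) (hi x)]
    abel
  rw [h]
  exact (intervalIntegral.integral_hasDerivAt_right (hg.intervalIntegrable _ _)
    hg.stronglyMeasurable.stronglyMeasurableAtFilter hg.continuousAt).const_add _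

theorem norm_cexp_sub_le {m : ℝ} {p q : ℂ} (hp : p.re ≤ m) (hq : q.re ≤ m) :
    ‖Complex.exp p - Complex.exp q‖ ≤ Real.exp m * ‖p - q‖ := by
  refine Convex.norm_image_sub_le_of_norm_hasDerivWithin_le (𝕜 := ℂ) (s := {w : ℂ | w.re ≤ m})
    (f' := Complex.exp) (fun x _ => (Complex.hasDerivAt_exp x).hasDerivWithinAt) (fun x hx => ?_)
    (convex_halfSpace_re_le m) hq hp
  rw [Complex.norm_exp]
  exact Real.exp_le_exp.2 hx

/-- The convolution of `g` with the exponential `t ↦ exp (2 i a t)` of the half-line. -/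
def expConv (a : ℂ) (g : ℝ → ℂ) (x : ℝ) : ℂ :=
  ∫ y in Iic x, Complex.exp (2 * Complex.I * a * (x - y)) * g y

variable {a a' : ℂ} {g h : ℝ → ℂ} {x : ℝ}

theorem norm_exp_kernel_le_one (ha : 0 ≤ a.im) {x y : ℝ} (hy : y ≤ x) :
    ‖Complex.exp (2 * Complex.I * a * (x - y))‖ ≤ 1 := by
  rw [Complex.norm_exp, Real.exp_le_one_iff]
  have : (2 * Complex.I * a * (x - y)).re = -(2 * a.im * (x - y)) := by
    simp [Complex.mul_re, Complex.mul_im]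
  rw [this]
  have := mul_nonneg (mul_nonneg zero_le_two ha) (sub_nonneg.2 hy)
  linarith

/-- Differentiating the kernel in `a` produces a factor x - y, which the decay exp(-2m(x - y))
absorbs through τ exp(-τ) ≤ 1. The bound is therefore uniform in x - y, at the price of staying at
distance `m` from the real axis. -/
theorem norm_exp_kernel_sub_le {m : ℝ} (hm : 0 < m) (ha : m ≤ a.im) (ha' : m ≤ a'.im) {x y : ℝ}
    (hy : y ≤ x) :
    ‖Complex.exp (2 * Complex.I * a * (x - y)) - Complex.exp (2 * Complex.I * a' * (x - y))‖
      ≤ ‖a - a'‖ / m := by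
  have hre : ∀ a : ℂ, (2 * Complex.I * a * (x - y)).re = -(2 * a.im * (x - y)) := by
    intro a; simp [Complex.mul_re, Complex.mul_im]
  have ht : 0 ≤ x - y := sub_nonneg.2 hy
  have h1 := norm_cexp_sub_le (m := -(2 * m * (x - y))) (p := 2 * Complex.I * a * (x - y))
    (q := 2 * Complex.I * a' * (x - y))
    (by rw [hre]; nlinarith) (by rw [hre]; nlinarith)
  refine h1.trans ?_
  have h2 : ‖2 * Complex.I * a * (x - y) - 2 * Complex.I * a' * (x - y)‖ =
      2 * ‖a - a'‖ * (x - y) := by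
    rw [← sub_mul, ← mul_sub, norm_mul, norm_mul, norm_mul, Complex.norm_I, ← Complex.ofReal_sub,
      Complex.norm_real, Real.norm_of_nonneg ht]
    simp
  rw [h2, le_div_iff₀ hm]
  have h3 : 2 * m * (x - y) * Real.exp (-(2 * m * (x - y))) ≤ 1 := by
    rw [Real.exp_neg, ← div_eq_mul_inv, div_le_one (Real.exp_pos _)]
    linarith [Real.add_one_le_exp (2 * m * (x - y))]
  calc Real.exp (-(2 * m * (x - y))) * (2 * ‖a - a'‖ * (x - y)) * m
      = ‖a - a'‖ * (2 * m * (x - y) * Real.exp (-(2 * m * (x - y)))) := by ring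
    _ ≤ ‖a - a'‖ * 1 := by gcongr
    _ = ‖a - a'‖ := mul_one _

theorem integrableOn_exp_kernel (ha : 0 ≤ a.im) (hg : IntegrableOn g (Iic x)) :
    IntegrableOn (fun y : ℝ => Complex.exp (2 * Complex.I * a * (x - y)) * g y) (Iic x) := by
  refine Integrable.bdd_mul (c := 1) hg (Continuous.aestronglyMeasurable (by fun_prop)) ?_
  filter_upwards [ae_restrict_mem measurableSet_Iic] with y hy
  exact norm_exp_kernel_le_one ha hy

theorem norm_expConv_le (ha : 0 ≤ a.im) (hg : IntegrableOn g (Iic x)) :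
    ‖expConv a g x‖ ≤ ∫ y in Iic x, ‖g y‖ := by
  refine norm_integral_le_of_norm_le hg.norm ?_
  filter_upwards [ae_restrict_mem measurableSet_Iic] with y hy
  rw [norm_mul]
  exact mul_le_of_le_one_left (norm_nonneg _) (norm_exp_kernel_le_one ha hy)

theorem norm_expConv_sub_le (ha : 0 ≤ a.im) (hg : IntegrableOn g (Iic x))
    (hh : IntegrableOn h (Iic x)) :
    ‖expConv a g x - expConv a h x‖ ≤ ∫ y in Iic x, ‖g y - h y‖ := by
  have : expConv a g x - expConv a h x = expConv a (fun y => g y - h y) x := by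
    unfold expConv
    rw [← integral_sub (integrableOn_exp_kernel ha hg) (integrableOn_exp_kernel ha hh)]
    simp only [mul_sub]
  rw [this]
  exact norm_expConv_le ha (hg.sub hh)

theorem norm_expConv_sub_param_le {m : ℝ} (hm : 0 < m) (ha : m ≤ a.im) (ha' : m ≤ a'.im)
    (hg : IntegrableOn g (Iic x)) :
    ‖expConv a g x - expConv a' g x‖ ≤ ‖a - a'‖ / m * ∫ y in Iic x, ‖g y‖ := by
  unfold expConv
  rw [← integral_sub (integrableOn_exp_kernel (hm.le.trans ha) hg)
    (integrableOn_exp_kernel (hm.le.trans ha') hg), ← integral_const_mul]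
  refine norm_integral_le_of_norm_le (hg.norm.const_mul _) ?_
  filter_upwards [ae_restrict_mem measurableSet_Iic] with y hy
  rw [← sub_mul, norm_mul]
  gcongr
  exact norm_exp_kernel_sub_le hm ha ha' hy

theorem hasDerivAt_expConv (ha : 0 ≤ a.im) (hc : Continuous g)
    (hg : ∀ x, IntegrableOn g (Iic x)) (x : ℝ) :
    HasDerivAt (expConv a g) (g x + 2 * Complex.I * a * expConv a g x) x := by
  -- Splitting the kernel into a function of x times a function of y leaves x only in a prefactor
  -- and in the endpoint of integration, so the product rule applies.
  have hexp : ∀ x y : ℝ, Complex.exp (2 * Complex.I * a * (x - y)) =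
      Complex.exp (2 * Complex.I * a * x) * Complex.exp (2 * Complex.I * a * (0 - y)) := by
    intro x y
    rw [← Complex.exp_add]
    ring_nf
  have heq : ∀ x, expConv a g x = Complex.exp (2 * Complex.I * a * x) *
      ∫ y in Iic x, Complex.exp (2 * Complex.I * a * (0 - y)) * g y := by
    intro x
    rw [← integral_const_mul]
    unfold expConv
    refine integral_congr_ae (Eventually.of_forall fun y => ?_)
    beta_reduce
    rw [hexp x y, mul_assoc]
  have hint : ∀ x : ℝ,
      IntegrableOn (fun y : ℝ => Complex.exp (2 * Complex.I * a * (0 - y)) * g y) (Iic x) := by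
    intro x
    have h := (integrableOn_exp_kernel ha (hg x)).const_mul (Complex.exp (-(2 * Complex.I * a * x)))
    refine h.congr (Eventually.of_forall fun y => ?_)
    simp only [hexp x y]
    rw [← mul_assoc, ← mul_assoc, ← Complex.exp_add]
    simp
  have h1 := hasDerivAt_setIntegral_Iic (g := fun y : ℝ =>
    Complex.exp (2 * Complex.I * a * (0 - y)) * g y) (by fun_prop) hint x
  have h2 : HasDerivAt (fun x : ℝ => Complex.exp (2 * Complex.I * a * x))
      (Complex.exp (2 * Complex.I * a * x) * (2 * Complex.I * a)) x := by
    have := ((hasDerivAt_id x).ofReal_comp.const_mul (2 * Complex.I * a)).cexp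
    simpa using this
  have h3 := h2.mul h1
  rw [show expConv a g = fun x : ℝ => Complex.exp (2 * Complex.I * a * x) *
      ∫ y : ℝ in Iic x, Complex.exp (2 * Complex.I * a * (0 - y)) * g y from funext heq]
  refine h3.congr_deriv ?_
  have h4 : Complex.exp (2 * Complex.I * a * x) * Complex.exp (2 * Complex.I * a * (0 - x)) = 1 := by
    rw [← hexp]; simp
  linear_combination g x * h4

end Volterra

/-! ### Exponential weights for the contraction argument -/

section Weight

variable {k : ℝ → ℝ}

/-- The weight `exp (L ∫_{-∞}^x k)`. -/
def weight (k : ℝ → ℝ) (L : ℝ) (x : ℝ) : ℝ := Real.exp (L * ∫ y in Iic x, k y)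

theorem weight_pos (k : ℝ → ℝ) (L x : ℝ) : 0 < weight k L x := Real.exp_pos _

variable {L : ℝ} (hk : Continuous k) (hk0 : ∀ x, 0 ≤ k x) (hi : ∀ x, IntegrableOn k (Iic x))
include hk hi

theorem hasDerivAt_weight (L x : ℝ) :
    HasDerivAt (weight k L) (L * (k x * weight k L x)) x := by
  have := ((hasDerivAt_setIntegral_Iic hk hi x).const_mul L).exp
  refine this.congr_deriv ?_
  simp only [weight]; ring

theorem continuous_weight (L : ℝ) : Continuous (weight k L) :=
  continuous_iff_continuousAt.2 fun x => (hasDerivAt_weight hk hi L x).continuousAt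

omit hk hi in
theorem tendsto_weight_atBot (k : ℝ → ℝ) (L : ℝ) : Tendsto (weight k L) atBot (𝓝 1) := by
  have h1 : Tendsto (fun x => ∫ y in Iic x, k y) atBot (𝓝 0) :=
    tendsto_integral_Iic_zero tendsto_id
  have h2 := (h1.const_mul L).rexp
  rw [mul_zero, Real.exp_zero] at h2
  exact h2

include hk0

omit hk in
theorem monotone_weight (hL : 0 ≤ L) : Monotone (weight k L) := by
  intro x y hxy
  refine Real.exp_le_exp.2 (mul_le_mul_of_nonneg_left ?_ hL)
  exact setIntegral_mono_set (hi y) (Eventually.of_forall hk0)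
    (Iic_subset_Iic.2 hxy).eventuallyLE

theorem integrableOn_mul_weight (hL : 0 ≤ L) (x : ℝ) :
    IntegrableOn (fun y => k y * weight k L y) (Iic x) := by
  refine Integrable.mono' ((hi x).mul_const (weight k L x))
    (hk.mul (continuous_weight hk hi L)).aestronglyMeasurable ?_
  filter_upwards [ae_restrict_mem measurableSet_Iic] with y hy
  rw [Real.norm_of_nonneg (mul_nonneg (hk0 y) (weight_pos k L y).le)]
  exact mul_le_mul_of_nonneg_left (monotone_weight hk0 hi hL hy) (hk0 y)

/-- Since `L * k * weight` is the derivative of the weight, integrating against `k` costs only a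
factor 1/L relative to the weight. A large `L` thus makes the Volterra map a contraction on the
whole line, however large the integral of `k` is. -/
theorem integral_mul_weight (hL : 0 < L) (x : ℝ) :
    ∫ y in Iic x, k y * weight k L y = (weight k L x - 1) / L := by
  have := integral_Iic_of_hasDerivAt_of_tendsto' (a := x)
    (fun y _ => hasDerivAt_weight hk hi L y)
    ((integrableOn_mul_weight hk hk0 hi hL.le x).const_mul L) (tendsto_weight_atBot k L)
  rw [integral_const_mul] at this
  rw [← this]
  field_simp

end Weight

/-! ### Estimates for the components of the Volterra map -/

section Source

open BoundedContinuousFunction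

/-- The pairs of bounded continuous functions in which the Volterra equation is solved. -/
abbrev BoundedPair := (ℝ →ᵇ ℂ) × (ℝ →ᵇ ℂ)

/-- The function `(p ν₁ + q ν₂) w`. -/
def source (p q : ℝ → ℂ) (w : ℝ → ℝ) (ν : BoundedPair) (y : ℝ) : ℂ :=
  (p y * ν.1 y + q y * ν.2 y) * w y

variable {p q p' q' : ℝ → ℂ} {k : ℝ → ℝ} {L D : ℝ}

theorem source_sub (w : ℝ → ℝ) (ν ν' : BoundedPair) (y : ℝ) :
    source p q w (ν - ν') y = source p q w ν y - source p q w ν' y := by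
  simp only [source, Prod.fst_sub, Prod.snd_sub, BoundedContinuousFunction.coe_sub, Pi.sub_apply]
  ring

theorem source_sub_coeff (w : ℝ → ℝ) (ν : BoundedPair) (y : ℝ) :
    source (fun y => p y - p' y) (fun y => q y - q' y) w ν y =
      source p q w ν y - source p' q' w ν y := by
  simp only [source]
  ring

theorem norm_source_le (hD : ∀ y, ‖p y‖ + ‖q y‖ ≤ D * k y) (ν : BoundedPair) (y : ℝ) :
    ‖source p q (weight k L) ν y‖ ≤ D * ‖ν‖ * (k y * weight k L y) := by
  have h1 : ‖ν.1 y‖ ≤ ‖ν‖ := (ν.1.norm_coe_le_norm y).trans (norm_fst_le ν)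
  have h2 : ‖ν.2 y‖ ≤ ‖ν‖ := (ν.2.norm_coe_le_norm y).trans (norm_snd_le ν)
  rw [source, norm_mul, Complex.norm_real, Real.norm_of_nonneg (weight_pos k L y).le, ← mul_assoc]
  refine mul_le_mul_of_nonneg_right ?_ (weight_pos k L y).le
  calc ‖p y * ν.1 y + q y * ν.2 y‖ ≤ ‖p y‖ * ‖ν.1 y‖ + ‖q y‖ * ‖ν.2 y‖ := by
        rw [← norm_mul, ← norm_mul]; exact norm_add_le _ _
    _ ≤ ‖p y‖ * ‖ν‖ + ‖q y‖ * ‖ν‖ := by gcongr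
    _ = (‖p y‖ + ‖q y‖) * ‖ν‖ := by ring
    _ ≤ (D * k y) * ‖ν‖ := by gcongr; exact hD y
    _ = D * ‖ν‖ * k y := by ring

variable (hk : Continuous k) (hk0 : ∀ x, 0 ≤ k x) (hi : ∀ x, IntegrableOn k (Iic x))
include hk hi

theorem continuous_source (hp : Continuous p) (hq : Continuous q) (ν : BoundedPair) :
    Continuous (source p q (weight k L) ν) := by
  have := continuous_weight hk hi L
  unfold source
  fun_prop

include hk0

theorem integrableOn_source (hL : 0 ≤ L) (hp : Continuous p) (hq : Continuous q)
    (hD : ∀ y, ‖p y‖ + ‖q y‖ ≤ D * k y) (ν : BoundedPair) (x : ℝ) :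
    IntegrableOn (source p q (weight k L) ν) (Iic x) :=
  Integrable.mono' ((integrableOn_mul_weight hk hk0 hi hL x).const_mul (D * ‖ν‖))
    (continuous_source hk hi hp hq ν).aestronglyMeasurable
    (Eventually.of_forall fun y => norm_source_le hD ν y)

theorem integral_norm_source_le (hL : 0 < L) (hp : Continuous p) (hq : Continuous q)
    (hD : ∀ y, ‖p y‖ + ‖q y‖ ≤ D * k y) (ν : BoundedPair) (x : ℝ) :
    ∫ y in Iic x, ‖source p q (weight k L) ν y‖ ≤ D / L * ‖ν‖ * (weight k L x - 1) := by
  calc ∫ y in Iic x, ‖source p q (weight k L) ν y‖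
      ≤ ∫ y in Iic x, D * ‖ν‖ * (k y * weight k L y) :=
        integral_mono (integrableOn_source hk hk0 hi hL.le hp hq hD ν x).norm
          ((integrableOn_mul_weight hk hk0 hi hL.le x).const_mul (D * ‖ν‖))
          fun y => norm_source_le hD ν y
    _ = D / L * ‖ν‖ * (weight k L x - 1) := by
        rw [integral_const_mul, integral_mul_weight hk hk0 hi hL]; ring

omit hk hi in
theorem one_le_weight (hL : 0 ≤ L) (x : ℝ) : 1 ≤ weight k L x :=
  Real.one_le_exp (mul_nonneg hL (integral_nonneg hk0))

/-- A component of the Volterra map, as a bounded continuous function. -/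
theorem exists_boundedConv {a : ℂ} (ha : 0 ≤ a.im) (hL : 0 < L) (hp : Continuous p)
    (hq : Continuous q) (hD : ∀ y, ‖p y‖ + ‖q y‖ ≤ D * k y) (hD0 : 0 ≤ D) (ν : BoundedPair) (e : ℂ) :
    ∃ f : ℝ →ᵇ ℂ, ∀ x, f x =
      (e + expConv a (source p q (weight k L) ν) x) / weight k L x := by
  have hs := continuous_source (L := L) hk hi hp hq ν
  have hsi := integrableOn_source hk hk0 hi hL.le hp hq hD ν
  have hw := continuous_weight hk hi L
  have hconv : Continuous (expConv a (source p q (weight k L) ν)) :=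
    continuous_iff_continuousAt.2 fun x => (hasDerivAt_expConv ha hs hsi x).continuousAt
  refine ⟨BoundedContinuousFunction.ofNormedAddCommGroup
    (fun x => (e + expConv a (source p q (weight k L) ν) x) / weight k L x) ?_
    (‖e‖ + D / L * ‖ν‖) ?_, fun x => rfl⟩
  · refine (continuous_const.add hconv).div (Complex.continuous_ofReal.comp hw) fun x => ?_
    exact Complex.ofReal_ne_zero.2 (weight_pos k L x).ne'
  · intro x
    have h1 := one_le_weight hk0 hL.le x
    rw [norm_div, Complex.norm_real, Real.norm_of_nonneg (weight_pos k L x).le,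
      div_le_iff₀ (weight_pos k L x)]
    have h2 := (norm_expConv_le ha (hsi x)).trans
      (integral_norm_source_le hk hk0 hi hL hp hq hD ν x)
    have h3 : 0 ≤ D / L * ‖ν‖ := by positivity
    nlinarith [norm_add_le e (expConv a (source p q (weight k L) ν) x), norm_nonneg e]

theorem norm_boundedConv_sub_le {a : ℂ} (ha : 0 ≤ a.im) (hL : 0 < L) (hp : Continuous p)
    (hq : Continuous q) (hD : ∀ y, ‖p y‖ + ‖q y‖ ≤ D * k y) (hD0 : 0 ≤ D)
    (ν ν' : BoundedPair) (e : ℂ) (x : ℝ) :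
    ‖(e + expConv a (source p q (weight k L) ν) x) / weight k L x -
      (e + expConv a (source p q (weight k L) ν') x) / weight k L x‖ ≤ D / L * ‖ν - ν'‖ := by
  have hsi := integrableOn_source hk hk0 hi hL.le hp hq hD
  rw [← sub_div, add_sub_add_left_eq_sub, norm_div, Complex.norm_real,
    Real.norm_of_nonneg (weight_pos k L x).le, div_le_iff₀ (weight_pos k L x)]
  have h := norm_expConv_sub_le ha (hsi ν x) (hsi ν' x)
  simp only [← source_sub] at h
  refine h.trans ((integral_norm_source_le hk hk0 hi hL hp hq hD (ν - ν') x).trans ?_)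
  have h3 : 0 ≤ D / L * ‖ν - ν'‖ := by positivity
  nlinarith

/-- The intermediate term is the convolution with the new exponent `a'` and the old coefficients;
the two differences are the change of kernel and the change of source. -/
theorem norm_boundedConv_sub_coeff_le {a a' : ℂ} {m D' : ℝ} (hm : 0 < m) (ha : m ≤ a.im)
    (ha' : m ≤ a'.im) (hL : 0 < L) (hp : Continuous p) (hq : Continuous q)
    (hp' : Continuous p') (hq' : Continuous q')
    (hD : ∀ y, ‖p y‖ + ‖q y‖ ≤ D * k y) (hD0 : 0 ≤ D)
    (hD1 : ∀ y, ‖p' y‖ + ‖q' y‖ ≤ D * k y)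
    (hD' : ∀ y, ‖p y - p' y‖ + ‖q y - q' y‖ ≤ D' * k y) (hD0' : 0 ≤ D')
    (ν : BoundedPair) (e : ℂ) (x : ℝ) :
    ‖(e + expConv a (source p q (weight k L) ν) x) / weight k L x -
      (e + expConv a' (source p' q' (weight k L) ν) x) / weight k L x‖ ≤
        (‖a - a'‖ / m * (D / L) + D' / L) * ‖ν‖ := by
  have hsi := integrableOn_source hk hk0 hi hL.le hp hq hD ν
  have hsi' := integrableOn_source hk hk0 hi hL.le hp' hq' hD1 ν
  rw [← sub_div, add_sub_add_left_eq_sub, norm_div, Complex.norm_real,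
    Real.norm_of_nonneg (weight_pos k L x).le, div_le_iff₀ (weight_pos k L x)]
  have h1 := norm_expConv_sub_param_le hm ha ha' (hsi x)
  have h2 := norm_expConv_sub_le (hm.le.trans ha') (hsi x) (hsi' x)
  simp only [← source_sub_coeff] at h2
  have h3 := integral_norm_source_le hk hk0 hi hL hp hq hD ν x
  have h4 := integral_norm_source_le hk hk0 hi hL (p := fun y => p y - p' y)
    (q := fun y => q y - q' y) (hp.sub hp') (hq.sub hq') hD' ν x
  have h5 : 0 ≤ ‖a - a'‖ / m := by positivity
  have h6 : 0 ≤ D / L * ‖ν‖ := by positivity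
  have h7 : 0 ≤ D' / L * ‖ν‖ := by positivity
  have h8 := mul_le_mul_of_nonneg_left h3 h5
  have h9 := norm_sub_le_norm_sub_add_norm_sub (expConv a (source p q (weight k L) ν) x)
    (expConv a' (source p q (weight k L) ν) x) (expConv a' (source p' q' (weight k L) ν) x)
  have h10 : 0 ≤ ‖a - a'‖ / m * (D / L * ‖ν‖) := by positivity
  nlinarith

/-- The estimate of `norm_boundedConv_sub_coeff_le` for the kernel without exponential. -/
theorem norm_boundedConv_sub_coeff_le' {D' : ℝ} (hL : 0 < L) (hp : Continuous p)
    (hq : Continuous q) (hp' : Continuous p') (hq' : Continuous q')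
    (hD : ∀ y, ‖p y‖ + ‖q y‖ ≤ D * k y)
    (hD1 : ∀ y, ‖p' y‖ + ‖q' y‖ ≤ D * k y)
    (hD' : ∀ y, ‖p y - p' y‖ + ‖q y - q' y‖ ≤ D' * k y) (hD0' : 0 ≤ D')
    (ν : BoundedPair) (e : ℂ) (x : ℝ) :
    ‖(e + expConv 0 (source p q (weight k L) ν) x) / weight k L x -
      (e + expConv 0 (source p' q' (weight k L) ν) x) / weight k L x‖ ≤ D' / L * ‖ν‖ := by
  have hsi := integrableOn_source hk hk0 hi hL.le hp hq hD ν
  have hsi' := integrableOn_source hk hk0 hi hL.le hp' hq' hD1 ν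
  rw [← sub_div, add_sub_add_left_eq_sub, norm_div, Complex.norm_real,
    Real.norm_of_nonneg (weight_pos k L x).le, div_le_iff₀ (weight_pos k L x)]
  have h2 := norm_expConv_sub_le (a := 0) le_rfl (hsi x) (hsi' x)
  simp only [← source_sub_coeff] at h2
  have h4 := integral_norm_source_le hk hk0 hi hL (p := fun y => p y - p' y)
    (q := fun y => q y - q' y) (hp.sub hp') (hq.sub hq') hD' ν x
  have h7 : 0 ≤ D' / L * ‖ν‖ := by positivity
  nlinarith

end Source

/-! ### The Volterra fixed point and its dependence on the parameters -/

section Family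

open BoundedContinuousFunction

/-- The Volterra map whose fixed points are the rescaled Jost solutions. -/
theorem exists_volterraMap {c s : ℝ → ℝ} (hc : Continuous c) (hs : Continuous s)
    (hci : ∀ x, IntegrableOn (fun y => 1 - c y) (Iic x)) (hsi : ∀ x, IntegrableOn s (Iic x))
    {M : ℝ} (hM : 0 < M) :
    ∃ F : ℂ → ℂ → BoundedPair → BoundedPair, ∀ a b : ℂ, 0 < a.im → ‖a‖ + ‖b‖ ≤ M →
      (∀ ν x, (F a b ν).1 x = (1 + expConv 0 (source (fun y => Complex.I * a * (1 - c y))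
        (fun y => Complex.I * b * s y) (weight (fun y => |1 - c y| + |s y|) (2 * M)) ν) x) /
          weight (fun y => |1 - c y| + |s y|) (2 * M) x) ∧
      (∀ ν x, (F a b ν).2 x = (0 + expConv a (source (fun y => Complex.I * b * s y)
        (fun y => -(Complex.I * a * (1 - c y)))
          (weight (fun y => |1 - c y| + |s y|) (2 * M)) ν) x) /
          weight (fun y => |1 - c y| + |s y|) (2 * M) x) ∧
      (∀ ν ν', dist (F a b ν) (F a b ν') ≤ 1 / 2 * dist ν ν') ∧
      ∀ a' b' : ℂ, ∀ m : ℝ, 0 < m → m ≤ a.im → m ≤ a'.im → ‖a'‖ + ‖b'‖ ≤ M → ∀ ν,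
        dist (F a b ν) (F a' b' ν) ≤
          (1 / m + 1 / M) * (‖a - a'‖ + ‖b - b'‖) * ‖ν‖ := by
  set k : ℝ → ℝ := fun y => |1 - c y| + |s y| with hk_def
  have hk : Continuous k := by fun_prop
  have hk0 : ∀ x, 0 ≤ k x := fun x => by positivity
  have hi : ∀ x, IntegrableOn k (Iic x) := fun x => (hci x).abs.add (hsi x).abs
  have hL : 0 < 2 * M := by positivity
  have hn1 : ∀ (a : ℂ) (y : ℝ), ‖Complex.I * a * (1 - c y)‖ = ‖a‖ * |1 - c y| := by
    intro a y
    rw [norm_mul, norm_mul, Complex.norm_I, one_mul, ← Complex.ofReal_one, ← Complex.ofReal_sub,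
      Complex.norm_real, Real.norm_eq_abs]
  have hn2 : ∀ (b : ℂ) (y : ℝ), ‖Complex.I * b * s y‖ = ‖b‖ * |s y| := by
    intro b y
    rw [norm_mul, norm_mul, Complex.norm_I, one_mul, Complex.norm_real, Real.norm_eq_abs]
  have hbound : ∀ (a b : ℂ) (y : ℝ) (D : ℝ), ‖a‖ + ‖b‖ ≤ D →
      ‖a‖ * |1 - c y| + ‖b‖ * |s y| ≤ D * k y := by
    intro a b y D h
    have h1 := abs_nonneg (1 - c y)
    have h2 := abs_nonneg (s y)
    have h3 := norm_nonneg a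
    have h4 := norm_nonneg b
    simp only [hk_def]
    nlinarith
  have hD1 : ∀ a b : ℂ, ‖a‖ + ‖b‖ ≤ M → ∀ y : ℝ,
      ‖Complex.I * a * (1 - c y)‖ + ‖Complex.I * b * s y‖ ≤ M * k y := by
    intro a b h y
    rw [hn1, hn2]; exact hbound a b y M h
  have hD2 : ∀ a b : ℂ, ‖a‖ + ‖b‖ ≤ M → ∀ y : ℝ,
      ‖Complex.I * b * s y‖ + ‖-(Complex.I * a * (1 - c y))‖ ≤ M * k y := by
    intro a b h y
    rw [norm_neg, hn1, hn2, add_comm]; exact hbound a b y M h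
  have hE1 : ∀ a b a' b' : ℂ, ∀ y : ℝ,
      ‖Complex.I * a * (1 - c y) - Complex.I * a' * (1 - c y)‖ +
        ‖Complex.I * b * s y - Complex.I * b' * s y‖ ≤ (‖a - a'‖ + ‖b - b'‖) * k y := by
    intro a b a' b' y
    rw [← sub_mul, ← mul_sub, ← sub_mul, ← mul_sub, hn1, hn2]
    exact hbound _ _ y _ le_rfl
  have hE2 : ∀ a b a' b' : ℂ, ∀ y : ℝ,
      ‖Complex.I * b * s y - Complex.I * b' * s y‖ +
        ‖-(Complex.I * a * (1 - c y)) - -(Complex.I * a' * (1 - c y))‖ ≤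
          (‖a - a'‖ + ‖b - b'‖) * k y := by
    intro a b a' b' y
    rw [add_comm, neg_sub_neg, norm_sub_rev]
    exact hE1 a b a' b' y
  have hp : ∀ a : ℂ, Continuous fun y : ℝ => Complex.I * a * (1 - c y) := fun a => by fun_prop
  have hpn : ∀ a : ℂ, Continuous fun y : ℝ => -(Complex.I * a * (1 - c y)) := fun a => by fun_prop
  have hq : ∀ b : ℂ, Continuous fun y : ℝ => Complex.I * b * s y := fun b => by fun_prop
  -- The map has to be total in `a` and `b`; outside the admissible parameters it takes the junk
  -- value 0.
  have hex : ∀ (a b : ℂ) (ν : BoundedPair), ∃ f : BoundedPair, 0 < a.im → ‖a‖ + ‖b‖ ≤ M →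
      (∀ x, f.1 x = (1 + expConv 0 (source (fun y => Complex.I * a * (1 - c y))
        (fun y => Complex.I * b * s y) (weight k (2 * M)) ν) x) / weight k (2 * M) x) ∧
      (∀ x, f.2 x = (0 + expConv a (source (fun y => Complex.I * b * s y)
        (fun y => -(Complex.I * a * (1 - c y))) (weight k (2 * M)) ν) x) /
          weight k (2 * M) x) := by
    intro a b ν
    by_cases h : 0 < a.im ∧ ‖a‖ + ‖b‖ ≤ M
    · obtain ⟨f, hf⟩ := exists_boundedConv hk hk0 hi (a := 0) le_rfl hL (hp a) (hq b)
        (hD1 a b h.2) hM.le ν 1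
      obtain ⟨g, hg⟩ := exists_boundedConv hk hk0 hi h.1.le hL (hq b) (hpn a)
        (hD2 a b h.2) hM.le ν 0
      exact ⟨(f, g), fun _ _ => ⟨hf, hg⟩⟩
    · exact ⟨0, fun h1 h2 => absurd ⟨h1, h2⟩ h⟩
  choose F hF using hex
  refine ⟨F, fun a b ha hab => ⟨fun ν => (hF a b ν ha hab).1, fun ν => (hF a b ν ha hab).2, ?_, ?_⟩⟩
  · intro ν ν'
    have hhalf : M / (2 * M) = 1 / 2 := by field_simp
    rw [dist_eq_norm ν, Prod.dist_eq]
    refine max_le ?_ ?_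
    · refine (BoundedContinuousFunction.dist_le (by positivity)).2 fun x => ?_
      rw [dist_eq_norm, (hF a b ν ha hab).1, (hF a b ν' ha hab).1, ← hhalf]
      exact norm_boundedConv_sub_le hk hk0 hi le_rfl hL (hp a) (hq b) (hD1 a b hab) hM.le ν ν' 1 x
    · refine (BoundedContinuousFunction.dist_le (by positivity)).2 fun x => ?_
      rw [dist_eq_norm, (hF a b ν ha hab).2, (hF a b ν' ha hab).2, ← hhalf]
      exact norm_boundedConv_sub_le hk hk0 hi ha.le hL (hq b) (hpn a) (hD2 a b hab) hM.le ν ν' 0 x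
  · intro a' b' m hm ham ham' hab' ν
    have hhalf : M / (2 * M) = 1 / 2 := by field_simp
    have e1 : 0 ≤ ‖a - a'‖ := norm_nonneg _
    have e2 : 0 ≤ ‖b - b'‖ := norm_nonneg _
    have e3 : (‖a - a'‖ + ‖b - b'‖) / (2 * M) ≤ 1 / M * (‖a - a'‖ + ‖b - b'‖) := by
      rw [one_div_mul_eq_div]
      gcongr
      linarith
    have e4 : ‖a - a'‖ / m * (M / (2 * M)) ≤ 1 / m * (‖a - a'‖ + ‖b - b'‖) := by
      rw [hhalf, one_div_mul_eq_div, ← div_eq_mul_one_div]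
      refine (div_le_self (by positivity) one_le_two).trans ?_
      gcongr
      linarith
    have e5 : 0 ≤ 1 / m * (‖a - a'‖ + ‖b - b'‖) := by positivity
    rw [Prod.dist_eq]
    refine max_le ?_ ?_
    · refine (BoundedContinuousFunction.dist_le (by positivity)).2 fun x => ?_
      rw [dist_eq_norm, (hF a b ν ha hab).1, (hF a' b' ν (hm.trans_le ham') hab').1]
      refine (norm_boundedConv_sub_coeff_le' hk hk0 hi hL (hp a) (hq b) (hp a') (hq b')
        (hD1 a b hab) (hD1 a' b' hab') (hE1 a b a' b') (by positivity) ν 1 x).trans ?_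
      refine mul_le_mul_of_nonneg_right ?_ (norm_nonneg _)
      linarith
    · refine (BoundedContinuousFunction.dist_le (by positivity)).2 fun x => ?_
      rw [dist_eq_norm, (hF a b ν ha hab).2, (hF a' b' ν (hm.trans_le ham') hab').2]
      refine (norm_boundedConv_sub_coeff_le hk hk0 hi hm ham ham' hL (hq b) (hpn a) (hq b')
        (hpn a') (hD2 a b hab) hM.le (hD2 a' b' hab') (hE2 a b a' b') (by positivity) ν 0 x).trans ?_
      refine mul_le_mul_of_nonneg_right ?_ (norm_nonneg _)
      linarith

/-- Solutions of the equation for the Jost solutions with the leading exponential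
`exp (-i a x)` factored out, normalised to `(1, 0)` at `-∞`, with estimates that are uniform in
the parameters. -/
theorem exists_reducedJost {c s : ℝ → ℝ} (hc : Continuous c) (hs : Continuous s)
    (hci : ∀ x, IntegrableOn (fun y => 1 - c y) (Iic x)) (hsi : ∀ x, IntegrableOn s (Iic x))
    {M : ℝ} (hM : 0 < M) :
    ∃ (μ₁ μ₂ : ℂ → ℂ → ℝ → ℂ) (w : ℝ → ℝ), Monotone w ∧
      ∀ a b : ℂ, 0 < a.im → ‖a‖ + ‖b‖ ≤ M →
      (∀ x, HasDerivAt (μ₁ a b) (Complex.I * a * (1 - c x) * μ₁ a b x +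
        Complex.I * b * s x * μ₂ a b x) x) ∧
      (∀ x, HasDerivAt (μ₂ a b) (Complex.I * b * s x * μ₁ a b x -
        Complex.I * a * (1 - c x) * μ₂ a b x + 2 * Complex.I * a * μ₂ a b x) x) ∧
      Tendsto (μ₁ a b) atBot (𝓝 1) ∧ Tendsto (μ₂ a b) atBot (𝓝 0) ∧
      (∀ x, ‖μ₁ a b x‖ ≤ w x ∧ ‖μ₂ a b x‖ ≤ w x) ∧
      ∀ a' b' : ℂ, ∀ m : ℝ, 0 < m → m ≤ a.im → m ≤ a'.im → ‖a'‖ + ‖b'‖ ≤ M → ∀ x,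
        ‖μ₁ a b x - μ₁ a' b' x‖ ≤ (1 / m + 1 / M) * (‖a - a'‖ + ‖b - b'‖) * 2 * w x ∧
        ‖μ₂ a b x - μ₂ a' b' x‖ ≤ (1 / m + 1 / M) * (‖a - a'‖ + ‖b - b'‖) * 2 * w x := by
  obtain ⟨F, hF⟩ := exists_volterraMap hc hs hci hsi hM
  set k : ℝ → ℝ := fun y => |1 - c y| + |s y| with hk_def
  have hk : Continuous k := by fun_prop
  have hk0 : ∀ x, 0 ≤ k x := fun x => by positivity
  have hi : ∀ x, IntegrableOn k (Iic x) := fun x => (hci x).abs.add (hsi x).abs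
  have hL : 0 < 2 * M := by positivity
  set w := weight k (2 * M) with hw_def
  have hw1 : ∀ x, 1 ≤ w x := one_le_weight hk0 hL.le
  have hw0 : ∀ x, (w x : ℂ) ≠ 0 := fun x => Complex.ofReal_ne_zero.2 (weight_pos k _ x).ne'
  have hcontr : ∀ a b : ℂ, 0 < a.im → ‖a‖ + ‖b‖ ≤ M →
      ContractingWith (1 / 2) (F a b) := by
    intro a b ha hab
    refine ⟨by rw [← NNReal.coe_lt_coe]; norm_num, LipschitzWith.of_dist_le_mul fun ν ν' => ?_⟩
    simpa using (hF a b ha hab).2.2.1 ν ν'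
  have hfix : ∀ a b : ℂ, ∃ ν : BoundedPair, 0 < a.im → ‖a‖ + ‖b‖ ≤ M → F a b ν = ν := by
    intro a b
    by_cases h : 0 < a.im ∧ ‖a‖ + ‖b‖ ≤ M
    · exact ⟨_, fun _ _ => (hcontr a b h.1 h.2).fixedPoint_isFixedPt⟩
    · exact ⟨0, fun h1 h2 => absurd ⟨h1, h2⟩ h⟩
  choose ν hν using hfix
  have hhalf : (1 - ((1 / 2 : NNReal) : ℝ)) = 1 / 2 := by norm_num
  -- The first iterate from 0 is (1/w, 0), of norm at most 1, and contraction with ratio 1/2 puts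
  -- the fixed point within twice that distance.
  have hνn : ∀ a b : ℂ, 0 < a.im → ‖a‖ + ‖b‖ ≤ M → ‖ν a b‖ ≤ 2 := by
    intro a b ha hab
    have h := (hcontr a b ha hab).dist_le_of_fixedPoint 0 (hν a b ha hab)
    rw [dist_zero_left, dist_zero_left, hhalf] at h
    have h0 : ‖F a b 0‖ ≤ 1 := by
      have hz : ∀ p q : ℝ → ℂ, source p q w 0 = fun _ => 0 := by
        intro p q; funext y; simp [source]
      have hez : ∀ a x, expConv a (fun _ => 0) x = 0 := by
        intro a x; simp [expConv]
      rw [Prod.norm_def]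
      refine max_le ?_ ?_
      · refine (BoundedContinuousFunction.norm_le zero_le_one).2 fun x => ?_
        rw [(hF a b ha hab).1, hz, hez, add_zero, norm_div, norm_one, Complex.norm_real,
          Real.norm_of_nonneg (zero_le_one.trans (hw1 x))]
        exact div_le_one_of_le₀ (hw1 x) (zero_le_one.trans (hw1 x))
      · refine (BoundedContinuousFunction.norm_le zero_le_one).2 fun x => ?_
        rw [(hF a b ha hab).2.1, hz, hez]
        simp
    linarith [h, h0]
  have hval : ∀ (f : BoundedPair) x, ‖(w x : ℂ) * f.1 x‖ ≤ ‖f‖ * w x ∧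
      ‖(w x : ℂ) * f.2 x‖ ≤ ‖f‖ * w x := by
    intro f x
    have hwx : 0 ≤ w x := zero_le_one.trans (hw1 x)
    constructor
    · rw [norm_mul, Complex.norm_real, Real.norm_of_nonneg hwx, mul_comm]
      exact mul_le_mul_of_nonneg_right ((f.1.norm_coe_le_norm x).trans (norm_fst_le f)) hwx
    · rw [norm_mul, Complex.norm_real, Real.norm_of_nonneg hwx, mul_comm]
      exact mul_le_mul_of_nonneg_right ((f.2.norm_coe_le_norm x).trans (norm_snd_le f)) hwx
  have hpn : ∀ (a b : ℂ) (y : ℝ), ‖Complex.I * a * (1 - c y)‖ + ‖Complex.I * b * s y‖ ≤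
      (‖a‖ + ‖b‖) * k y := by
    intro a b y
    have hn1 : ‖Complex.I * a * (1 - c y)‖ = ‖a‖ * |1 - c y| := by
      rw [norm_mul, norm_mul, Complex.norm_I, one_mul, ← Complex.ofReal_one, ← Complex.ofReal_sub,
        Complex.norm_real, Real.norm_eq_abs]
    have hn2 : ‖Complex.I * b * s y‖ = ‖b‖ * |s y| := by
      rw [norm_mul, norm_mul, Complex.norm_I, one_mul, Complex.norm_real, Real.norm_eq_abs]
    rw [hn1, hn2]
    simp only [hk_def]
    nlinarith [abs_nonneg (1 - c y), abs_nonneg (s y), norm_nonneg a, norm_nonneg b,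
      mul_nonneg (norm_nonneg a) (abs_nonneg (s y)), mul_nonneg (norm_nonneg b)
        (abs_nonneg (1 - c y))]
  have hmono := monotone_weight (L := 2 * M) hk0 hi hL.le
  refine ⟨fun a b x => w x * (ν a b).1 x, fun a b x => w x * (ν a b).2 x, fun x => 2 * w x,
    fun x y h => mul_le_mul_of_nonneg_left (hmono h) zero_le_two, fun a b ha hab => ?_⟩
  set f := ν a b with hf_def
  set p : ℝ → ℂ := fun y => Complex.I * a * (1 - c y) with hp_def
  set q : ℝ → ℂ := fun y => Complex.I * b * s y with hq_def
  have hpc : Continuous p := by fun_prop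
  have hqc : Continuous q := by fun_prop
  have hD1 : ∀ y, ‖p y‖ + ‖q y‖ ≤ (‖a‖ + ‖b‖) * k y := hpn a b
  have hD2 : ∀ y, ‖q y‖ + ‖-p y‖ ≤ (‖a‖ + ‖b‖) * k y := fun y => by
    rw [norm_neg, add_comm]; exact hpn a b y
  have h1 : (fun x => (w x : ℂ) * f.1 x) = fun x => 1 + expConv 0 (source p q w f) x := by
    funext x
    have := (hF a b ha hab).1 f x
    rw [hν a b ha hab] at this
    rw [this, mul_div_cancel₀ _ (hw0 x)]
  have h2 : (fun x => (w x : ℂ) * f.2 x) =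
      fun x => expConv a (source q (-p) w f) x := by
    funext x
    have := (hF a b ha hab).2.1 f x
    rw [hν a b ha hab] at this
    rw [this, zero_add, mul_div_cancel₀ _ (hw0 x)]
    rfl
  have hs1 := continuous_source (L := 2 * M) hk hi hpc hqc f
  have hs2 := continuous_source (L := 2 * M) hk hi hqc hpc.neg f
  have hi1 := integrableOn_source hk hk0 hi hL.le hpc hqc hD1 f
  have hi2 := integrableOn_source hk hk0 hi hL.le hqc hpc.neg hD2 f
  have hlim : Tendsto (fun x => (‖a‖ + ‖b‖) / (2 * M) * ‖f‖ * (w x - 1)) atBot (𝓝 0) := by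
    have := ((tendsto_weight_atBot k (2 * M)).sub_const 1).const_mul
      ((‖a‖ + ‖b‖) / (2 * M) * ‖f‖)
    simpa using this
  beta_reduce
  rw [← hf_def]
  refine ⟨fun x => ?_, fun x => ?_, ?_, ?_, fun x => ?_, ?_⟩
  · rw [h1]
    refine ((hasDerivAt_expConv le_rfl hs1 hi1 x).const_add 1).congr_deriv ?_
    simp only [source, hw_def]
    ring
  · have := congrFun h2 x
    rw [h2]
    refine (hasDerivAt_expConv ha.le hs2 hi2 x).congr_deriv ?_
    rw [← this]
    simp only [source, hw_def, Pi.neg_apply]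
    ring
  · rw [h1]
    have : Tendsto (fun x => expConv 0 (source p q w f) x) atBot (𝓝 0) :=
      squeeze_zero_norm (fun x => (norm_expConv_le le_rfl (hi1 x)).trans
        (integral_norm_source_le hk hk0 hi hL hpc hqc hD1 f x)) hlim
    simpa using this.const_add 1
  · rw [h2]
    exact squeeze_zero_norm (fun x => (norm_expConv_le ha.le (hi2 x)).trans
        (integral_norm_source_le hk hk0 hi hL hqc hpc.neg hD2 f x)) hlim
  · have hw0' := zero_le_one.trans (hw1 x)
    have := hνn a b ha hab
    exact ⟨((hval f x).1).trans (by gcongr), ((hval f x).2).trans (by gcongr)⟩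
  · intro a' b' m hm ham ham' hab' x
    have ha' := hm.trans_le ham'
    have hd := (hcontr a b ha hab).dist_le_of_fixedPoint (ν a' b') (hν a b ha hab)
    rw [hhalf] at hd
    have hd2 := (hF a b ha hab).2.2.2 a' b' m hm ham ham' hab' (ν a' b')
    rw [hν a' b' ha' hab', dist_comm] at hd2
    have hn := hνn a' b' ha' hab'
    have hK : 0 ≤ (1 / m + 1 / M) * (‖a - a'‖ + ‖b - b'‖) := by positivity
    -- The 4 is a factor 2 = 1/(1 - 1/2) from the contraction times the bound 2 for the norm of `ν
    -- a' b'`.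
    have hd3 : ‖f - ν a' b'‖ ≤ (1 / m + 1 / M) * (‖a - a'‖ + ‖b - b'‖) * 4 := by
      rw [← dist_eq_norm, dist_comm]
      refine hd.trans ?_
      rw [div_le_iff₀ (by norm_num)]
      nlinarith
    have hv := hval (f - ν a' b') x
    have hw0' := zero_le_one.trans (hw1 x)
    have hfin : ‖f - ν a' b'‖ * w x ≤
        (1 / m + 1 / M) * (‖a - a'‖ + ‖b - b'‖) * 2 * (2 * w x) := by
      nlinarith [mul_le_mul_of_nonneg_right hd3 hw0']
    rw [← mul_sub, ← mul_sub]
    exact ⟨hv.1.trans hfin, hv.2.trans hfin⟩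

end Family

/-! ### The scattering system and its Jost solutions at `-∞` -/

section System

/-- The scattering system, written in components with coefficient functions `c` and `s` and
parameters `a` and `b`. -/
def IsSystemSolution (c s : ℝ → ℝ) (a b : ℂ) (y₁ y₂ : ℝ → ℂ) : Prop :=
  (∀ x, HasDerivAt y₁ (-Complex.I * a * c x * y₁ x + Complex.I * b * s x * y₂ x) x) ∧
    ∀ x, HasDerivAt y₂ (Complex.I * b * s x * y₁ x + Complex.I * a * c x * y₂ x) x

/-- Coefficient functions of a potential that vanishes at `-∞`. -/
structure IsLeftData (c s : ℝ → ℝ) : Prop where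
  continuous_c : Continuous c
  continuous_s : Continuous s
  abs_c_le : ∀ x, |c x| ≤ 1
  abs_s_le : ∀ x, |s x| ≤ 1
  integrableOn_c : ∀ x, IntegrableOn (fun y => 1 - c y) (Iic x)
  integrableOn_s : ∀ x, IntegrableOn s (Iic x)

/-- The solution of the system normalised at `-∞`. -/
structure IsLeftSystemJost (c s : ℝ → ℝ) (a b : ℂ) (y₁ y₂ : ℝ → ℂ) : Prop where
  isSolution : IsSystemSolution c s a b y₁ y₂
  tendsto_fst : Tendsto (fun x => y₁ x * Complex.exp (Complex.I * a * (∫ t in (0 : ℝ)..x, c t : ℝ)))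
    atBot (𝓝 1)
  tendsto_snd : Tendsto (fun x => y₂ x * Complex.exp (Complex.I * a * (∫ t in (0 : ℝ)..x, c t : ℝ)))
    atBot (𝓝 0)

variable {c s : ℝ → ℝ} {a b : ℂ} {y₁ y₂ z₁ z₂ : ℝ → ℂ}

/-- Liouville's formula: the coefficient matrix has trace zero. -/
theorem IsSystemSolution.wronskian_eq (hy : IsSystemSolution c s a b y₁ y₂)
    (hz : IsSystemSolution c s a b z₁ z₂) (x x' : ℝ) :
    y₁ x * z₂ x - y₂ x * z₁ x = y₁ x' * z₂ x' - y₂ x' * z₁ x' := by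
  have h : ∀ x, HasDerivAt (fun x => y₁ x * z₂ x - y₂ x * z₁ x) 0 x := by
    intro x
    refine (((hy.1 x).mul (hz.2 x)).sub ((hy.2 x).mul (hz.1 x))).congr_deriv ?_
    ring
  exact is_const_of_deriv_eq_zero (fun x => (h x).differentiableAt) (fun x => (h x).deriv) x x'

theorem IsSystemSolution.eq_of_eq_at (hc : ∀ x, |c x| ≤ 1) (hs : ∀ x, |s x| ≤ 1)
    (hy : IsSystemSolution c s a b y₁ y₂) (hz : IsSystemSolution c s a b z₁ z₂) {x₀ : ℝ}
    (h1 : y₁ x₀ = z₁ x₀) (h2 : y₂ x₀ = z₂ x₀) : y₁ = z₁ ∧ y₂ = z₂ := by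
  let v : ℝ → ℂ × ℂ → ℂ × ℂ := fun x p => (-Complex.I * a * c x * p.1 + Complex.I * b * s x * p.2,
    Complex.I * b * s x * p.1 + Complex.I * a * c x * p.2)
  have hbound : ∀ (x : ℝ) (p q : ℂ), ‖a * c x * p‖ + ‖b * s x * q‖ ≤
      (‖a‖ + ‖b‖) * max ‖p‖ ‖q‖ := by
    intro x p q
    simp only [norm_mul, Complex.norm_real, Real.norm_eq_abs]
    have e1 : ‖a‖ * |c x| * ‖p‖ ≤ ‖a‖ * 1 * max ‖p‖ ‖q‖ := by
      gcongr
      · exact hc x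
      · exact le_max_left _ _
    have e2 : ‖b‖ * |s x| * ‖q‖ ≤ ‖b‖ * 1 * max ‖p‖ ‖q‖ := by
      gcongr
      · exact hs x
      · exact le_max_right _ _
    linarith
  have hv : ∀ x, LipschitzOnWith (‖a‖₊ + ‖b‖₊) (v x) univ := by
    intro x
    refine (LipschitzWith.of_dist_le_mul fun p q => ?_).lipschitzOnWith
    rw [dist_eq_norm, dist_eq_norm, Prod.norm_def (p - q), NNReal.coe_add, coe_nnnorm, coe_nnnorm,
      Prod.norm_def]
    refine max_le ?_ ?_
    · have e : (v x p - v x q).1 = -Complex.I * (a * c x * (p - q).1) +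
          Complex.I * (b * s x * (p - q).2) := by
        simp only [v, Prod.fst_sub, Prod.snd_sub]; ring
      rw [e]
      refine (norm_add_le _ _).trans ?_
      rw [norm_mul, norm_mul Complex.I, norm_neg, Complex.norm_I, one_mul, one_mul]
      exact hbound x _ _
    · have e : (v x p - v x q).2 = Complex.I * (b * s x * (p - q).1) +
          Complex.I * (a * c x * (p - q).2) := by
        simp only [v, Prod.fst_sub, Prod.snd_sub]; ring
      rw [e]
      refine (norm_add_le _ _).trans ?_
      rw [norm_mul, norm_mul Complex.I, Complex.norm_I, one_mul, one_mul, add_comm, max_comm]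
      exact hbound x _ _
  have h := ODE_solution_unique_univ (v := v) (s := fun _ => univ) (t₀ := x₀)
    (f := fun x => (y₁ x, y₂ x)) (g := fun x => (z₁ x, z₂ x)) hv
    (fun x => ⟨(hy.1 x).prodMk (hy.2 x), mem_univ _⟩)
    (fun x => ⟨(hz.1 x).prodMk (hz.2 x), mem_univ _⟩) (by simp [h1, h2])
  exact ⟨funext fun x => congrArg Prod.fst (congrFun h x),
    funext fun x => congrArg Prod.snd (congrFun h x)⟩

theorem IsSystemSolution.const_mul (hy : IsSystemSolution c s a b y₁ y₂) (l : ℂ) :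
    IsSystemSolution c s a b (fun x => l * y₁ x) (fun x => l * y₂ x) :=
  ⟨fun x => ((hy.1 x).const_mul l).congr_deriv (by ring),
    fun x => ((hy.2 x).const_mul l).congr_deriv (by ring)⟩

theorem isSystemSolution_zero : IsSystemSolution c s a b (fun _ => 0) (fun _ => 0) :=
  ⟨fun x => by simpa using hasDerivAt_const x (0 : ℂ),
    fun x => by simpa using hasDerivAt_const x (0 : ℂ)⟩

/-- Solutions with vanishing Wronskian are proportional. -/
theorem IsSystemSolution.exists_eq_mul (hc : ∀ x, |c x| ≤ 1) (hs : ∀ x, |s x| ≤ 1)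
    (hy : IsSystemSolution c s a b y₁ y₂) (hz : IsSystemSolution c s a b z₁ z₂) {x₀ : ℝ}
    (hne : y₁ x₀ ≠ 0 ∨ y₂ x₀ ≠ 0) (hw : y₁ x₀ * z₂ x₀ - y₂ x₀ * z₁ x₀ = 0) :
    ∃ l : ℂ, (∀ x, z₁ x = l * y₁ x) ∧ ∀ x, z₂ x = l * y₂ x := by
  have key : ∀ l : ℂ, z₁ x₀ = l * y₁ x₀ → z₂ x₀ = l * y₂ x₀ →
      ∃ l : ℂ, (∀ x, z₁ x = l * y₁ x) ∧ ∀ x, z₂ x = l * y₂ x := by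
    intro l h1 h2
    obtain ⟨e1, e2⟩ := hz.eq_of_eq_at hc hs (hy.const_mul l) h1 h2
    exact ⟨l, fun x => congrFun e1 x, fun x => congrFun e2 x⟩
  rcases hne with h | h
  · refine key (z₁ x₀ / y₁ x₀) (by field_simp) ?_
    field_simp
    linear_combination hw
  · refine key (z₂ x₀ / y₂ x₀) ?_ (by field_simp)
    field_simp
    linear_combination -hw

/-- As 1 - c is integrable at `-∞`, the phase ∫₀ˣ c differs from x by a convergent quantity. -/
theorem IsLeftData.tendsto_integral (h : IsLeftData c s) :
    Tendsto (fun x => ∫ t in (0 : ℝ)..x, c t) atBot atBot := by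
  have h1 : Tendsto (fun x => ∫ t in Iic x, (1 - c t)) atBot (𝓝 0) :=
    tendsto_integral_Iic_zero tendsto_id
  have h2 : (fun x => ∫ t in (0 : ℝ)..x, c t) =
      fun x => x + ((∫ t in Iic (0 : ℝ), (1 - c t)) - ∫ t in Iic x, (1 - c t)) := by
    funext x
    have e := intervalIntegral.integral_Iic_sub_Iic (h.integrableOn_c 0) (h.integrableOn_c x)
    rw [intervalIntegral.integral_sub intervalIntegrable_const
      (h.continuous_c.intervalIntegrable _ _)] at e
    simp at e
    linarith
  rw [h2]
  exact tendsto_id.atBot_add (tendsto_const_nhds.sub h1)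

theorem IsLeftData.tendsto_exp (h : IsLeftData c s) (ha : 0 < a.im) :
    Tendsto (fun x => Complex.exp (-(Complex.I * a * (∫ t in (0 : ℝ)..x, c t : ℝ)))) atBot (𝓝 0) := by
  rw [tendsto_zero_iff_norm_tendsto_zero]
  simp only [Complex.norm_exp]
  have : ∀ x : ℝ, (-(Complex.I * a * (∫ t in (0 : ℝ)..x, c t : ℝ))).re =
      a.im * ∫ t in (0 : ℝ)..x, c t := by
    intro x; simp [Complex.mul_re, Complex.mul_im]
  simp only [this]
  exact Real.tendsto_exp_atBot.comp (h.tendsto_integral.const_mul_atBot ha)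

theorem IsLeftSystemJost.tendsto_zero (hd : IsLeftData c s) (ha : 0 < a.im)
    (h : IsLeftSystemJost c s a b y₁ y₂) :
    Tendsto y₁ atBot (𝓝 0) ∧ Tendsto y₂ atBot (𝓝 0) := by
  have h1 := h.tendsto_fst.mul (hd.tendsto_exp ha)
  have h2 := h.tendsto_snd.mul (hd.tendsto_exp ha)
  simp only [mul_assoc, ← Complex.exp_add, add_neg_cancel, Complex.exp_zero, mul_one,
    mul_zero] at h1 h2
  exact ⟨h1, h2⟩

theorem IsLeftSystemJost.exists_ne_zero (h : IsLeftSystemJost c s a b y₁ y₂) :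
    ∃ x, y₁ x ≠ 0 := by
  by_contra! h0
  have := h.tendsto_fst
  simp only [h0, zero_mul] at this
  exact zero_ne_one (tendsto_nhds_unique tendsto_const_nhds this)

/-- Two such solutions decay at `-∞`, so their constant Wronskian is 0 and they are proportional;
the normalisation of the first component makes the factor 1. -/
theorem IsLeftSystemJost.unique (hd : IsLeftData c s) (ha : 0 < a.im)
    (hy : IsLeftSystemJost c s a b y₁ y₂) (hz : IsLeftSystemJost c s a b z₁ z₂) :
    z₁ = y₁ ∧ z₂ = y₂ := by
  obtain ⟨x₀, hx₀⟩ := hy.exists_ne_zero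
  obtain ⟨t1, t2⟩ := hy.tendsto_zero hd ha
  obtain ⟨t3, t4⟩ := hz.tendsto_zero hd ha
  have hw : y₁ x₀ * z₂ x₀ - y₂ x₀ * z₁ x₀ = 0 := by
    have h1 := (t1.mul t4).sub (t2.mul t3)
    simp only [hy.isSolution.wronskian_eq hz.isSolution _ x₀] at h1
    simpa using tendsto_nhds_unique tendsto_const_nhds h1
  obtain ⟨l, h1, h2⟩ := hy.isSolution.exists_eq_mul hd.abs_c_le hd.abs_s_le hz.isSolution
    (Or.inl hx₀) hw
  have hl : l = 1 := by
    have e1 := hy.tendsto_fst.const_mul l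
    have e2 := hz.tendsto_fst
    simp only [h1, mul_assoc] at e2
    simp only [mul_one] at e1
    exact (tendsto_nhds_unique e1 (by simpa only [mul_assoc] using e2))
  subst hl
  exact ⟨funext fun x => by rw [h1, one_mul], funext fun x => by rw [h2, one_mul]⟩

/-- The Jost solutions at `-∞` with estimates uniform in the parameters. -/
theorem IsLeftData.exists_jost (hd : IsLeftData c s) {M : ℝ} (hM : 0 < M) :
    ∃ y₁ y₂ : ℂ → ℂ → ℝ → ℂ, ∃ C : ℝ, 0 ≤ C ∧ ∀ a b : ℂ, 0 < a.im → ‖a‖ + ‖b‖ ≤ M →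
      IsLeftSystemJost c s a b (y₁ a b) (y₂ a b) ∧
      (∀ x ≤ 0, ‖y₁ a b x‖ ≤ C * Real.exp (a.im * x) ∧ ‖y₂ a b x‖ ≤ C * Real.exp (a.im * x)) ∧
      ∀ x, ∃ K : ℝ, ∀ a' b' : ℂ, a.im / 2 ≤ a'.im → ‖a'‖ + ‖b'‖ ≤ M →
        ‖y₁ a' b' x - y₁ a b x‖ ≤ K * (‖a' - a‖ + ‖b' - b‖) ∧
        ‖y₂ a' b' x - y₂ a b x‖ ≤ K * (‖a' - a‖ + ‖b' - b‖) := by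
  obtain ⟨μ₁, μ₂, w, hw, hμ⟩ :=
    exists_reducedJost hd.continuous_c hd.continuous_s hd.integrableOn_c hd.integrableOn_s hM
  -- This constant is the limit of ∫₀ˣ c - x at `-∞`. It corrects the plain exponential exp(-iax) of
  -- the reduced equation to the phase used in the normalisation.
  set κ : ℝ := ∫ t in Iic (0 : ℝ), (1 - c t) with hκ
  have hphase : ∀ x : ℝ, ∫ t in (0 : ℝ)..x, c t = x + κ - ∫ t in Iic x, (1 - c t) := by
    intro x
    have e := intervalIntegral.integral_Iic_sub_Iic (hd.integrableOn_c 0) (hd.integrableOn_c x)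
    rw [intervalIntegral.integral_sub intervalIntegrable_const
      (hd.continuous_c.intervalIntegrable _ _)] at e
    simp at e
    linarith
  let E : ℂ → ℝ → ℂ := fun a x => Complex.exp (-(Complex.I * a * (x + κ)))
  have hEre : ∀ (a : ℂ) (x : ℝ), (-(Complex.I * a * (x + κ))).re = a.im * (x + κ) := by
    intro a x; simp [Complex.mul_re, Complex.mul_im]
  have hE : ∀ (a : ℂ) (x : ℝ), ‖E a x‖ = Real.exp (a.im * κ) * Real.exp (a.im * x) := by
    intro a x
    rw [Complex.norm_exp, hEre, ← Real.exp_add]; ring_nf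
  have hEd : ∀ (a : ℂ) (x : ℝ), HasDerivAt (E a) (E a x * (-(Complex.I * a))) x := by
    intro a x
    have h1 : HasDerivAt (fun x : ℝ => -(Complex.I * a * ((x : ℂ) + κ))) (-(Complex.I * a)) x := by
      have := ((((hasDerivAt_id x).ofReal_comp).add_const (κ : ℂ)).const_mul (Complex.I * a)).neg
      exact this.congr_deriv (by simp)
    exact h1.cexp
  have him : ∀ a b : ℂ, ‖a‖ + ‖b‖ ≤ M → |a.im| ≤ M := fun a b h =>
    (Complex.abs_im_le_norm a).trans (by linarith [norm_nonneg b])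
  have hlim : ∀ a : ℂ, Tendsto (fun x : ℝ =>
      E a x * Complex.exp (Complex.I * a * (∫ t in (0 : ℝ)..x, c t : ℝ))) atBot (𝓝 1) := by
    intro a
    have h1 : Tendsto (fun x => ∫ t in Iic x, (1 - c t)) atBot (𝓝 0) :=
      tendsto_integral_Iic_zero tendsto_id
    have h2 : Tendsto (fun x : ℝ => Complex.exp (-(Complex.I * a * (∫ t in Iic x, (1 - c t) : ℝ))))
        atBot (𝓝 (Complex.exp (-(Complex.I * a * ((0 : ℝ) : ℂ))))) :=
      (Complex.continuous_exp.tendsto _).comp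
        ((((Complex.continuous_ofReal.tendsto 0).comp h1).const_mul (Complex.I * a)).neg)
    simp only [Complex.ofReal_zero, mul_zero, neg_zero, Complex.exp_zero] at h2
    refine h2.congr fun x => ?_
    simp only [E]
    rw [← Complex.exp_add, hphase]
    push_cast
    ring_nf
  -- Only the bounds by `w` are available, so nonnegativity is read off at one admissible pair of
  -- parameters, (iM, 0).
  have hw0 : 0 ≤ w 0 := by
    have h1 : (0 : ℝ) < (Complex.I * (M : ℂ)).im := by simpa using hM
    have := ((hμ (Complex.I * M) 0 h1 (by simp [abs_of_pos hM])).2.2.2.2.1 0).1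
    exact (norm_nonneg _).trans this
  refine ⟨fun a b x => E a x * μ₁ a b x, fun a b x => E a x * μ₂ a b x,
    Real.exp (M * |κ|) * w 0, by positivity, fun a b ha hab => ?_⟩
  obtain ⟨d1, d2, t1, t2, bd, lip⟩ := hμ a b ha hab
  have hcoef : ∀ a b : ℂ, ‖a‖ + ‖b‖ ≤ M → Real.exp (a.im * κ) ≤ Real.exp (M * |κ|) := by
    intro a b h
    refine Real.exp_le_exp.2 ((le_abs_self _).trans ?_)
    rw [abs_mul]
    exact mul_le_mul_of_nonneg_right (him a b h) (abs_nonneg _)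
  refine ⟨⟨⟨fun x => ?_, fun x => ?_⟩, ?_, ?_⟩, fun x hx => ?_, fun x => ?_⟩
  · exact ((hEd a x).mul (d1 x)).congr_deriv (by ring)
  · exact ((hEd a x).mul (d2 x)).congr_deriv (by ring)
  · have := (hlim a).mul t1
    rw [one_mul] at this
    exact this.congr fun x => by ring
  · have := (hlim a).mul t2
    rw [one_mul] at this
    exact this.congr fun x => by ring
  · have hb := bd x
    have hwx := hw hx
    have e1 := hcoef a b hab
    constructor
    · rw [norm_mul, hE]
      calc _ ≤ Real.exp (M * |κ|) * Real.exp (a.im * x) * w 0 := by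
            gcongr; exact hb.1.trans hwx
        _ = _ := by ring
    · rw [norm_mul, hE]
      calc _ ≤ Real.exp (M * |κ|) * Real.exp (a.im * x) * w 0 := by
            gcongr; exact hb.2.trans hwx
        _ = _ := by ring
  · have hm : 0 < a.im / 2 := by positivity
    set B := Real.exp (M * |x + κ|) with hB
    have hre : ∀ a b : ℂ, ‖a‖ + ‖b‖ ≤ M → (-(Complex.I * a * (x + κ))).re ≤ M * |x + κ| := by
      intro a b h
      rw [hEre]
      refine (le_abs_self _).trans ?_
      rw [abs_mul]
      exact mul_le_mul_of_nonneg_right (him a b h) (abs_nonneg _)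
    have hEB : ∀ a b : ℂ, ‖a‖ + ‖b‖ ≤ M → ‖E a x‖ ≤ B := by
      intro a b h
      rw [Complex.norm_exp]
      exact Real.exp_le_exp.2 (hre a b h)
    set N := 1 / (a.im / 2) + 1 / M with hN
    have hN0 : 0 ≤ N := by positivity
    have key : ∀ a' b' : ℂ, ∀ m m' : ℂ, ‖a'‖ + ‖b'‖ ≤ M → ‖m‖ ≤ w x →
        ‖m' - m‖ ≤ N * (‖a' - a‖ + ‖b' - b‖) * 2 * w x →
        ‖E a' x * m' - E a x * m‖ ≤
          (B * |x + κ| * w x + B * (N * 2 * w x)) * (‖a' - a‖ + ‖b' - b‖) := by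
      intro a' b' m m' h hm hmm
      have hwx : 0 ≤ w x := (norm_nonneg _).trans hm
      have e1 : E a' x * m' - E a x * m = (E a' x - E a x) * m + E a' x * (m' - m) := by ring
      have e2 : ‖E a' x - E a x‖ ≤ B * (‖a' - a‖ * |x + κ|) := by
        refine (norm_cexp_sub_le (hre a' b' h) (hre a b hab)).trans (le_of_eq ?_)
        rw [neg_sub_neg, ← sub_mul, ← mul_sub, norm_mul, norm_mul, Complex.norm_I, one_mul,
          norm_sub_rev, ← Complex.ofReal_add, Complex.norm_real, Real.norm_eq_abs]
      rw [e1]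
      calc _ ≤ ‖E a' x - E a x‖ * ‖m‖ + ‖E a' x‖ * ‖m' - m‖ := by
            rw [← norm_mul, ← norm_mul]; exact norm_add_le _ _
        _ ≤ B * (‖a' - a‖ * |x + κ|) * w x +
            B * (N * (‖a' - a‖ + ‖b' - b‖) * 2 * w x) := by
            gcongr
            exact hEB a' b' h
        _ ≤ B * ((‖a' - a‖ + ‖b' - b‖) * |x + κ|) * w x +
            B * (N * (‖a' - a‖ + ‖b' - b‖) * 2 * w x) := by
            gcongr
            linarith [norm_nonneg (b' - b)]
        _ = _ := by ring
    refine ⟨B * |x + κ| * w x + B * (N * 2 * w x), fun a' b' ha' hab' => ?_⟩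
    have hl := lip a' b' (a.im / 2) hm (by linarith) ha' hab' x
    refine ⟨key a' b' _ _ hab' (bd x).1 ?_, key a' b' _ _ hab' (bd x).2 ?_⟩
    · rw [norm_sub_rev, norm_sub_rev a', norm_sub_rev b']; exact hl.1
    · rw [norm_sub_rev, norm_sub_rev a', norm_sub_rev b']; exact hl.2

end System

/-! ### Jost solutions at `+∞` by reflection -/

section Right

/-- Coefficient functions of a potential for which `cos (u / 2) → -1` at `+∞`. -/
def IsRightData (c s : ℝ → ℝ) : Prop := IsLeftData (fun x => -c (-x)) (fun x => -s (-x))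

/-- The solution of the system normalised at `+∞`. -/
structure IsRightSystemJost (c s : ℝ → ℝ) (a b : ℂ) (y₁ y₂ : ℝ → ℂ) : Prop where
  isSolution : IsSystemSolution c s a b y₁ y₂
  tendsto_fst : Tendsto (fun x => y₁ x * Complex.exp (Complex.I * a * (∫ t in (0 : ℝ)..x, c t : ℝ)))
    atTop (𝓝 1)
  tendsto_snd : Tendsto (fun x => y₂ x * Complex.exp (Complex.I * a * (∫ t in (0 : ℝ)..x, c t : ℝ)))
    atTop (𝓝 0)

variable {c s : ℝ → ℝ} {a b : ℂ} {y₁ y₂ z₁ z₂ : ℝ → ℂ}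

/-- Reversing x flips the sign of the derivative, which is absorbed by both coefficient functions
with `a` and `b` kept. If c → -1 at `+∞`, then -c(-x) → 1 at `-∞`, so the theory at `+∞` is that at
`-∞`. -/
theorem IsSystemSolution.comp_neg (h : IsSystemSolution c s a b y₁ y₂) :
    IsSystemSolution (fun x => -c (-x)) (fun x => -s (-x)) a b (fun x => y₁ (-x))
      (fun x => y₂ (-x)) := by
  constructor <;> intro x
  · refine ((h.1 (-x)).scomp x (hasDerivAt_neg x)).congr_deriv ?_
    push_cast
    simp only [neg_smul, one_smul]
    ring
  · refine ((h.2 (-x)).scomp x (hasDerivAt_neg x)).congr_deriv ?_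
    push_cast
    simp only [neg_smul, one_smul]
    ring

theorem integral_neg_comp_neg (c : ℝ → ℝ) (x : ℝ) :
    ∫ t in (0 : ℝ)..x, -c (-t) = ∫ t in (0 : ℝ)..(-x), c t := by
  rw [intervalIntegral.integral_neg, intervalIntegral.integral_comp_neg, neg_zero,
    ← intervalIntegral.integral_symm]

theorem IsRightSystemJost.comp_neg (h : IsRightSystemJost c s a b y₁ y₂) :
    IsLeftSystemJost (fun x => -c (-x)) (fun x => -s (-x)) a b (fun x => y₁ (-x))
      (fun x => y₂ (-x)) := by
  refine ⟨h.isSolution.comp_neg, ?_, ?_⟩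
  · simp only [integral_neg_comp_neg]
    exact h.tendsto_fst.comp tendsto_neg_atBot_atTop
  · simp only [integral_neg_comp_neg]
    exact h.tendsto_snd.comp tendsto_neg_atBot_atTop

theorem IsLeftSystemJost.comp_neg
    (h : IsLeftSystemJost (fun x => -c (-x)) (fun x => -s (-x)) a b y₁ y₂) :
    IsRightSystemJost c s a b (fun x => y₁ (-x)) (fun x => y₂ (-x)) := by
  have h1 := h.isSolution.comp_neg
  have h2 := h.tendsto_fst.comp tendsto_neg_atTop_atBot
  have h3 := h.tendsto_snd.comp tendsto_neg_atTop_atBot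
  simp only [neg_neg] at h1
  simp only [integral_neg_comp_neg, Function.comp_def, neg_neg] at h2 h3
  exact ⟨h1, h2, h3⟩

theorem IsRightSystemJost.unique (hd : IsRightData c s) (ha : 0 < a.im)
    (hy : IsRightSystemJost c s a b y₁ y₂) (hz : IsRightSystemJost c s a b z₁ z₂) :
    z₁ = y₁ ∧ z₂ = y₂ := by
  obtain ⟨h1, h2⟩ := hy.comp_neg.unique hd ha hz.comp_neg
  constructor
  · funext x
    simpa using congrFun h1 (-x)
  · funext x
    simpa using congrFun h2 (-x)

theorem IsRightData.exists_jost (hd : IsRightData c s) {M : ℝ} (hM : 0 < M) :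
    ∃ y₁ y₂ : ℂ → ℂ → ℝ → ℂ, ∃ C : ℝ, 0 ≤ C ∧ ∀ a b : ℂ, 0 < a.im → ‖a‖ + ‖b‖ ≤ M →
      IsRightSystemJost c s a b (y₁ a b) (y₂ a b) ∧
      (∀ x, 0 ≤ x → ‖y₁ a b x‖ ≤ C * Real.exp (-(a.im * x)) ∧
        ‖y₂ a b x‖ ≤ C * Real.exp (-(a.im * x))) ∧
      ∀ x, ∃ K : ℝ, ∀ a' b' : ℂ, a.im / 2 ≤ a'.im → ‖a'‖ + ‖b'‖ ≤ M →
        ‖y₁ a' b' x - y₁ a b x‖ ≤ K * (‖a' - a‖ + ‖b' - b‖) ∧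
        ‖y₂ a' b' x - y₂ a b x‖ ≤ K * (‖a' - a‖ + ‖b' - b‖) := by
  obtain ⟨y₁, y₂, C, hC, h⟩ := IsLeftData.exists_jost hd hM
  refine ⟨fun a b x => y₁ a b (-x), fun a b x => y₂ a b (-x), C, hC, fun a b ha hab => ?_⟩
  obtain ⟨h1, h2, h3⟩ := h a b ha hab
  refine ⟨h1.comp_neg, fun x hx => ?_, fun x => h3 (-x)⟩
  simpa using h2 (-x) (by linarith)

end Right

/-! ### Square integrable solutions are multiples of Jost solutions -/

section SquareIntegrable

variable {c s : ℝ → ℝ} {a b : ℂ} {y₁ y₂ z₁ z₂ : ℝ → ℂ}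

theorem IsSystemSolution.continuous (h : IsSystemSolution c s a b y₁ y₂) :
    Continuous y₁ ∧ Continuous y₂ :=
  ⟨continuous_iff_continuousAt.2 fun x => (h.1 x).continuousAt,
    continuous_iff_continuousAt.2 fun x => (h.2 x).continuousAt⟩

theorem memLp_two_of_norm_le_exp {y : ℝ → ℂ} (hy : Continuous y) {C r : ℝ} (hr : 0 < r)
    (h : ∀ x ≤ 0, ‖y x‖ ≤ C * Real.exp (r * x)) : MemLp y 2 (volume.restrict (Iic 0)) := by
  rw [memLp_two_iff_integrable_sq_norm hy.aestronglyMeasurable]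
  have h1 : IntegrableOn (fun x => C ^ 2 * Real.exp ((2 * r) * x)) (Iic 0) :=
    (integrableOn_exp_mul_Iic (by positivity) 0).const_mul _
  refine Integrable.mono' h1 (by fun_prop) ?_
  filter_upwards [ae_restrict_mem measurableSet_Iic] with x hx
  have h2 := h x hx
  rw [Real.norm_of_nonneg (by positivity)]
  calc ‖y x‖ ^ 2 ≤ (C * Real.exp (r * x)) ^ 2 := by gcongr
    _ = C ^ 2 * Real.exp ((2 * r) * x) := by
      rw [mul_pow, ← Real.exp_nat_mul]; push_cast; ring_nf

/-- Two solutions that are square integrable near `-∞` have vanishing Wronskian. -/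
theorem IsSystemSolution.wronskian_eq_zero (hy : IsSystemSolution c s a b y₁ y₂)
    (hz : IsSystemSolution c s a b z₁ z₂)
    (hy₁ : MemLp y₁ 2 (volume.restrict (Iic 0))) (hy₂ : MemLp y₂ 2 (volume.restrict (Iic 0)))
    (hz₁ : MemLp z₁ 2 (volume.restrict (Iic 0))) (hz₂ : MemLp z₂ 2 (volume.restrict (Iic 0)))
    (x : ℝ) : y₁ x * z₂ x - y₂ x * z₁ x = 0 := by
  have h1 : IntegrableOn (fun t => y₁ t * z₂ t - y₂ t * z₁ t) (Iic 0) :=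
    (hy₁.integrable_mul hz₂).sub (hy₂.integrable_mul hz₁)
  simp only [hy.wronskian_eq hz _ x] at h1
  -- The Wronskian is integrable and constant on a half-line of infinite measure, hence zero.
  have h2 := (integrableOn_const_iff (C := y₁ x * z₂ x - y₂ x * z₁ x) (μ := volume)
    (s := Iic (0 : ℝ))).1 h1
  simpa using h2

theorem IsLeftSystemJost.exists_eq_mul (hd : IsLeftData c s) {C : ℝ} (ha : 0 < a.im)
    (hj : IsLeftSystemJost c s a b y₁ y₂)
    (hb : ∀ x ≤ 0, ‖y₁ x‖ ≤ C * Real.exp (a.im * x) ∧ ‖y₂ x‖ ≤ C * Real.exp (a.im * x))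
    (hz : IsSystemSolution c s a b z₁ z₂)
    (hz₁ : MemLp z₁ 2 (volume.restrict (Iic 0))) (hz₂ : MemLp z₂ 2 (volume.restrict (Iic 0))) :
    ∃ l : ℂ, (∀ x, z₁ x = l * y₁ x) ∧ ∀ x, z₂ x = l * y₂ x := by
  obtain ⟨x₀, hx₀⟩ := hj.exists_ne_zero
  have hc := hj.isSolution.continuous
  refine hj.isSolution.exists_eq_mul hd.abs_c_le hd.abs_s_le hz (Or.inl hx₀) ?_
  exact hj.isSolution.wronskian_eq_zero hz
    (memLp_two_of_norm_le_exp hc.1 ha fun x hx => (hb x hx).1)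
    (memLp_two_of_norm_le_exp hc.2 ha fun x hx => (hb x hx).2) hz₁ hz₂ x₀

theorem MemLp.comp_neg_restrict {y : ℝ → ℂ} (h : MemLp y 2 volume) :
    MemLp (fun x => y (-x)) 2 (volume.restrict (Iic 0)) :=
  (h.comp_measurePreserving (Measure.measurePreserving_neg volume)).restrict _

theorem IsRightSystemJost.exists_eq_mul (hd : IsRightData c s) {C : ℝ} (ha : 0 < a.im)
    (hj : IsRightSystemJost c s a b y₁ y₂)
    (hb : ∀ x, 0 ≤ x → ‖y₁ x‖ ≤ C * Real.exp (-(a.im * x)) ∧ ‖y₂ x‖ ≤ C * Real.exp (-(a.im * x)))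
    (hz : IsSystemSolution c s a b z₁ z₂) (hz₁ : MemLp z₁ 2 volume) (hz₂ : MemLp z₂ 2 volume) :
    ∃ l : ℂ, (∀ x, z₁ x = l * y₁ x) ∧ ∀ x, z₂ x = l * y₂ x := by
  obtain ⟨l, h1, h2⟩ := hj.comp_neg.exists_eq_mul (C := C) hd ha (fun x hx => by
    simpa using hb (-x) (by linarith)) hz.comp_neg (MemLp.comp_neg_restrict hz₁)
    (MemLp.comp_neg_restrict hz₂)
  exact ⟨l, fun x => by simpa using h1 (-x), fun x => by simpa using h2 (-x)⟩

end SquareIntegrable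

/-! ### Parameter derivative of a Wronskian with a fixed solution -/

section WronskianDerivative

/-- Differentiability of `F` is not needed because its cofactor vanishes at `z₀`. This lets the
Wronskian be differentiated when the solutions are only known to depend continuously on the
parameter. -/
theorem hasDerivAt_sub_mul_of_continuousAt {A F : ℂ → ℂ} {A' z₀ : ℂ} (hA : HasDerivAt A A' z₀)
    (hF : ContinuousAt F z₀) : HasDerivAt (fun z => (A z - A z₀) * F z) (A' * F z₀) z₀ := by
  rw [hasDerivAt_iff_tendsto_slope] at hA ⊢
  have h := hA.mul (hF.mono_left (nhdsWithin_le_nhds (s := {z₀}ᶜ)))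
  refine h.congr fun z => ?_
  simp only [slope_def_field, sub_self, zero_mul, sub_zero]
  ring

variable {c s : ℝ → ℝ} {A B : ℂ → ℂ} {A' B' z₀ : ℂ} {p₁ p₂ : ℂ → ℝ → ℂ} {r₁ r₂ : ℝ → ℂ} {C : ℝ}

/-- The derivative with respect to the parameter of the Wronskian of a family of solutions that
are bounded on the left half-line with a fixed solution decaying there. -/
theorem hasDerivAt_wronskian_left (hc : Continuous c) (hs : Continuous s)
    (hc1 : ∀ x, |c x| ≤ 1) (hs1 : ∀ x, |s x| ≤ 1) (hA : HasDerivAt A A' z₀) (hB : HasDerivAt B B' z₀)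
    (hp : ∀ᶠ z in 𝓝 z₀, IsSystemSolution c s (A z) (B z) (p₁ z) (p₂ z))
    (hr : IsSystemSolution c s (A z₀) (B z₀) r₁ r₂)
    (hb : ∀ᶠ z in 𝓝 z₀, ∀ x ≤ 0, ‖p₁ z x‖ ≤ C ∧ ‖p₂ z x‖ ≤ C)
    (h₁ : ∀ x, ContinuousAt (fun z => p₁ z x) z₀) (h₂ : ∀ x, ContinuousAt (fun z => p₂ z x) z₀)
    (hi₁ : IntegrableOn r₁ (Iic 0)) (hi₂ : IntegrableOn r₂ (Iic 0))
    (ht₁ : Tendsto r₁ atBot (𝓝 0)) (ht₂ : Tendsto r₂ atBot (𝓝 0)) :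
    HasDerivAt (fun z => p₁ z 0 * r₂ 0 - p₂ z 0 * r₁ 0)
      (A' * (∫ x in Iic (0 : ℝ), -Complex.I * c x * (p₁ z₀ x * r₂ x + p₂ z₀ x * r₁ x)) +
        B' * ∫ x in Iic (0 : ℝ), Complex.I * s x * (p₂ z₀ x * r₂ x - p₁ z₀ x * r₁ x)) z₀ := by
  obtain ⟨hrc₁, hrc₂⟩ := hr.continuous
  have hC : 0 ≤ C := by
    obtain ⟨z, hz⟩ := hb.exists
    exact (norm_nonneg _).trans (hz 0 le_rfl).1
  have hbi : IntegrableOn (fun x => C * ‖r₁ x‖ + C * ‖r₂ x‖) (Iic 0) :=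
    (hi₁.norm.const_mul C).add (hi₂.norm.const_mul C)
  have hest : ∀ (f p q r t : ℂ), ‖f‖ ≤ 1 → ‖p‖ ≤ C → ‖q‖ ≤ C →
      ‖f * (p * r + q * t)‖ ≤ C * ‖t‖ + C * ‖r‖ := by
    intro f p q r t hf hp hq
    rw [norm_mul]
    calc ‖f‖ * ‖p * r + q * t‖ ≤ 1 * (‖p‖ * ‖r‖ + ‖q‖ * ‖t‖) := by
          gcongr
          rw [← norm_mul, ← norm_mul]; exact norm_add_le _ _
      _ ≤ 1 * (C * ‖r‖ + C * ‖t‖) := by gcongr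
      _ = _ := by ring
  have hcn : ∀ x, ‖-Complex.I * (c x : ℂ)‖ ≤ 1 := fun x => by
    rw [norm_mul, norm_neg, Complex.norm_I, one_mul, Complex.norm_real]; exact hc1 x
  have hsn : ∀ x, ‖Complex.I * (s x : ℂ)‖ ≤ 1 := fun x => by
    rw [norm_mul, Complex.norm_I, one_mul, Complex.norm_real]; exact hs1 x
  have hF1 : ∀ z, (∀ x ≤ 0, ‖p₁ z x‖ ≤ C ∧ ‖p₂ z x‖ ≤ C) → ∀ x ≤ 0,
      ‖-Complex.I * c x * (p₁ z x * r₂ x + p₂ z x * r₁ x)‖ ≤ C * ‖r₁ x‖ + C * ‖r₂ x‖ :=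
    fun z hz x hx => hest _ _ _ _ _ (hcn x) (hz x hx).1 (hz x hx).2
  have hG1 : ∀ z, (∀ x ≤ 0, ‖p₁ z x‖ ≤ C ∧ ‖p₂ z x‖ ≤ C) → ∀ x ≤ 0,
      ‖Complex.I * s x * (p₂ z x * r₂ x - p₁ z x * r₁ x)‖ ≤ C * ‖r₁ x‖ + C * ‖r₂ x‖ := by
    intro z hz x hx
    rw [sub_eq_add_neg, ← neg_mul]
    exact hest _ _ _ _ _ (hsn x) (hz x hx).2 (by rw [norm_neg]; exact (hz x hx).1)
  have hmeasF : ∀ z, IsSystemSolution c s (A z) (B z) (p₁ z) (p₂ z) →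
      AEStronglyMeasurable (fun x => -Complex.I * c x * (p₁ z x * r₂ x + p₂ z x * r₁ x))
        (volume.restrict (Iic 0)) := by
    intro z hz
    have := hz.continuous.1
    have := hz.continuous.2
    exact Continuous.aestronglyMeasurable (by fun_prop)
  have hmeasG : ∀ z, IsSystemSolution c s (A z) (B z) (p₁ z) (p₂ z) →
      AEStronglyMeasurable (fun x => Complex.I * s x * (p₂ z x * r₂ x - p₁ z x * r₁ x))
        (volume.restrict (Iic 0)) := by
    intro z hz
    have := hz.continuous.1
    have := hz.continuous.2
    exact Continuous.aestronglyMeasurable (by fun_prop)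
  have hFc : ContinuousAt (fun z => ∫ x in Iic (0 : ℝ),
      -Complex.I * c x * (p₁ z x * r₂ x + p₂ z x * r₁ x)) z₀ := by
    refine continuousAt_of_dominated (hp.mono hmeasF) ?_ hbi (Eventually.of_forall fun x => ?_)
    · filter_upwards [hb] with z hz
      filter_upwards [ae_restrict_mem measurableSet_Iic] with x hx using hF1 z hz x hx
    · exact continuousAt_const.mul (((h₁ x).mul continuousAt_const).add
        ((h₂ x).mul continuousAt_const))
  have hGc : ContinuousAt (fun z => ∫ x in Iic (0 : ℝ),
      Complex.I * s x * (p₂ z x * r₂ x - p₁ z x * r₁ x)) z₀ := by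
    refine continuousAt_of_dominated (hp.mono hmeasG) ?_ hbi (Eventually.of_forall fun x => ?_)
    · filter_upwards [hb] with z hz
      filter_upwards [ae_restrict_mem measurableSet_Iic] with x hx using hG1 z hz x hx
    · exact continuousAt_const.mul (((h₂ x).mul continuousAt_const).sub
        ((h₁ x).mul continuousAt_const))
  refine ((hasDerivAt_sub_mul_of_continuousAt hA hFc).add
    (hasDerivAt_sub_mul_of_continuousAt hB hGc)).congr_of_eventuallyEq ?_
  filter_upwards [hp, hb] with z hz hzb
  have hiF : IntegrableOn (fun x => -Complex.I * c x * (p₁ z x * r₂ x + p₂ z x * r₁ x)) (Iic 0) := by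
    refine Integrable.mono' hbi (hmeasF z hz) ?_
    filter_upwards [ae_restrict_mem measurableSet_Iic] with x hx using hF1 z hzb x hx
  have hiG : IntegrableOn (fun x => Complex.I * s x * (p₂ z x * r₂ x - p₁ z x * r₁ x)) (Iic 0) := by
    refine Integrable.mono' hbi (hmeasG z hz) ?_
    filter_upwards [ae_restrict_mem measurableSet_Iic] with x hx using hG1 z hzb x hx
  -- For solutions belonging to different parameters the Wronskian is no longer constant: its
  -- x-derivative is linear in the parameter differences. Integrated from `-∞`, it exhibits the
  -- Wronskian at 0 as these differences times functions continuous in z.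
  have hD : ∀ x : ℝ, HasDerivAt (fun x => p₁ z x * r₂ x - p₂ z x * r₁ x)
      ((A z - A z₀) * (-Complex.I * c x * (p₁ z x * r₂ x + p₂ z x * r₁ x)) +
        (B z - B z₀) * (Complex.I * s x * (p₂ z x * r₂ x - p₁ z x * r₁ x))) x := by
    intro x
    refine (((hz.1 x).mul (hr.2 x)).sub ((hz.2 x).mul (hr.1 x))).congr_deriv ?_
    ring
  have hlim : Tendsto (fun x => p₁ z x * r₂ x - p₂ z x * r₁ x) atBot (𝓝 0) := by
    have hsum : Tendsto (fun x => C * ‖r₂ x‖ + C * ‖r₁ x‖) atBot (𝓝 0) := by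
      simpa using (ht₂.norm.const_mul C).add (ht₁.norm.const_mul C)
    refine squeeze_zero_norm' ?_ hsum
    filter_upwards [eventually_le_atBot 0] with x hx
    refine (norm_sub_le _ _).trans ?_
    rw [norm_mul, norm_mul]
    gcongr
    · exact (hzb x hx).1
    · exact (hzb x hx).2
  have h := integral_Iic_of_hasDerivAt_of_tendsto' (a := 0) (fun x _ => hD x)
    ((hiF.const_mul _).add (hiG.const_mul _)) hlim
  rw [integral_add (hiF.const_mul _) (hiG.const_mul _), integral_const_mul, integral_const_mul,
    sub_zero] at h
  simp only [Pi.add_apply]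
  exact h.symm

end WronskianDerivative

/-! ### Derivative of the Wronskian of the two Jost solutions -/

section WronskianDerivative

variable {c s : ℝ → ℝ} {A B : ℂ → ℂ} {A' B' z₀ : ℂ} {p₁ p₂ q₁ q₂ : ℂ → ℝ → ℂ} {C : ℝ}

/-- A product of two first-order increments is of second order; this disposes of the remainder in
the expansion of the Wronskian. -/
theorem hasDerivAt_mul_of_isBigO {f g : ℂ → ℂ} {z₀ : ℂ} (hf : f =O[𝓝 z₀] fun z => z - z₀)
    (hg : g =O[𝓝 z₀] fun z => z - z₀) : HasDerivAt (fun z => f z * g z) 0 z₀ := by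
  have h0 : f z₀ * g z₀ = 0 := by
    have h := (hf.bound.choose_spec).self_of_nhds
    simp only [sub_self, norm_zero, mul_zero, norm_le_zero_iff] at h
    rw [h, zero_mul]
  rw [hasDerivAt_iff_isLittleO]
  simp only [h0, sub_zero, smul_zero]
  refine (hf.mul hg).trans_isLittleO ?_
  have h1 : (fun z => z - z₀) =o[𝓝 z₀] fun _ => (1 : ℂ) := by
    rw [Asymptotics.isLittleO_one_iff]
    exact tendsto_sub_nhds_zero_iff.2 tendsto_id
  simpa using (Asymptotics.isBigO_refl (fun z => z - z₀) (𝓝 z₀)).mul_isLittleO h1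

theorem continuousAt_of_sub_isBigO {f : ℂ → ℂ} {z₀ : ℂ}
    (h : (fun z => f z - f z₀) =O[𝓝 z₀] fun z => z - z₀) : ContinuousAt f z₀ := by
  rw [ContinuousAt, ← tendsto_sub_nhds_zero_iff]
  exact h.trans_tendsto (tendsto_sub_nhds_zero_iff.2 tendsto_id)

/-- The derivative of the Wronskian of a left and a right family of solutions at a parameter at
which they are proportional. -/
theorem hasDerivAt_wronskian (hc : Continuous c) (hs : Continuous s)
    (hc1 : ∀ x, |c x| ≤ 1) (hs1 : ∀ x, |s x| ≤ 1) (hA : HasDerivAt A A' z₀) (hB : HasDerivAt B B' z₀)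
    (hp : ∀ᶠ z in 𝓝 z₀, IsSystemSolution c s (A z) (B z) (p₁ z) (p₂ z))
    (hq : ∀ᶠ z in 𝓝 z₀, IsSystemSolution c s (A z) (B z) (q₁ z) (q₂ z))
    (hpb : ∀ᶠ z in 𝓝 z₀, ∀ x ≤ 0, ‖p₁ z x‖ ≤ C ∧ ‖p₂ z x‖ ≤ C)
    (hqb : ∀ᶠ z in 𝓝 z₀, ∀ x, 0 ≤ x → ‖q₁ z x‖ ≤ C ∧ ‖q₂ z x‖ ≤ C)
    (hp₁ : ∀ x, (fun z => p₁ z x - p₁ z₀ x) =O[𝓝 z₀] fun z => z - z₀)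
    (hp₂ : ∀ x, (fun z => p₂ z x - p₂ z₀ x) =O[𝓝 z₀] fun z => z - z₀)
    (hq₁ : ∀ x, (fun z => q₁ z x - q₁ z₀ x) =O[𝓝 z₀] fun z => z - z₀)
    (hq₂ : ∀ x, (fun z => q₂ z x - q₂ z₀ x) =O[𝓝 z₀] fun z => z - z₀)
    {l : ℂ} (hl₁ : ∀ x, p₁ z₀ x = l * q₁ z₀ x) (hl₂ : ∀ x, p₂ z₀ x = l * q₂ z₀ x)
    (hi₁ : Integrable (q₁ z₀)) (hi₂ : Integrable (q₂ z₀))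
    (hm₁ : MemLp (q₁ z₀) 2) (hm₂ : MemLp (q₂ z₀) 2)
    (hbot₁ : Tendsto (q₁ z₀) atBot (𝓝 0)) (hbot₂ : Tendsto (q₂ z₀) atBot (𝓝 0))
    (htop₁ : Tendsto (q₁ z₀) atTop (𝓝 0)) (htop₂ : Tendsto (q₂ z₀) atTop (𝓝 0)) :
    HasDerivAt (fun z => p₁ z 0 * q₂ z 0 - p₂ z 0 * q₁ z 0)
      (l * ∫ x, (A' * (-Complex.I * c x * (2 * (q₁ z₀ x * q₂ z₀ x))) +
        B' * (Complex.I * s x * (q₂ z₀ x ^ 2 - q₁ z₀ x ^ 2)))) z₀ := by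
  have hpz := hp.self_of_nhds
  have hqz := hq.self_of_nhds
  have hleft := hasDerivAt_wronskian_left hc hs hc1 hs1 hA hB hp hqz hpb
    (fun x => continuousAt_of_sub_isBigO (hp₁ x)) (fun x => continuousAt_of_sub_isBigO (hp₂ x))
    hi₁.integrableOn hi₂.integrableOn hbot₁ hbot₂
  -- The right family decays at `+∞`, so the same formula is applied to its reflection.
  have hright := hasDerivAt_wronskian_left (c := fun x => -c (-x)) (s := fun x => -s (-x))
    (p₁ := fun z x => q₁ z (-x)) (p₂ := fun z x => q₂ z (-x)) (r₁ := fun x => q₁ z₀ (-x))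
    (r₂ := fun x => q₂ z₀ (-x)) (C := C) (by fun_prop) (by fun_prop)
    (fun x => by rw [abs_neg]; exact hc1 _) (fun x => by rw [abs_neg]; exact hs1 _) hA hB
    (hq.mono fun z hz => hz.comp_neg) hqz.comp_neg
    (hqb.mono fun z hz x hx => hz (-x) (by linarith))
    (fun x => continuousAt_of_sub_isBigO (hq₁ (-x))) (fun x => continuousAt_of_sub_isBigO (hq₂ (-x)))
    hi₁.comp_neg.integrableOn hi₂.comp_neg.integrableOn
    (htop₁.comp tendsto_neg_atBot_atTop) (htop₂.comp tendsto_neg_atBot_atTop)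
  have hrem := (hasDerivAt_mul_of_isBigO (hp₁ 0) (hq₂ 0)).sub
    (hasDerivAt_mul_of_isBigO (hp₂ 0) (hq₁ 0))
  have hcm : ∀ x, ‖-Complex.I * (c x : ℂ)‖ ≤ 1 := fun x => by
    rw [norm_mul, norm_neg, Complex.norm_I, one_mul, Complex.norm_real]; exact hc1 x
  have hsm : ∀ x, ‖Complex.I * (s x : ℂ)‖ ≤ 1 := fun x => by
    rw [norm_mul, Complex.norm_I, one_mul, Complex.norm_real]; exact hs1 x
  have hI : Integrable fun x => -Complex.I * c x * (2 * (q₁ z₀ x * q₂ z₀ x)) :=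
    Integrable.bdd_mul ((hm₁.integrable_mul hm₂).const_mul 2)
      (Continuous.aestronglyMeasurable (by fun_prop)) (Eventually.of_forall hcm)
  have hsq : ∀ q : ℝ → ℂ, MemLp q 2 → Integrable fun x => q x ^ 2 := by
    intro q h
    exact (h.integrable_mul h).congr (Eventually.of_forall fun x => by simp [pow_two])
  have hJ : Integrable fun x => Complex.I * s x * (q₂ z₀ x ^ 2 - q₁ z₀ x ^ 2) :=
    Integrable.bdd_mul ((hsq _ hm₂).sub (hsq _ hm₁))
      (Continuous.aestronglyMeasurable (by fun_prop)) (Eventually.of_forall hsm)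
  have hsplit : ∀ f : ℝ → ℂ, Integrable f →
      (∫ x in Iic (0 : ℝ), f x) + ∫ x in Iic (0 : ℝ), f (-x) = ∫ x, f x := by
    intro f hf
    rw [integral_comp_neg_Iic, neg_zero]
    exact intervalIntegral.integral_Iic_add_Ioi hf.integrableOn hf.integrableOn
  have hIsplit := hsplit _ hI
  have hJsplit := hsplit _ hJ
  -- With p = l q at `z₀`, the Wronskian of p(z) and q(z) is that of p(z) and q(z₀), minus l times
  -- that of q(z) and q(z₀), plus the Wronskian of the increments. The two half-line integrals then
  -- join into one over the line.
  have hsum := (hleft.sub (hright.const_mul l)).add hrem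
  have hval : ∫ x, (A' * (-Complex.I * c x * (2 * (q₁ z₀ x * q₂ z₀ x))) +
        B' * (Complex.I * s x * (q₂ z₀ x ^ 2 - q₁ z₀ x ^ 2))) =
      A' * (∫ x, -Complex.I * c x * (2 * (q₁ z₀ x * q₂ z₀ x))) +
        B' * ∫ x, Complex.I * s x * (q₂ z₀ x ^ 2 - q₁ z₀ x ^ 2) := by
    rw [integral_add (hI.const_mul _) (hJ.const_mul _), integral_const_mul, integral_const_mul]
  rw [hval, ← hIsplit, ← hJsplit]
  refine (hsum.congr_deriv ?_).congr_of_eventuallyEq (Eventually.of_forall fun z => ?_)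
  · have e1 : ∫ x in Iic (0 : ℝ), -Complex.I * c x * (p₁ z₀ x * q₂ z₀ x + p₂ z₀ x * q₁ z₀ x) =
        l * ∫ x in Iic (0 : ℝ), -Complex.I * c x * (2 * (q₁ z₀ x * q₂ z₀ x)) := by
      rw [← integral_const_mul]
      congr 1; funext x; rw [hl₁, hl₂]; ring
    have e2 : ∫ x in Iic (0 : ℝ), Complex.I * s x * (p₂ z₀ x * q₂ z₀ x - p₁ z₀ x * q₁ z₀ x) =
        l * ∫ x in Iic (0 : ℝ), Complex.I * s x * (q₂ z₀ x ^ 2 - q₁ z₀ x ^ 2) := by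
      rw [← integral_const_mul]
      congr 1; funext x; rw [hl₁, hl₂]; ring
    have e3 : ∫ x in Iic (0 : ℝ), -Complex.I * ((-c (-x) : ℝ) : ℂ) *
          (q₁ z₀ (-x) * q₂ z₀ (-x) + q₂ z₀ (-x) * q₁ z₀ (-x)) =
        -∫ x in Iic (0 : ℝ), -Complex.I * c (-x) * (2 * (q₁ z₀ (-x) * q₂ z₀ (-x))) := by
      rw [← integral_neg]
      congr 1; funext x; push_cast; ring
    have e4 : ∫ x in Iic (0 : ℝ), Complex.I * ((-s (-x) : ℝ) : ℂ) *
          (q₂ z₀ (-x) * q₂ z₀ (-x) - q₁ z₀ (-x) * q₁ z₀ (-x)) =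
        -∫ x in Iic (0 : ℝ), Complex.I * s (-x) * (q₂ z₀ (-x) ^ 2 - q₁ z₀ (-x) ^ 2) := by
      rw [← integral_neg]
      congr 1; funext x; push_cast; ring
    rw [e1, e2, e3, e4]
    ring
  · simp only [Pi.add_apply, Pi.sub_apply, neg_zero, hl₁, hl₂]
    ring

end WronskianDerivative

/-! ### Positivity of the Krein form -/

section Krein

theorem hasDerivAt_complex_re {f : ℝ → ℂ} {f' : ℂ} {x : ℝ} (h : HasDerivAt f f' x) :
    HasDerivAt (fun x => (f x).re) f'.re x :=
  Complex.reCLM.hasFDerivAt.comp_hasDerivAt x h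

theorem hasDerivAt_complex_im {f : ℝ → ℂ} {f' : ℂ} {x : ℝ} (h : HasDerivAt f f' x) :
    HasDerivAt (fun x => (f x).im) f'.im x :=
  Complex.imCLM.hasFDerivAt.comp_hasDerivAt x h

/-- The density of the Krein form of the scattering system. -/
def kreinDensity (c s : ℝ → ℝ) (a b : ℂ) (y₁ y₂ : ℝ → ℂ) (x : ℝ) : ℝ :=
  a.im * s x * (‖y₁ x‖ ^ 2 + ‖y₂ x‖ ^ 2) -
    2 * b.re * c x * ((y₁ x).im * (y₂ x).re - (y₁ x).re * (y₂ x).im)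

variable {c s g : ℝ → ℝ} {a b : ℂ} {y₁ y₂ : ℝ → ℂ} {t X : ℝ}

theorem norm_sq_eq (w : ℂ) : ‖w‖ ^ 2 = w.re ^ 2 + w.im ^ 2 := by
  rw [Complex.sq_norm, Complex.normSq_apply]; ring

theorem IsSystemSolution.hasDerivAt_norm_sq_snd (h : IsSystemSolution c s a b y₁ y₂) (x : ℝ) :
    HasDerivAt (fun x => ‖y₂ x‖ ^ 2) (-2 * a.im * c x * ‖y₂ x‖ ^ 2 +
      2 * s x * (-b.re * ((y₁ x).im * (y₂ x).re - (y₁ x).re * (y₂ x).im) -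
        b.im * ((y₁ x).re * (y₂ x).re + (y₁ x).im * (y₂ x).im))) x := by
  simp only [norm_sq_eq]
  refine (((hasDerivAt_complex_re (h.2 x)).pow 2).add ((hasDerivAt_complex_im (h.2 x)).pow 2)).congr_deriv ?_
  simp
  ring

/-- The real part of `y₁ * conj y₂` is a primitive of a multiple of the Krein density. -/
theorem IsSystemSolution.hasDerivAt_re_mul_conj (h : IsSystemSolution c s a b y₁ y₂)
    (hre : a.re = t * b.re) (him : b.im = t * a.im) (x : ℝ) :
    HasDerivAt (fun x => (y₁ x).re * (y₂ x).re + (y₁ x).im * (y₂ x).im)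
      (-t * kreinDensity c s a b y₁ y₂ x) x := by
  refine (((hasDerivAt_complex_re (h.1 x)).mul (hasDerivAt_complex_re (h.2 x))).add
    ((hasDerivAt_complex_im (h.1 x)).mul (hasDerivAt_complex_im (h.2 x)))).congr_deriv ?_
  simp [kreinDensity, norm_sq_eq, hre, him]
  ring

/-- The bracket is the x-derivative of c/(s + ε)·|y₂|² when c' = -gs, s' = gc, with `a₂` = Im a,
`b₁` = Re b and Im b = t·Im a. Formally at ε = 0 the multiplier is cot(u/2), and the difference of
the two sides is a sum of squares weighted by 1/s and by g. The shift by ε avoids dividing by s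
where it vanishes, and costs the last term on the left, linear in ε. -/
theorem krein_pointwise {c s g ε a₂ b₁ t r₁ i₁ r₂ i₂ : ℝ} (hs : 0 ≤ s) (hg : 0 ≤ g) (hε : 0 < ε)
    (ha : 0 < a₂) :
    ((-(g * s) * (s + ε) - c * (g * c)) / (s + ε) ^ 2 * (r₂ ^ 2 + i₂ ^ 2) +
      c / (s + ε) * (-2 * a₂ * c * (r₂ ^ 2 + i₂ ^ 2) +
        2 * s * (-b₁ * (i₁ * r₂ - r₁ * i₂) - t * a₂ * (r₁ * r₂ + i₁ * i₂)))) +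
      a₂ * (1 - t ^ 2) * (s * ((r₁ ^ 2 + i₁ ^ 2) + (r₂ ^ 2 + i₂ ^ 2))) -
        ε * (b₁ ^ 2 / a₂ * (r₁ ^ 2 + i₁ ^ 2)) ≤
      a₂ * s * ((r₁ ^ 2 + i₁ ^ 2) + (r₂ ^ 2 + i₂ ^ 2)) - 2 * b₁ * c * (i₁ * r₂ - r₁ * i₂) := by
  have hD : 0 < s + ε := by positivity
  have key : a₂ * s * ((r₁ ^ 2 + i₁ ^ 2) + (r₂ ^ 2 + i₂ ^ 2)) - 2 * b₁ * c * (i₁ * r₂ - r₁ * i₂) -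
      (((-(g * s) * (s + ε) - c * (g * c)) / (s + ε) ^ 2 * (r₂ ^ 2 + i₂ ^ 2) +
      c / (s + ε) * (-2 * a₂ * c * (r₂ ^ 2 + i₂ ^ 2) +
        2 * s * (-b₁ * (i₁ * r₂ - r₁ * i₂) - t * a₂ * (r₁ * r₂ + i₁ * i₂)))) +
      a₂ * (1 - t ^ 2) * (s * ((r₁ ^ 2 + i₁ ^ 2) + (r₂ ^ 2 + i₂ ^ 2))) -
        ε * (b₁ ^ 2 / a₂ * (r₁ ^ 2 + i₁ ^ 2))) =
      g * (s * (s + ε) + c ^ 2) / (s + ε) ^ 2 * (r₂ ^ 2 + i₂ ^ 2) +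
      a₂ / (s + ε) * ((t * s * r₁ + c * r₂) ^ 2 + (t * s * i₁ + c * i₂) ^ 2) +
      a₂ * t ^ 2 * (s * ε / (s + ε)) * (r₁ ^ 2 + i₁ ^ 2) + a₂ * t ^ 2 * s * (r₂ ^ 2 + i₂ ^ 2) +
      1 / (a₂ * (s + ε)) * ((a₂ * c * r₂ - b₁ * ε * i₁) ^ 2 + (a₂ * c * i₂ + b₁ * ε * r₁) ^ 2) +
      b₁ ^ 2 / a₂ * (ε * s / (s + ε)) * (r₁ ^ 2 + i₁ ^ 2) := by
    field_simp
    ring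
  rw [← sub_nonneg, key]
  positivity

theorem integrable_mul_norm_sq (hsc : Continuous s) (hs1 : ∀ x, |s x| ≤ 1)
    (hy₁ : Integrable fun x => ‖y₁ x‖ ^ 2) (hy₂ : Integrable fun x => ‖y₂ x‖ ^ 2) :
    Integrable fun x => s x * (‖y₁ x‖ ^ 2 + ‖y₂ x‖ ^ 2) :=
  Integrable.bdd_mul (hy₁.add hy₂) hsc.aestronglyMeasurable (Eventually.of_forall hs1)

theorem integrable_kreinDensity (hcc : Continuous c) (hsc : Continuous s)
    (hc1 : ∀ x, |c x| ≤ 1) (hs1 : ∀ x, |s x| ≤ 1) (hyc₁ : Continuous y₁) (hyc₂ : Continuous y₂)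
    (hy₁ : Integrable fun x => ‖y₁ x‖ ^ 2) (hy₂ : Integrable fun x => ‖y₂ x‖ ^ 2) :
    Integrable (kreinDensity c s a b y₁ y₂) := by
  have hn := integrable_mul_norm_sq hsc hs1 hy₁ hy₂
  have hw : Integrable fun x => c x * ((y₁ x).im * (y₂ x).re - (y₁ x).re * (y₂ x).im) := by
    refine Integrable.bdd_mul ?_ hcc.aestronglyMeasurable (Eventually.of_forall hc1)
    refine Integrable.mono' (hy₁.add hy₂) (Continuous.aestronglyMeasurable (by fun_prop))
      (Eventually.of_forall fun x => ?_)
    simp only [Pi.add_apply, norm_sq_eq, Real.norm_eq_abs]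
    rw [abs_le]
    constructor <;> nlinarith [sq_nonneg ((y₁ x).im - (y₂ x).re), sq_nonneg ((y₁ x).im + (y₂ x).re),
      sq_nonneg ((y₁ x).re - (y₂ x).im), sq_nonneg ((y₁ x).re + (y₂ x).im)]
  refine ((hn.const_mul a.im).sub (hw.const_mul (2 * b.re))).congr
    (Eventually.of_forall fun x => ?_)
  simp only [kreinDensity, Pi.sub_apply]; ring

/-- Lower bound for the Krein form on a half-line on which the potential increases. -/
theorem IsSystemSolution.le_integral_kreinDensity_Iic (h : IsSystemSolution c s a b y₁ y₂)
    (hc : ∀ x, HasDerivAt c (-(g x * s x)) x) (hs : ∀ x, HasDerivAt s (g x * c x) x)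
    (hgc : Continuous g) (hc1 : ∀ x, |c x| ≤ 1) (hs1 : ∀ x, |s x| ≤ 1)
    (hg : ∀ x ≤ X, 0 ≤ g x) (hs0 : ∀ x ≤ X, 0 ≤ s x)
    (hcX : 0 ≤ c X) (ha : 0 < a.im) (him : b.im = t * a.im)
    (hy₁ : Integrable fun x => ‖y₁ x‖ ^ 2) (hy₂ : Integrable fun x => ‖y₂ x‖ ^ 2)
    (hlim : Tendsto y₂ atBot (𝓝 0)) :
    a.im * (1 - t ^ 2) * ∫ x in Iic X, s x * (‖y₁ x‖ ^ 2 + ‖y₂ x‖ ^ 2) ≤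
      ∫ x in Iic X, kreinDensity c s a b y₁ y₂ x := by
  have hcc : Continuous c := continuous_iff_continuousAt.2 fun x => (hc x).continuousAt
  have hsc : Continuous s := continuous_iff_continuousAt.2 fun x => (hs x).continuousAt
  obtain ⟨hyc₁, hyc₂⟩ := h.continuous
  have hkc : Continuous (kreinDensity c s a b y₁ y₂) := by unfold kreinDensity; fun_prop
  have hn := integrable_mul_norm_sq hsc hs1 hy₁ hy₂
  have hk : Integrable (kreinDensity c s a b y₁ y₂) :=
    integrable_kreinDensity hcc hsc hc1 hs1 hyc₁ hyc₂ hy₁ hy₂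
  set m := ∫ x in Iic X, b.re ^ 2 / a.im * ‖y₁ x‖ ^ 2 with hm_def
  have hm0 : 0 ≤ m := integral_nonneg fun x => by positivity
  have hε : ∀ ε > 0, a.im * (1 - t ^ 2) * (∫ x in Iic X, s x * (‖y₁ x‖ ^ 2 + ‖y₂ x‖ ^ 2)) ≤
      (∫ x in Iic X, kreinDensity c s a b y₁ y₂ x) + ε * m := by
    intro ε hε
    -- Regularised cot(u/2)|y₂|². It tends to 0 at `-∞` since s + ε ≥ ε there, and at X it is
    -- nonnegative since c(X) ≥ 0, so its total variation over the half-line can be dropped.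
    let F : ℝ → ℝ := fun x => c x / (s x + ε) * ‖y₂ x‖ ^ 2
    let F' : ℝ → ℝ := fun x =>
      (-(g x * s x) * (s x + ε) - c x * (g x * c x)) / (s x + ε) ^ 2 * ‖y₂ x‖ ^ 2 +
      c x / (s x + ε) * (-2 * a.im * c x * ‖y₂ x‖ ^ 2 +
      2 * s x * (-b.re * ((y₁ x).im * (y₂ x).re - (y₁ x).re * (y₂ x).im) -
        b.im * ((y₁ x).re * (y₂ x).re + (y₁ x).im * (y₂ x).im)))
    have hD : ∀ x ≤ X, s x + ε ≠ 0 := fun x hx => (add_pos_of_nonneg_of_pos (hs0 x hx) hε).ne'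
    have hF : ∀ x ≤ X, HasDerivAt F (F' x) x := fun x hx =>
      ((hc x).div ((hs x).add_const ε) (hD x hx)).mul (h.hasDerivAt_norm_sq_snd x)
    let G : ℝ → ℝ := fun x => a.im * (1 - t ^ 2) * (s x * (‖y₁ x‖ ^ 2 + ‖y₂ x‖ ^ 2)) -
      ε * (b.re ^ 2 / a.im * ‖y₁ x‖ ^ 2)
    have hGc : Continuous G := by fun_prop
    have hpt : ∀ x ≤ X, F' x + G x ≤ kreinDensity c s a b y₁ y₂ x := by
      intro x hx
      have := krein_pointwise (c := c x) (b₁ := b.re) (t := t) (r₁ := (y₁ x).re) (i₁ := (y₁ x).im)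
        (r₂ := (y₂ x).re) (i₂ := (y₂ x).im) (hs0 x hx) (hg x hx) hε ha
      simp only [F', G, kreinDensity, norm_sq_eq, him]
      linarith
    have hF'c : ContinuousOn F' (Iic X) := by
      refine ContinuousOn.add (ContinuousOn.mul (ContinuousOn.div (by fun_prop) (by fun_prop)
        fun x hx => pow_ne_zero 2 (hD x hx)) (by fun_prop)) (ContinuousOn.mul
          (ContinuousOn.div (by fun_prop) (by fun_prop) hD) (by fun_prop))
    have hint : ∀ x ≤ X, F X - F x + ∫ y in x..X, G y ≤
        ∫ y in x..X, kreinDensity c s a b y₁ y₂ y := by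
      intro x hx
      have hsub : uIcc x X ⊆ Iic X := by
        rw [uIcc_of_le hx]; exact Icc_subset_Iic_self
      have hFi : IntervalIntegrable F' volume x X := (hF'c.mono hsub).intervalIntegrable
      rw [← intervalIntegral.integral_eq_sub_of_hasDerivAt (fun y hy => hF y (hsub hy)) hFi,
        ← intervalIntegral.integral_add hFi (hGc.intervalIntegrable _ _)]
      exact intervalIntegral.integral_mono_on hx (hFi.add (hGc.intervalIntegrable _ _))
        (hkc.intervalIntegrable _ _) fun y hy => hpt y hy.2
    have hGi : Integrable G := (hn.const_mul _).sub ((hy₁.const_mul _).const_mul _)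
    have hFlim : Tendsto F atBot (𝓝 0) := by
      have h0 : Tendsto (fun x => 1 / ε * ‖y₂ x‖ ^ 2) atBot (𝓝 0) := by
        simpa using (hlim.norm.pow 2).const_mul (1 / ε)
      refine squeeze_zero_norm' ?_ h0
      filter_upwards [eventually_le_atBot X] with x hx
      simp only [F]
      rw [norm_mul, Real.norm_of_nonneg (sq_nonneg ‖y₂ x‖), norm_div,
        Real.norm_of_nonneg (add_nonneg (hs0 x hx) hε.le)]
      gcongr
      · exact hc1 x
      · linarith [hs0 x hx]
    have hL : Tendsto (fun x => F X - F x + ∫ y in x..X, G y) atBot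
        (𝓝 (F X - 0 + ∫ y in Iic X, G y)) :=
      (tendsto_const_nhds.sub hFlim).add
        (intervalIntegral_tendsto_integral_Iic X hGi.integrableOn tendsto_id)
    have hR := intervalIntegral_tendsto_integral_Iic X hk.integrableOn tendsto_id
    have hle := le_of_tendsto_of_tendsto hL hR
      ((eventually_le_atBot X).mono fun x hx => hint x hx)
    have hFX : 0 ≤ F X := mul_nonneg (div_nonneg hcX (add_nonneg (hs0 X le_rfl) hε.le)) (sq_nonneg _)
    have hGv : ∫ y in Iic X, G y =
        a.im * (1 - t ^ 2) * (∫ x in Iic X, s x * (‖y₁ x‖ ^ 2 + ‖y₂ x‖ ^ 2)) - ε * m := by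
      simp only [G]
      rw [integral_sub (hn.const_mul _).integrableOn
        ((hy₁.const_mul _).const_mul _).integrableOn, integral_const_mul, integral_const_mul]
    rw [hGv] at hle
    linarith
  refine le_of_forall_pos_le_add fun δ hδ => ?_
  -- The 1 in the denominator covers m = 0.
  refine (hε (δ / (m + 1)) (by positivity)).trans ?_
  have : δ / (m + 1) * m ≤ δ := by
    rw [div_mul_eq_mul_div, div_le_iff₀ (by positivity)]
    nlinarith
  linarith

/-- Changing the sign of y₂ flips s, and exchanging the components (`IsSystemSolution.swap`) flips
c. Together with reflection these carry the bound on a left half-line to the right half-lines. -/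
theorem IsSystemSolution.neg_snd (h : IsSystemSolution c s a b y₁ y₂) :
    IsSystemSolution c (fun x => -s x) a b y₁ (fun x => -y₂ x) :=
  ⟨fun x => (h.1 x).congr_deriv (by push_cast; ring),
    fun x => (h.2 x).neg.congr_deriv (by push_cast; ring)⟩

theorem IsSystemSolution.swap (h : IsSystemSolution c s a b y₁ y₂) :
    IsSystemSolution (fun x => -c x) s a b y₂ y₁ :=
  ⟨fun x => (h.2 x).congr_deriv (by push_cast; ring),
    fun x => (h.1 x).congr_deriv (by push_cast; ring)⟩

/-- Lower bound for the Krein form on a half-line `[X, ∞)` on which the potential increases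
towards `2π`. -/
theorem IsSystemSolution.le_integral_kreinDensity_Ioi (h : IsSystemSolution c s a b y₁ y₂)
    (hc : ∀ x, HasDerivAt c (-(g x * s x)) x) (hs : ∀ x, HasDerivAt s (g x * c x) x)
    (hgc : Continuous g) (hc1 : ∀ x, |c x| ≤ 1) (hs1 : ∀ x, |s x| ≤ 1)
    (hg : ∀ x, X ≤ x → 0 ≤ g x) (hs0 : ∀ x, X ≤ x → 0 ≤ s x)
    (hcX : c X ≤ 0) (ha : 0 < a.im) (him : b.im = t * a.im)
    (hy₁ : Integrable fun x => ‖y₁ x‖ ^ 2) (hy₂ : Integrable fun x => ‖y₂ x‖ ^ 2)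
    (hlim : Tendsto y₂ atTop (𝓝 0)) :
    a.im * (1 - t ^ 2) * ∫ x in Ioi X, s x * (‖y₁ x‖ ^ 2 + ‖y₂ x‖ ^ 2) ≤
      ∫ x in Ioi X, kreinDensity c s a b y₁ y₂ x := by
  -- The new coefficients -c(-x), s(-x) are those of 2π - u(-x), which is increasing on the
  -- reflected half-line.
  have h' := h.comp_neg.neg_snd
  simp only [neg_neg] at h'
  have hl : Tendsto (fun x => -y₂ (-x)) atBot (𝓝 0) := by
    simpa using (hlim.comp tendsto_neg_atBot_atTop).neg
  have key := h'.le_integral_kreinDensity_Iic (g := fun x => g (-x)) (X := -X) (t := t)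
    (fun x => (((hc (-x)).scomp x (hasDerivAt_neg x)).neg).congr_deriv (by simp))
    (fun x => ((hs (-x)).scomp x (hasDerivAt_neg x)).congr_deriv (by simp))
    (by fun_prop) (fun x => by rw [abs_neg]; exact hc1 _) (fun x => hs1 _)
    (fun x hx => hg _ (by linarith)) (fun x hx => hs0 _ (by linarith)) (by simpa using hcX) ha him
    hy₁.comp_neg (by simpa using hy₂.comp_neg) hl
  have e1 : ∫ x in Iic (-X), s (-x) * (‖y₁ (-x)‖ ^ 2 + ‖-y₂ (-x)‖ ^ 2) =
      ∫ x in Ioi X, s x * (‖y₁ x‖ ^ 2 + ‖y₂ x‖ ^ 2) := by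
    rw [← neg_neg X, ← integral_comp_neg_Iic, neg_neg]
    simp only [norm_neg]
  have e2 : ∫ x in Iic (-X), kreinDensity (fun x => -c (-x)) (fun x => s (-x)) a b
      (fun x => y₁ (-x)) (fun x => -y₂ (-x)) x = ∫ x in Ioi X, kreinDensity c s a b y₁ y₂ x := by
    rw [← neg_neg X, ← integral_comp_neg_Iic, neg_neg]
    congr 1
    funext x
    simp only [kreinDensity, norm_neg, Complex.neg_re, Complex.neg_im]
    ring
  rwa [e1, e2] at key

/-- Lower bound for the Krein form on a half-line `[X, ∞)` on which the potential decreases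
towards `0`. -/
theorem IsSystemSolution.le_integral_kreinDensity_Ioi' (h : IsSystemSolution c s a b y₁ y₂)
    (hc : ∀ x, HasDerivAt c (-(g x * s x)) x) (hs : ∀ x, HasDerivAt s (g x * c x) x)
    (hgc : Continuous g) (hc1 : ∀ x, |c x| ≤ 1) (hs1 : ∀ x, |s x| ≤ 1)
    (hg : ∀ x, X ≤ x → g x ≤ 0) (hs0 : ∀ x, X ≤ x → 0 ≤ s x)
    (hcX : 0 ≤ c X) (ha : 0 < a.im) (him : b.im = t * a.im)
    (hy₁ : Integrable fun x => ‖y₁ x‖ ^ 2) (hy₂ : Integrable fun x => ‖y₂ x‖ ^ 2)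
    (hlim : Tendsto y₁ atTop (𝓝 0)) :
    a.im * (1 - t ^ 2) * ∫ x in Ioi X, s x * (‖y₁ x‖ ^ 2 + ‖y₂ x‖ ^ 2) ≤
      ∫ x in Ioi X, kreinDensity c s a b y₁ y₂ x := by
  -- The new coefficients c(-x), s(-x) are those of u(-x), which is increasing on the reflected
  -- half-line. The exchange makes y₁ the component in the boundary term.
  have h' := h.comp_neg.swap.neg_snd
  simp only [neg_neg] at h'
  have hl : Tendsto (fun x => -y₁ (-x)) atBot (𝓝 0) := by
    simpa using (hlim.comp tendsto_neg_atBot_atTop).neg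
  have key := h'.le_integral_kreinDensity_Iic (g := fun x => -g (-x)) (X := -X) (t := t)
    (fun x => ((hc (-x)).scomp x (hasDerivAt_neg x)).congr_deriv (by simp))
    (fun x => ((hs (-x)).scomp x (hasDerivAt_neg x)).congr_deriv (by simp))
    (by fun_prop) (fun x => hc1 _) (fun x => hs1 _)
    (fun x hx => neg_nonneg.2 (hg _ (by linarith))) (fun x hx => hs0 _ (by linarith))
    (by simpa using hcX) ha him hy₂.comp_neg (by simpa using hy₁.comp_neg) hl
  have e1 : ∫ x in Iic (-X), s (-x) * (‖y₂ (-x)‖ ^ 2 + ‖-y₁ (-x)‖ ^ 2) =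
      ∫ x in Ioi X, s x * (‖y₁ x‖ ^ 2 + ‖y₂ x‖ ^ 2) := by
    rw [← neg_neg X, ← integral_comp_neg_Iic, neg_neg]
    simp only [norm_neg, add_comm]
  have e2 : ∫ x in Iic (-X), kreinDensity (fun x => c (-x)) (fun x => s (-x)) a b
      (fun x => y₂ (-x)) (fun x => -y₁ (-x)) x = ∫ x in Ioi X, kreinDensity c s a b y₁ y₂ x := by
    rw [← neg_neg X, ← integral_comp_neg_Iic, neg_neg]
    congr 1
    funext x
    simp only [kreinDensity, norm_neg, Complex.neg_re, Complex.neg_im]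
    ring
  rwa [e1, e2] at key

theorem integral_pos_of_le_half_lines {f k : ℝ → ℝ} {K : ℝ} (hK : 0 < K) (hf : Continuous f)
    (hf0 : ∀ x, 0 ≤ f x) (hfX : 0 < f X) (hfi : Integrable f) (hki : Integrable k)
    (hl : K * ∫ x in Iic X, f x ≤ ∫ x in Iic X, k x)
    (hr : K * ∫ x in Ioi X, f x ≤ ∫ x in Ioi X, k x) : 0 < ∫ x, k x := by
  have h1 := intervalIntegral.integral_Iic_add_Ioi (b := X) hfi.integrableOn hfi.integrableOn
  have h2 := intervalIntegral.integral_Iic_add_Ioi (b := X) hki.integrableOn hki.integrableOn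
  have h3 : 0 < ∫ x, f x := by
    rw [integral_pos_iff_support_of_nonneg hf0 hfi]
    exact hf.isOpen_support.measure_pos volume ⟨X, hfX.ne'⟩
  have h4 := mul_pos hK h3
  rw [← h1] at h4
  rw [← h2]
  linarith

theorem IsSystemSolution.norm_sq_add_pos (h : IsSystemSolution c s a b y₁ y₂)
    (hc1 : ∀ x, |c x| ≤ 1) (hs1 : ∀ x, |s x| ≤ 1) (hne : ∃ x, y₁ x ≠ 0 ∨ y₂ x ≠ 0) (x : ℝ) :
    0 < ‖y₁ x‖ ^ 2 + ‖y₂ x‖ ^ 2 := by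
  by_contra! h0
  have e1 : y₁ x = 0 := by
    rw [← norm_eq_zero, ← sq_eq_zero_iff]
    linarith [sq_nonneg ‖y₁ x‖, sq_nonneg ‖y₂ x‖]
  have e2 : y₂ x = 0 := by
    rw [← norm_eq_zero, ← sq_eq_zero_iff]
    linarith [sq_nonneg ‖y₁ x‖, sq_nonneg ‖y₂ x‖]
  obtain ⟨f1, f2⟩ := h.eq_of_eq_at hc1 hs1 isSystemSolution_zero e1 e2
  obtain ⟨x', hx' | hx'⟩ := hne
  · exact hx' (congrFun f1 x')
  · exact hx' (congrFun f2 x')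

/-- If the integral of the Krein density is nonzero, then the parameters have purely imaginary
`a` and real `b`. -/
theorem IsSystemSolution.eq_zero_of_integral_ne_zero (h : IsSystemSolution c s a b y₁ y₂)
    (hre : a.re = t * b.re) (him : b.im = t * a.im)
    (hk : Integrable (kreinDensity c s a b y₁ y₂))
    (hK : ∫ x, kreinDensity c s a b y₁ y₂ x ≠ 0)
    (hbot₁ : Tendsto y₁ atBot (𝓝 0)) (hbot₂ : Tendsto y₂ atBot (𝓝 0))
    (htop₁ : Tendsto y₁ atTop (𝓝 0)) (htop₂ : Tendsto y₂ atTop (𝓝 0)) : t = 0 := by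
  have hlim : ∀ l : Filter ℝ, Tendsto y₁ l (𝓝 0) → Tendsto y₂ l (𝓝 0) →
      Tendsto (fun x => (y₁ x).re * (y₂ x).re + (y₁ x).im * (y₂ x).im) l (𝓝 0) := by
    intro l h1 h2
    have r1 := (Complex.continuous_re.tendsto _).comp h1
    have r2 := (Complex.continuous_re.tendsto _).comp h2
    have i1 := (Complex.continuous_im.tendsto _).comp h1
    have i2 := (Complex.continuous_im.tendsto _).comp h2
    simpa using (r1.mul r2).add (i1.mul i2)
  -- The integral of -t times the density is the difference of the limits of Re(y₁ȳ₂), both zero.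
  have := integral_of_hasDerivAt_of_tendsto (fun x => h.hasDerivAt_re_mul_conj hre him x)
    (hk.const_mul (-t)) (hlim _ hbot₁ hbot₂) (hlim _ htop₁ htop₂)
  rw [integral_const_mul, sub_zero, mul_eq_zero, or_iff_left hK, neg_eq_zero] at this
  exact this

end Krein

/-! ### From the matrix formulation to the system in components -/

section Conversion

/-- The coefficient `(z - 1/z) / 4`. -/
def diagParam (z : ℂ) : ℂ := (1 / 4 : ℂ) * (z - 1 / z)

/-- The coefficient `(z + 1/z) / 4`. -/
def offDiagParam (z : ℂ) : ℂ := (1 / 4 : ℂ) * (z + 1 / z)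

/-- The function `cos (u / 2)`. -/
def cosHalf (u : ℝ → ℝ) (x : ℝ) : ℝ := Real.cos (u x / 2)

/-- The function `sin (u / 2)`. -/
def sinHalf (u : ℝ → ℝ) (x : ℝ) : ℝ := Real.sin (u x / 2)

variable {u : ℝ → ℝ} {z : ℂ} {Φ Ψ : ℝ → Fin 2 → ℂ}

theorem isSolution_iff : IsSolution u z Φ ↔ IsSystemSolution (cosHalf u) (sinHalf u)
    (diagParam z) (offDiagParam z) (fun x => Φ x 0) (fun x => Φ x 1) := by
  have e : ∀ x, coeff u z x *ᵥ Φ x =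
      ![-Complex.I * diagParam z * cosHalf u x * Φ x 0 +
          Complex.I * offDiagParam z * sinHalf u x * Φ x 1,
        Complex.I * offDiagParam z * sinHalf u x * Φ x 0 +
          Complex.I * diagParam z * cosHalf u x * Φ x 1] := by
    intro x
    ext i
    fin_cases i <;>
    · simp only [coeff, tau1, tau2, diagParam, offDiagParam, cosHalf, sinHalf, Matrix.mulVec,
        dotProduct, Fin.sum_univ_two, Matrix.add_apply, Matrix.smul_apply]
      simp
      ring
  simp only [IsSolution, hasDerivAt_pi, Fin.forall_fin_two, e]
  exact forall_and

theorem diagParam_im_pos (hz : 0 < z.im) : 0 < (diagParam z).im := by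
  have hn : 0 < Complex.normSq z := Complex.normSq_pos.2 fun h => by simp [h] at hz
  have : (diagParam z).im = 1 / 4 * (z.im + z.im / Complex.normSq z) := by
    simp [diagParam, Complex.mul_im, Complex.inv_im, neg_div]
  rw [this]
  positivity

/-- The comparison vector has one nonvanishing component, whose modulus is its norm. The equivalence
can therefore be divided through by that exponential in each component. -/
theorem isEquivalent_vecCons_zero_iff {l : Filter ℝ} {w : ℝ → ℂ} :
    Asymptotics.IsEquivalent l Ψ (fun x => ![Complex.exp (-w x), 0]) ↔
      Tendsto (fun x => Ψ x 0 * Complex.exp (w x)) l (𝓝 1) ∧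
        Tendsto (fun x => Ψ x 1 * Complex.exp (w x)) l (𝓝 0) := by
  have hn : ∀ g : ℂ, ‖(![g, 0] : Fin 2 → ℂ)‖ = ‖g‖ := by
    intro g
    simp [Pi.norm_def, Finset.univ_fin2]
  have h1 : ∀ x, Complex.exp (-w x) ≠ 0 := fun x => Complex.exp_ne_zero _
  rw [Asymptotics.IsEquivalent, ← Asymptotics.isLittleO_norm_right]
  simp only [hn]
  rw [Asymptotics.isLittleO_norm_right, Asymptotics.isLittleO_pi, Fin.forall_fin_two,
    Asymptotics.isLittleO_iff_tendsto fun x hx => absurd hx (h1 x),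
    Asymptotics.isLittleO_iff_tendsto fun x hx => absurd hx (h1 x)]
  have e : ∀ x, (Ψ x 0 - Complex.exp (-w x)) / Complex.exp (-w x) =
      Ψ x 0 * Complex.exp (w x) - 1 := by
    intro x
    rw [sub_div, div_self (h1 x), Complex.exp_neg, div_inv_eq_mul]
  have e' : ∀ x, (Ψ x 1 - 0) / Complex.exp (-w x) = Ψ x 1 * Complex.exp (w x) := by
    intro x
    rw [sub_zero, Complex.exp_neg, div_inv_eq_mul]
  simp only [Pi.sub_apply, cons_val_zero, cons_val_one, e, e']
  rw [tendsto_sub_nhds_zero_iff]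

/-- Interchange of the two components. -/
def swapVec (v : Fin 2 → ℂ) : Fin 2 → ℂ := ![v 1, v 0]

theorem swapVec_swapVec (v : Fin 2 → ℂ) : swapVec (swapVec v) = v := by
  ext i; fin_cases i <;> rfl

theorem norm_swapVec (v : Fin 2 → ℂ) : ‖swapVec v‖ = ‖v‖ := by
  simp [Pi.norm_def, Finset.univ_fin2, swapVec, max_comm]

theorem isEquivalent_swapVec {l : Filter ℝ} {Ψ' : ℝ → Fin 2 → ℂ}
    (h : Asymptotics.IsEquivalent l Ψ Ψ') :
    Asymptotics.IsEquivalent l (fun x => swapVec (Ψ x)) (fun x => swapVec (Ψ' x)) := by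
  rw [Asymptotics.IsEquivalent, ← Asymptotics.isLittleO_norm_norm] at h ⊢
  refine h.congr (fun x => ?_) (fun x => (norm_swapVec _).symm)
  rw [← norm_swapVec]
  congr 1
  ext i; fin_cases i <;> rfl

theorem free_upper (x : ℝ) : free u z ![1, 0] x =
    ![Complex.exp (-(Complex.I * diagParam z * (∫ t in (0 : ℝ)..x, cosHalf u t : ℝ))), 0] := by
  simp [free, diagParam, cosHalf, mul_assoc]

theorem free_lower (x : ℝ) : free u z ![0, 1] x =
    swapVec ![Complex.exp (-(Complex.I * diagParam z *
      (∫ t in (0 : ℝ)..x, -cosHalf u t : ℝ))), 0] := by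
  simp [free, diagParam, cosHalf, mul_assoc, swapVec]

theorem isLeftJost_iff (hz : 0 < z.im) : IsLeftJost u z Ψ ↔
    IsLeftSystemJost (cosHalf u) (sinHalf u) (diagParam z) (offDiagParam z)
      (fun x => Ψ x 0) (fun x => Ψ x 1) := by
  have e : free u z (leftDir z) = fun x => ![Complex.exp (-(Complex.I * diagParam z *
      (∫ t in (0 : ℝ)..x, cosHalf u t : ℝ))), 0] := by
    funext x
    rw [leftDir, if_pos hz, free_upper]
  rw [IsLeftJost, e, isEquivalent_vecCons_zero_iff, isSolution_iff]
  exact ⟨fun h => ⟨h.1, h.2.1, h.2.2⟩, fun h => ⟨h.1, h.2, h.3⟩⟩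

theorem isRightJost_one_iff (hz : 0 < z.im) : IsRightJost u 1 z Ψ ↔
    IsRightSystemJost (cosHalf u) (sinHalf u) (diagParam z) (offDiagParam z)
      (fun x => Ψ x 0) (fun x => Ψ x 1) := by
  have e : free u z (rightDir 1 z) = fun x => ![Complex.exp (-(Complex.I * diagParam z *
      (∫ t in (0 : ℝ)..x, cosHalf u t : ℝ))), 0] := by
    funext x
    rw [rightDir, if_pos (iff_of_true hz odd_one), free_upper]
  rw [IsRightJost, e, isEquivalent_vecCons_zero_iff, isSolution_iff]
  exact ⟨fun h => ⟨h.1, h.2.1, h.2.2⟩, fun h => ⟨h.1, h.2, h.3⟩⟩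

/-- For charge 0 the decaying direction at `+∞` is (0, 1). Exchanging the components replaces c by
-c, which tends to -1, and so reduces to the normalisation used for charge 1. -/
theorem isRightJost_zero_iff (hz : 0 < z.im) : IsRightJost u 0 z Ψ ↔
    IsRightSystemJost (fun x => -cosHalf u x) (sinHalf u) (diagParam z) (offDiagParam z)
      (fun x => Ψ x 1) (fun x => Ψ x 0) := by
  have e : free u z (rightDir 0 z) = fun x => swapVec ![Complex.exp (-(Complex.I * diagParam z *
      (∫ t in (0 : ℝ)..x, -cosHalf u t : ℝ))), 0] := by
    funext x
    rw [rightDir, if_neg (by simp [hz]), free_lower]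
  have e2 : Asymptotics.IsEquivalent atTop Ψ (free u z (rightDir 0 z)) ↔
      Asymptotics.IsEquivalent atTop (fun x => swapVec (Ψ x)) (fun x =>
        ![Complex.exp (-(Complex.I * diagParam z * (∫ t in (0 : ℝ)..x, -cosHalf u t : ℝ))), 0]) := by
    rw [e]
    constructor
    · intro h
      simpa only [swapVec_swapVec] using isEquivalent_swapVec h
    · intro h
      simpa only [swapVec_swapVec] using isEquivalent_swapVec h
  rw [IsRightJost, e2, isEquivalent_vecCons_zero_iff, isSolution_iff]
  refine ⟨fun h => ⟨h.1.swap, h.2.1, h.2.2⟩, fun h => ⟨?_, h.2, h.3⟩⟩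
  simpa only [neg_neg] using h.1.swap

end Conversion

/-! ### The symmetry `z ↦ 1/z` -/

section Inversion

variable {u : ℝ → ℝ} {z : ℂ} {Q : ℤ} {Φ Ψ : ℝ → Fin 2 → ℂ}

theorem diagParam_inv (z : ℂ) : diagParam (1 / z) = -diagParam z := by
  simp only [diagParam, one_div, inv_inv]; ring

theorem offDiagParam_inv (z : ℂ) : offDiagParam (1 / z) = offDiagParam z := by
  simp only [offDiagParam, one_div, inv_inv]; ring

/-- Inversion changes the sign of a and fixes b, and the exchange of components undoes exactly this.
-/
theorem isSolution_swap (h : IsSolution u z Φ) :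
    IsSolution u (1 / z) fun x => swapVec (Φ x) := by
  rw [isSolution_iff] at h ⊢
  rw [diagParam_inv, offDiagParam_inv]
  refine ⟨fun x => (h.2 x).congr_deriv ?_, fun x => (h.1 x).congr_deriv ?_⟩ <;>
  · simp only [swapVec, cons_val_zero, cons_val_one]
    ring

theorem free_swap (e : Fin 2 → ℂ) (x : ℝ) :
    free u (1 / z) (swapVec e) x = swapVec (free u z e x) := by
  have h : ∀ w : ℂ, (1 / 4 : ℂ) * (1 / z - 1 / (1 / z)) * w = -((1 / 4 : ℂ) * (z - 1 / z) * w) := by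
    intro w
    simp only [one_div, inv_inv]; ring
  ext i
  fin_cases i <;> simp only [free, swapVec, h] <;> simp

theorem im_inv_pos_iff : 0 < (1 / z).im ↔ z.im < 0 := by
  rcases eq_or_ne z 0 with rfl | hz
  · simp
  have hn : 0 < Complex.normSq z := Complex.normSq_pos.2 hz
  rw [one_div, Complex.inv_im, div_pos_iff_of_pos_right hn]
  exact neg_pos

theorem im_inv_ne_zero (hz : z.im ≠ 0) : (1 / z).im ≠ 0 := by
  have h0 : z ≠ 0 := fun h => hz (by simp [h])
  rw [one_div, Complex.inv_im]
  exact div_ne_zero (neg_ne_zero.2 hz) (Complex.normSq_pos.2 h0).ne'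

theorem im_inv_pos_iff_not (hz : z.im ≠ 0) : 0 < (1 / z).im ↔ ¬ 0 < z.im := by
  rw [im_inv_pos_iff, not_lt]
  exact ⟨le_of_lt, fun h => lt_of_le_of_ne h hz⟩

theorem leftDir_inv (hz : z.im ≠ 0) : leftDir (1 / z) = swapVec (leftDir z) := by
  simp only [leftDir, im_inv_pos_iff_not hz]
  by_cases h : 0 < z.im
  · rw [if_neg (not_not.2 h), if_pos h]; rfl
  · rw [if_pos h, if_neg h]; rfl

theorem rightDir_inv (hz : z.im ≠ 0) : rightDir Q (1 / z) = swapVec (rightDir Q z) := by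
  simp only [rightDir, im_inv_pos_iff_not hz]
  by_cases h : (0 < z.im ↔ Odd Q)
  · rw [if_neg (by tauto), if_pos h]; rfl
  · rw [if_pos (by tauto), if_neg h]; rfl

theorem isLeftJost_swap (hz : z.im ≠ 0) (h : IsLeftJost u z Ψ) :
    IsLeftJost u (1 / z) fun x => swapVec (Ψ x) := by
  refine ⟨isSolution_swap h.1, ?_⟩
  have e : free u (1 / z) (leftDir (1 / z)) = fun x => swapVec (free u z (leftDir z) x) := by
    funext x; rw [leftDir_inv hz, free_swap]
  rw [e]
  exact isEquivalent_swapVec h.2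

theorem isRightJost_swap (hz : z.im ≠ 0) (h : IsRightJost u Q z Ψ) :
    IsRightJost u Q (1 / z) fun x => swapVec (Ψ x) := by
  refine ⟨isSolution_swap h.1, ?_⟩
  have e : free u (1 / z) (rightDir Q (1 / z)) = fun x => swapVec (free u z (rightDir Q z) x) := by
    funext x; rw [rightDir_inv hz, free_swap]
  rw [e]
  exact isEquivalent_swapVec h.2

theorem wronskian_swap (x : ℝ) :
    wronskian (fun x => swapVec (Ψ x)) (fun x => swapVec (Φ x)) x = -wronskian Ψ Φ x := by
  simp only [wronskian, swapVec, cons_val_zero, cons_val_one]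
  ring

theorem memLp_swap (h : MemLp Φ 2 volume) : MemLp (fun x => swapVec (Φ x)) 2 volume := by
  refine MemLp.of_le h ?_ (Eventually.of_forall fun x => (norm_swapVec _).le)
  have hc : Continuous swapVec := by
    unfold swapVec; fun_prop
  exact hc.comp_aestronglyMeasurable h.1

theorem mem_eigenspace_swap (h : Φ ∈ eigenspace u z) :
    (fun x => swapVec (Φ x)) ∈ eigenspace u (1 / z) :=
  ⟨isSolution_swap h.1, memLp_swap h.2⟩

theorem isEigenvalue_inv (h : IsEigenvalue u z) : IsEigenvalue u (1 / z) := by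
  obtain ⟨h0, Φ, hΦ, hne⟩ := h
  refine ⟨one_div_ne_zero h0, _, mem_eigenspace_swap hΦ, fun h => hne ?_⟩
  funext x
  rw [← swapVec_swapVec (Φ x), congrFun h x]
  ext i; fin_cases i <;> rfl

end Inversion

/-! ### Potentials provide admissible coefficient functions -/

section Data

variable {u : ℝ → ℝ}

/-- Near `-∞` the function c is nonnegative, so the absolute value in the hypothesis disappears; the
remaining interval is compact. -/
theorem integrableOn_one_sub {c : ℝ → ℝ} (hc : Continuous c) (hlim : Tendsto c atBot (𝓝 1))
    (hi : Integrable fun x => 1 - |c x|) (x : ℝ) : IntegrableOn (fun y => 1 - c y) (Iic x) := by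
  obtain ⟨N, hN⟩ := eventually_atBot.1 (hlim.eventually (eventually_ge_nhds zero_lt_one))
  have h1 : IntegrableOn (fun y => 1 - c y) (Iic N) :=
    hi.integrableOn.congr_fun (fun y hy => by
      simp only [abs_of_nonneg (hN y hy)]) measurableSet_Iic
  have h2 : IntegrableOn (fun y => 1 - c y) (Icc N x) :=
    ((continuous_const.sub hc).continuousOn).integrableOn_Icc
  refine (h1.union h2).mono_set fun y hy => ?_
  rcases le_total y N with h | h
  · exact Or.inl h
  · exact Or.inr ⟨h, hy⟩

theorem tendsto_cosHalf {l : Filter ℝ} {y : ℝ} (hu : Tendsto u l (𝓝 y)) :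
    Tendsto (cosHalf u) l (𝓝 (Real.cos (y / 2))) :=
  (Real.continuous_cos.tendsto _).comp (hu.div_const 2)

variable (h : IsPotential u)
include h

theorem IsPotential.continuous_cosHalf : Continuous (cosHalf u) := by
  have := h.contDiff.continuous
  unfold cosHalf; fun_prop

theorem IsPotential.continuous_sinHalf : Continuous (sinHalf u) := by
  have := h.contDiff.continuous
  unfold sinHalf; fun_prop

theorem IsPotential.isLeftData (hu : Tendsto u atBot (𝓝 0)) :
    IsLeftData (cosHalf u) (sinHalf u) where
  continuous_c := h.continuous_cosHalf
  continuous_s := h.continuous_sinHalf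
  abs_c_le x := Real.abs_cos_le_one _
  abs_s_le x := Real.abs_sin_le_one _
  integrableOn_c := integrableOn_one_sub h.continuous_cosHalf
    (by simpa using tendsto_cosHalf hu) h.integrable_cos
  integrableOn_s x := h.integrable_sin.integrableOn

theorem IsPotential.isRightData_one (hu : Tendsto u atTop (𝓝 (2 * Real.pi))) :
    IsRightData (cosHalf u) (sinHalf u) where
  continuous_c := (h.continuous_cosHalf.comp continuous_neg).neg
  continuous_s := (h.continuous_sinHalf.comp continuous_neg).neg
  abs_c_le x := by rw [abs_neg]; exact Real.abs_cos_le_one _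
  abs_s_le x := by rw [abs_neg]; exact Real.abs_sin_le_one _
  integrableOn_c := by
    refine integrableOn_one_sub (h.continuous_cosHalf.comp continuous_neg).neg ?_ ?_
    · have := ((tendsto_cosHalf hu).comp tendsto_neg_atBot_atTop).neg
      simpa using this
    · simp only [abs_neg]
      exact h.integrable_cos.comp_neg
  integrableOn_s x := h.integrable_sin.comp_neg.neg.integrableOn

theorem IsPotential.isRightData_zero (hu : Tendsto u atTop (𝓝 0)) :
    IsRightData (fun x => -cosHalf u x) (sinHalf u) where
  continuous_c := (h.continuous_cosHalf.comp continuous_neg).neg.neg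
  continuous_s := (h.continuous_sinHalf.comp continuous_neg).neg
  abs_c_le x := by rw [neg_neg]; exact Real.abs_cos_le_one _
  abs_s_le x := by rw [abs_neg]; exact Real.abs_sin_le_one _
  integrableOn_c := by
    simp only [neg_neg]
    refine integrableOn_one_sub (h.continuous_cosHalf.comp continuous_neg) ?_
      h.integrable_cos.comp_neg
    have := (tendsto_cosHalf hu).comp tendsto_neg_atBot_atTop
    rw [zero_div, Real.cos_zero] at this
    exact this
  integrableOn_s x := h.integrable_sin.comp_neg.neg.integrableOn

end Data

/-! ### Jost theory in the spectral parameter and the Wronskian function -/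

section Spectrum

variable {u : ℝ → ℝ} {Q : ℤ} {z : ℂ} {Φ Ψ Z : ℝ → Fin 2 → ℂ}

/-- Existence and uniqueness of the Jost solutions at one end for parameters in the upper half
plane, with locally uniform estimates on the half-line `S`; square integrable solutions are
multiples of the Jost solution. -/
structure HasJostTheory (u : ℝ → ℝ) (J : ℂ → (ℝ → Fin 2 → ℂ) → Prop) (S : Set ℝ) : Prop where
  isSolution : ∀ z Φ, J z Φ → IsSolution u z Φ
  exists_family : ∀ M > 0, ∃ q : ℂ → ℝ → Fin 2 → ℂ, ∃ C : ℝ, 0 ≤ C ∧ ∀ z : ℂ, 0 < z.im →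
    ‖diagParam z‖ + ‖offDiagParam z‖ ≤ M → J z (q z) ∧
    (∀ x ∈ S, ∀ i, ‖q z x i‖ ≤ C * Real.exp (-((diagParam z).im * |x|))) ∧
    ∀ x, ∃ K : ℝ, ∀ z' : ℂ, 0 < z'.im → (diagParam z).im / 2 ≤ (diagParam z').im →
      ‖diagParam z'‖ + ‖offDiagParam z'‖ ≤ M → ∀ i, ‖q z' x i - q z x i‖ ≤
        K * (‖diagParam z' - diagParam z‖ + ‖offDiagParam z' - offDiagParam z‖)
  unique : ∀ z, 0 < z.im → ∀ Φ Ψ, J z Φ → J z Ψ → Φ = Ψ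
  eq_smul : ∀ z, 0 < z.im → ∀ Φ, J z Φ → ∀ Z ∈ eigenspace u z, ∃ l : ℂ, Z = l • Φ

theorem memLp_component (h : MemLp Z 2 volume) (i : Fin 2) : MemLp (fun x => Z x i) 2 volume :=
  MemLp.of_le h ((continuous_apply i).comp_aestronglyMeasurable h.1)
    (Eventually.of_forall fun _ => norm_le_pi_norm _ i)

theorem hasJostTheory_left (hd : IsLeftData (cosHalf u) (sinHalf u)) :
    HasJostTheory u (IsLeftJost u) (Iic 0) := by
  have hfam : ∀ M > 0, ∃ q : ℂ → ℝ → Fin 2 → ℂ, ∃ C : ℝ, 0 ≤ C ∧ ∀ z : ℂ, 0 < z.im →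
      ‖diagParam z‖ + ‖offDiagParam z‖ ≤ M → IsLeftJost u z (q z) ∧
      (∀ x ∈ Iic (0 : ℝ), ∀ i, ‖q z x i‖ ≤ C * Real.exp (-((diagParam z).im * |x|))) ∧
      ∀ x, ∃ K : ℝ, ∀ z' : ℂ, 0 < z'.im → (diagParam z).im / 2 ≤ (diagParam z').im →
        ‖diagParam z'‖ + ‖offDiagParam z'‖ ≤ M → ∀ i, ‖q z' x i - q z x i‖ ≤
          K * (‖diagParam z' - diagParam z‖ + ‖offDiagParam z' - offDiagParam z‖) := by
    intro M hM
    obtain ⟨y₁, y₂, C, hC, h⟩ := hd.exists_jost hM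
    refine ⟨fun z x => ![y₁ (diagParam z) (offDiagParam z) x, y₂ (diagParam z) (offDiagParam z) x],
      C, hC, fun z hz hzM => ?_⟩
    obtain ⟨h1, h2, h3⟩ := h _ _ (diagParam_im_pos hz) hzM
    refine ⟨(isLeftJost_iff hz).2 h1, fun x hx i => ?_, fun x => ?_⟩
    · rw [abs_of_nonpos hx, mul_neg, neg_neg]
      fin_cases i
      exacts [(h2 x hx).1, (h2 x hx).2]
    · obtain ⟨K, hK⟩ := h3 x
      refine ⟨K, fun z' _ h4 h5 i => ?_⟩
      fin_cases i
      exacts [(hK _ _ h4 h5).1, (hK _ _ h4 h5).2]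
  have huniq : ∀ z, 0 < z.im → ∀ Φ Ψ, IsLeftJost u z Φ → IsLeftJost u z Ψ → Φ = Ψ := by
    intro z hz Φ Ψ h1 h2
    obtain ⟨e1, e2⟩ := ((isLeftJost_iff hz).1 h2).unique hd (diagParam_im_pos hz)
      ((isLeftJost_iff hz).1 h1)
    funext x i
    fin_cases i
    exacts [congrFun e1 x, congrFun e2 x]
  refine ⟨fun z Φ h => h.1, hfam, huniq, fun z hz Φ hΦ Z hZ => ?_⟩
  obtain ⟨q, C, -, hq⟩ := hfam (‖diagParam z‖ + ‖offDiagParam z‖ + 1) (by positivity)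
  obtain ⟨h1, h2, -⟩ := hq z hz (by linarith)
  rw [huniq z hz Φ _ hΦ h1]
  obtain ⟨l, e1, e2⟩ := ((isLeftJost_iff hz).1 h1).exists_eq_mul hd (C := C) (diagParam_im_pos hz)
    (fun x hx => by
      have := h2 x hx
      rw [abs_of_nonpos hx, mul_neg, neg_neg] at this
      exact ⟨this 0, this 1⟩) (isSolution_iff.1 hZ.1)
    ((memLp_component hZ.2 0).restrict _) ((memLp_component hZ.2 1).restrict _)
  refine ⟨l, ?_⟩
  funext x i
  fin_cases i
  exacts [e1 x, e2 x]

/-- The theory at `+∞`, for both charges: `σ` is the identity or the interchange of the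
components. -/
theorem hasJostTheory_right {c : ℝ → ℝ} (hd : IsRightData c (sinHalf u)) (σ : Fin 2 → Fin 2)
    (hσ : ∀ i, σ (σ i) = i)
    (hsol : ∀ z Z, IsSolution u z Z → IsSystemSolution c (sinHalf u) (diagParam z)
      (offDiagParam z) (fun x => Z x (σ 0)) (fun x => Z x (σ 1)))
    (hJ : ∀ z : ℂ, 0 < z.im → ∀ Φ, IsRightJost u Q z Φ ↔ IsRightSystemJost c (sinHalf u)
      (diagParam z) (offDiagParam z) (fun x => Φ x (σ 0)) (fun x => Φ x (σ 1))) :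
    HasJostTheory u (IsRightJost u Q) (Ici 0) := by
  -- An involution is surjective, so checking at `σ 0` and `σ 1` suffices.
  have hall : ∀ P : Fin 2 → Prop, P (σ 0) → P (σ 1) → ∀ i, P i := by
    intro P h0 h1 i
    rw [← hσ i]
    generalize σ i = j
    fin_cases j
    exacts [h0, h1]
  have hfam : ∀ M > 0, ∃ q : ℂ → ℝ → Fin 2 → ℂ, ∃ C : ℝ, 0 ≤ C ∧ ∀ z : ℂ, 0 < z.im →
      ‖diagParam z‖ + ‖offDiagParam z‖ ≤ M → IsRightJost u Q z (q z) ∧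
      (∀ x ∈ Ici (0 : ℝ), ∀ i, ‖q z x i‖ ≤ C * Real.exp (-((diagParam z).im * |x|))) ∧
      ∀ x, ∃ K : ℝ, ∀ z' : ℂ, 0 < z'.im → (diagParam z).im / 2 ≤ (diagParam z').im →
        ‖diagParam z'‖ + ‖offDiagParam z'‖ ≤ M → ∀ i, ‖q z' x i - q z x i‖ ≤
          K * (‖diagParam z' - diagParam z‖ + ‖offDiagParam z' - offDiagParam z‖) := by
    intro M hM
    obtain ⟨y₁, y₂, C, hC, h⟩ := hd.exists_jost hM
    let q : ℂ → ℝ → Fin 2 → ℂ := fun z x i =>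
      ![y₁ (diagParam z) (offDiagParam z) x, y₂ (diagParam z) (offDiagParam z) x] (σ i)
    have q0 : ∀ z x, q z x (σ 0) = y₁ (diagParam z) (offDiagParam z) x := by
      intro z x; simp only [q, hσ]; rfl
    have q1 : ∀ z x, q z x (σ 1) = y₂ (diagParam z) (offDiagParam z) x := by
      intro z x; simp only [q, hσ]; rfl
    refine ⟨q, C, hC, fun z hz hzM => ?_⟩
    obtain ⟨h1, h2, h3⟩ := h _ _ (diagParam_im_pos hz) hzM
    refine ⟨(hJ z hz _).2 ?_, fun x hx => ?_, fun x => ?_⟩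
    · simp only [q0, q1]
      exact h1
    · rw [abs_of_nonneg hx]
      refine hall _ ?_ ?_
      · rw [q0]; exact (h2 x hx).1
      · rw [q1]; exact (h2 x hx).2
    · obtain ⟨K, hK⟩ := h3 x
      refine ⟨K, fun z' _ h4 h5 => hall _ ?_ ?_⟩
      · rw [q0, q0]; exact (hK _ _ h4 h5).1
      · rw [q1, q1]; exact (hK _ _ h4 h5).2
  have huniq : ∀ z, 0 < z.im → ∀ Φ Ψ, IsRightJost u Q z Φ → IsRightJost u Q z Ψ → Φ = Ψ := by
    intro z hz Φ Ψ h1 h2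
    obtain ⟨e1, e2⟩ := ((hJ z hz _).1 h2).unique hd (diagParam_im_pos hz) ((hJ z hz _).1 h1)
    funext x
    ext i
    revert i
    exact hall _ (congrFun e1 x) (congrFun e2 x)
  refine ⟨fun z Φ h => h.1, hfam, huniq, fun z hz Φ hΦ Z hZ => ?_⟩
  obtain ⟨q, C, -, hq⟩ := hfam (‖diagParam z‖ + ‖offDiagParam z‖ + 1) (by positivity)
  obtain ⟨h1, h2, -⟩ := hq z hz (by linarith)
  rw [huniq z hz Φ _ hΦ h1]
  obtain ⟨l, e1, e2⟩ := ((hJ z hz _).1 h1).exists_eq_mul hd (C := C) (diagParam_im_pos hz)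
    (fun x hx => by
      have := h2 x hx
      rw [abs_of_nonneg hx] at this
      exact ⟨this _, this _⟩) (hsol z Z hZ.1)
    (memLp_component hZ.2 _) (memLp_component hZ.2 _)
  refine ⟨l, ?_⟩
  funext x
  ext i
  revert i
  exact hall _ (e1 x) (e2 x)

variable (hL : HasJostTheory u (IsLeftJost u) (Iic 0))
  (hR : HasJostTheory u (IsRightJost u Q) (Ici 0))

theorem wronskian_eq (hΦ : IsSolution u z Φ) (hΨ : IsSolution u z Ψ) (x x' : ℝ) :
    wronskian Φ Ψ x = wronskian Φ Ψ x' :=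
  (isSolution_iff.1 hΦ).wronskian_eq (isSolution_iff.1 hΨ) x x'

theorem HasJostTheory.exists {J : ℂ → (ℝ → Fin 2 → ℂ) → Prop} {S : Set ℝ}
    (h : HasJostTheory u J S) (hz : 0 < z.im) : ∃ Φ, J z Φ := by
  obtain ⟨q, C, hC, hq⟩ := h.exists_family (‖diagParam z‖ + ‖offDiagParam z‖ + 1) (by positivity)
  exact ⟨q z, (hq z hz (by linarith)).1⟩

include hL hR

/-- The Wronskian of the Jost solutions is well defined off the real axis. -/
theorem exists_isJostWronskian : ∃ W, IsJostWronskian u Q W ∧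
    ∀ z : ℂ, z.im ≠ 0 → W (1 / z) = -W z := by
  have hup : ∀ z : ℂ, 0 < z.im → ∃ w : ℂ, ∀ Ψ Φ, IsLeftJost u z Ψ → IsRightJost u Q z Φ →
      ∀ x, wronskian Ψ Φ x = w := by
    intro z hz
    obtain ⟨Ψ₀, hΨ₀⟩ := hL.exists hz
    obtain ⟨Φ₀, hΦ₀⟩ := hR.exists hz
    refine ⟨wronskian Ψ₀ Φ₀ 0, fun Ψ Φ hΨ hΦ x => ?_⟩
    rw [hL.unique z hz Ψ Ψ₀ hΨ hΨ₀, hR.unique z hz Φ Φ₀ hΦ hΦ₀]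
    exact wronskian_eq hΨ₀.1 hΦ₀.1 x 0
  choose! w hw using hup
  have hlow : ∀ z : ℂ, z.im ≠ 0 → ¬ 0 < z.im → 0 < (1 / z).im := fun z hz h =>
    (im_inv_pos_iff_not hz).2 h
  have hinv : ∀ z : ℂ, 1 / (1 / z) = z := fun z => one_div_one_div z
  -- The lower half plane is filled in by the inversion symmetry; the sign is that of the Wronskian
  -- under exchange of components.
  refine ⟨fun z => if 0 < z.im then w z else -w (1 / z), fun z hz => ?_, fun z hz => ?_⟩
  · by_cases h : 0 < z.im
    · simp only [if_pos h]
      exact ⟨hL.exists h, hR.exists h, hw z h⟩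
    · simp only [if_neg h]
      have h' := hlow z hz h
      refine ⟨?_, ?_, fun Ψ Φ hΨ hΦ x => ?_⟩
      · obtain ⟨Ψ, hΨ⟩ := hL.exists h'
        have := isLeftJost_swap h'.ne' hΨ
        rw [hinv] at this
        exact ⟨_, this⟩
      · obtain ⟨Φ, hΦ⟩ := hR.exists h'
        have := isRightJost_swap h'.ne' hΦ
        rw [hinv] at this
        exact ⟨_, this⟩
      · rw [← hw _ h' _ _ (isLeftJost_swap hz hΨ) (isRightJost_swap hz hΦ) x, wronskian_swap,
          neg_neg]
  · by_cases h : 0 < z.im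
    · have h' : ¬ 0 < (1 / z).im := fun h' => (im_inv_pos_iff_not hz).1 h' h
      simp only [if_pos h, if_neg h', hinv]
    · simp only [if_neg h, if_pos (hlow z hz h), neg_neg]

omit hL hR in
-- The relations z a' = b and z b' = a interchange the roles of a and b. This is why the derivative
-- of the Wronskian has the same coefficients as the Krein density.
theorem diagParam_hasDerivAt (hz : z ≠ 0) :
    HasDerivAt diagParam (offDiagParam z / z) z := by
  have h := ((hasDerivAt_id z).sub (hasDerivAt_inv hz)).const_mul (1 / 4 : ℂ)
  have e : diagParam = fun z => (1 / 4 : ℂ) * (id z - z⁻¹) := by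
    funext z; simp [diagParam]
  rw [e]
  refine h.congr_deriv ?_
  simp only [offDiagParam]
  field_simp
  ring

omit hL hR in
theorem offDiagParam_hasDerivAt (hz : z ≠ 0) :
    HasDerivAt offDiagParam (diagParam z / z) z := by
  have h := ((hasDerivAt_id z).add (hasDerivAt_inv hz)).const_mul (1 / 4 : ℂ)
  have e : offDiagParam = fun z => (1 / 4 : ℂ) * (id z + z⁻¹) := by
    funext z; simp [offDiagParam]
  rw [e]
  refine h.congr_deriv ?_
  simp only [diagParam]
  field_simp
  ring

end Spectrum

/-! ### Positivity of the Krein form implies simplicity -/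

section Simplicity

variable {u : ℝ → ℝ} {Q : ℤ} {z : ℂ} {Φ Ψ Z : ℝ → Fin 2 → ℂ}

theorem decay_of_norm_le_exp_abs {y : ℝ → ℂ} (hy : Continuous y) {C m : ℝ} (hm : 0 < m)
    (h : ∀ x, ‖y x‖ ≤ C * Real.exp (-(m * |x|))) :
    Integrable y ∧ Tendsto y atBot (𝓝 0) ∧ Tendsto y atTop (𝓝 0) := by
  have hlim : ∀ l : Filter ℝ, Tendsto (fun x : ℝ => |x|) l atTop → Tendsto y l (𝓝 0) := by
    intro l hl
    have h1 : Tendsto (fun x : ℝ => C * Real.exp (-(m * |x|))) l (𝓝 (C * 0)) :=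
      (Real.tendsto_exp_neg_atTop_nhds_zero.comp (hl.const_mul_atTop hm)).const_mul C
    rw [mul_zero] at h1
    exact squeeze_zero_norm h h1
  refine ⟨?_, hlim _ tendsto_abs_atBot_atTop, hlim _ tendsto_abs_atTop_atTop⟩
  rw [← integrableOn_univ, ← Iic_union_Ioi (a := (0 : ℝ))]
  refine IntegrableOn.union ?_ ?_
  · refine Integrable.mono' ((integrableOn_exp_mul_Iic hm 0).const_mul C)
      hy.aestronglyMeasurable ?_
    filter_upwards [ae_restrict_mem measurableSet_Iic] with x hx
    have := h x
    rwa [abs_of_nonpos hx, mul_neg, neg_neg] at this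
  · refine Integrable.mono' ((exp_neg_integrableOn_Ioi 0 hm).const_mul C)
      hy.aestronglyMeasurable ?_
    filter_upwards [ae_restrict_mem measurableSet_Ioi] with x hx
    have := h x
    rwa [abs_of_pos hx, ← neg_mul] at this

/-- The ratio is t = (|z|² - 1)/(|z|² + 1); it measures the distance to the unit circle and vanishes
exactly there. -/
theorem exists_param_ratio (hz : 0 < z.im) : ∃ t : ℝ, t ^ 2 < 1 ∧
    (diagParam z).re = t * (offDiagParam z).re ∧ (offDiagParam z).im = t * (diagParam z).im := by
  have hn : 0 < Complex.normSq z := Complex.normSq_pos.2 fun h => by simp [h] at hz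
  set r := Complex.normSq z with hr
  have e1 : (diagParam z).re = 1 / 4 * (z.re - z.re / r) := by
    simp [diagParam, Complex.mul_re, Complex.inv_re, hr]
  have e2 : (diagParam z).im = 1 / 4 * (z.im + z.im / r) := by
    simp [diagParam, Complex.mul_im, Complex.inv_im, neg_div, hr]
  have e3 : (offDiagParam z).re = 1 / 4 * (z.re + z.re / r) := by
    simp [offDiagParam, Complex.mul_re, Complex.inv_re, hr]
  have e4 : (offDiagParam z).im = 1 / 4 * (z.im - z.im / r) := by
    simp [offDiagParam, Complex.mul_im, Complex.inv_im, neg_div, hr, sub_eq_add_neg]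
  refine ⟨(r - 1) / (r + 1), ?_, ?_, ?_⟩
  · rw [div_pow, div_lt_one (by positivity)]
    nlinarith
  · rw [e1, e3]; field_simp
  · rw [e2, e4]; field_simp

/-- For purely imaginary `a` and real `b`, conjugation of one component and negative conjugation of
the other preserve solutions. -/
theorem IsSystemSolution.conj_neg_conj {c s : ℝ → ℝ} {a b : ℂ} {y₁ y₂ : ℝ → ℂ}
    (h : IsSystemSolution c s a b y₁ y₂) (ha : a.re = 0) (hb : b.im = 0) :
    IsSystemSolution c s a b (fun x => star (y₁ x)) (fun x => -star (y₂ x)) := by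
  have ha' : star a = -a := by
    apply Complex.ext <;> simp [ha]
  have hb' : star b = b := by
    apply Complex.ext <;> simp [hb]
  have hI : star Complex.I = -Complex.I := Complex.conj_I
  have hr : ∀ r : ℝ, star (r : ℂ) = r := Complex.conj_ofReal
  constructor <;> intro x
  · refine (h.1 x).star.congr_deriv ?_
    simp only [star_add, star_mul', star_neg, ha', hb', hI, hr]
    ring
  · refine (h.2 x).star.neg.congr_deriv ?_
    simp only [star_add, star_mul', ha', hb', hI, hr]
    ring

/-- The factor l converts x and y into their conjugates up to sign, so the products xy, x², y² of
the Wronskian derivative become the Hermitian expressions of the Krein density. -/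
theorem krein_pointwise_eq {a b x y l : ℂ} {c s : ℝ} (ha : a.re = 0) (hb : b.im = 0)
    (hx : star x = l * x) (hy : -star y = l * y) :
    l * (b * (-Complex.I * c * (2 * (x * y))) + a * (Complex.I * s * (y ^ 2 - x ^ 2))) =
      ((a.im * s * (‖x‖ ^ 2 + ‖y‖ ^ 2) - 2 * b.re * c * (x.im * y.re - x.re * y.im) : ℝ) : ℂ) := by
  have e1 : l * (2 * (x * y)) = star x * y - x * star y := by
    linear_combination (-y) * hx - x * hy
  have e2 : l * (y ^ 2 - x ^ 2) = -(star x * x + star y * y) := by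
    linear_combination x * hx - y * hy
  have e3 : l * (b * (-Complex.I * c * (2 * (x * y))) + a * (Complex.I * s * (y ^ 2 - x ^ 2))) =
      b * (-Complex.I * c) * (l * (2 * (x * y))) + a * (Complex.I * s) * (l * (y ^ 2 - x ^ 2)) := by
    ring
  rw [e3, e1, e2, norm_sq_eq, norm_sq_eq]
  apply Complex.ext
  · simp [ha, hb, pow_two]; ring
  · simp [ha, hb, pow_two]; ring_nf; simp

/-- An eigenvalue in the upper half plane is simple as soon as the Krein form is definite on the
eigenfunctions. -/
theorem isSimpleEigenvalue_of_krein (hL : HasJostTheory u (IsLeftJost u) (Iic 0))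
    (hR : HasJostTheory u (IsRightJost u Q) (Ici 0))
    (hcc : Continuous (cosHalf u)) (hsc : Continuous (sinHalf u))
    {z₀ : ℂ} (hz₀ : 0 < z₀.im) (hev : IsEigenvalue u z₀)
    (hK : ∀ y₁ y₂ : ℝ → ℂ, ∀ t : ℝ, t ^ 2 < 1 → (offDiagParam z₀).im = t * (diagParam z₀).im →
      IsSystemSolution (cosHalf u) (sinHalf u) (diagParam z₀) (offDiagParam z₀) y₁ y₂ →
      (∃ x, y₁ x ≠ 0 ∨ y₂ x ≠ 0) →
      (Integrable fun x => ‖y₁ x‖ ^ 2) → (Integrable fun x => ‖y₂ x‖ ^ 2) →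
      Tendsto y₁ atBot (𝓝 0) → Tendsto y₂ atBot (𝓝 0) →
      Tendsto y₁ atTop (𝓝 0) → Tendsto y₂ atTop (𝓝 0) →
      0 < ∫ x, kreinDensity (cosHalf u) (sinHalf u) (diagParam z₀) (offDiagParam z₀) y₁ y₂ x) :
    IsSimpleEigenvalue u Q z₀ := by
  obtain ⟨hz0, Z, hZ, hZne⟩ := id hev
  have hc1 : ∀ x, |cosHalf u x| ≤ 1 := fun x => Real.abs_cos_le_one _
  have hs1 : ∀ x, |sinHalf u x| ≤ 1 := fun x => Real.abs_sin_le_one _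
  have ha0 := diagParam_im_pos hz₀
  have hda := diagParam_hasDerivAt hz0
  have hdb := offDiagParam_hasDerivAt hz0
  -- The extra 1 makes the bound strict at `z₀`, hence valid in a neighbourhood.
  set M := ‖diagParam z₀‖ + ‖offDiagParam z₀‖ + 1 with hM
  obtain ⟨p, Cp, hCp, hp⟩ := hL.exists_family M (by positivity)
  obtain ⟨q, Cq, hCq, hq⟩ := hR.exists_family M (by positivity)
  obtain ⟨hp0, hpb, hpl⟩ := hp z₀ hz₀ (by linarith)
  obtain ⟨hq0, hqb, hql⟩ := hq z₀ hz₀ (by linarith)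
  obtain ⟨l₁, hl₁⟩ := hL.eq_smul z₀ hz₀ _ hp0 Z hZ
  obtain ⟨l₂, hl₂⟩ := hR.eq_smul z₀ hz₀ _ hq0 Z hZ
  have hl₁0 : l₁ ≠ 0 := fun h => hZne (by rw [hl₁, h, zero_smul])
  have hl₂0 : l₂ ≠ 0 := fun h => hZne (by rw [hl₂, h, zero_smul])
  set l := l₁⁻¹ * l₂ with hl
  have hl0 : l ≠ 0 := mul_ne_zero (inv_ne_zero hl₁0) hl₂0
  have hpq : ∀ x i, p z₀ x i = l * q z₀ x i := by
    intro x i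
    have h : l₁ * p z₀ x i = l₂ * q z₀ x i := by
      have := congrFun (congrFun (hl₁.symm.trans hl₂) x) i
      exact this
    rw [hl, mul_assoc, ← h, inv_mul_cancel_left₀ hl₁0]
  have hqZ : q z₀ = l₂⁻¹ • Z := by rw [hl₂, inv_smul_smul₀ hl₂0]
  have hqE : q z₀ ∈ eigenspace u z₀ := hqZ ▸ (eigenspace u z₀).smul_mem _ hZ
  have hqne : q z₀ ≠ 0 := fun h => hZne (by rw [hl₂, h, smul_zero])
  have hqsol := isSolution_iff.1 hq0.1
  obtain ⟨hqc₁, hqc₂⟩ := hqsol.continuous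
  have hqx : ∃ x, q z₀ x 0 ≠ 0 ∨ q z₀ x 1 ≠ 0 := by
    by_contra! h
    apply hqne
    funext x i
    fin_cases i
    exacts [(h x).1, (h x).2]
  have hm := memLp_component hqE.2
  have hsq : ∀ i, Integrable fun x => ‖q z₀ x i‖ ^ 2 := fun i =>
    (memLp_two_iff_integrable_sq_norm (hm i).1).1 (hm i)
  -- The eigenfunction inherits exponential decay at both ends, being a multiple of both Jost
  -- solutions; the estimate for p is used on the left and that for q on the right.
  have hbound : ∀ i x, ‖q z₀ x i‖ ≤
      max (‖l⁻¹‖ * Cp) Cq * Real.exp (-((diagParam z₀).im * |x|)) := by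
    intro i x
    rcases le_total x 0 with hx | hx
    · have e : q z₀ x i = l⁻¹ * p z₀ x i := by rw [hpq, inv_mul_cancel_left₀ hl0]
      rw [e, norm_mul]
      refine (mul_le_mul_of_nonneg_left (hpb x hx i) (norm_nonneg _)).trans ?_
      rw [← mul_assoc]
      exact mul_le_mul_of_nonneg_right (le_max_left _ _) (Real.exp_pos _).le
    · exact (hqb x hx i).trans (mul_le_mul_of_nonneg_right (le_max_right _ _) (Real.exp_pos _).le)
  obtain ⟨hi₁, hbot₁, htop₁⟩ := decay_of_norm_le_exp_abs hqc₁ ha0 (hbound 0)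
  obtain ⟨hi₂, hbot₂, htop₂⟩ := decay_of_norm_le_exp_abs hqc₂ ha0 (hbound 1)
  -- the neighbourhood of `z₀` on which the estimates hold
  have hnhds : ∀ᶠ z in 𝓝 z₀, 0 < z.im ∧ (diagParam z₀).im / 2 ≤ (diagParam z).im ∧
      ‖diagParam z‖ + ‖offDiagParam z‖ ≤ M := by
    have h1 : ∀ᶠ z in 𝓝 z₀, 0 < z.im :=
      (Complex.continuous_im.tendsto z₀).eventually (lt_mem_nhds hz₀)
    have h2 : ∀ᶠ z in 𝓝 z₀, (diagParam z₀).im / 2 < (diagParam z).im :=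
      ((Complex.continuous_im.tendsto _).comp hda.continuousAt).eventually
        (lt_mem_nhds (half_lt_self ha0))
    have h3 : ∀ᶠ z in 𝓝 z₀, ‖diagParam z‖ + ‖offDiagParam z‖ < M :=
      (hda.continuousAt.norm.add hdb.continuousAt.norm).eventually
        (gt_mem_nhds (lt_add_one _))
    filter_upwards [h1, h2, h3] with z h1 h2 h3 using ⟨h1, h2.le, h3.le⟩
  have hpar : (fun z => ‖diagParam z - diagParam z₀‖ + ‖offDiagParam z - offDiagParam z₀‖) =O[𝓝 z₀]
      fun z => z - z₀ := hda.isBigO_sub.norm_left.add hdb.isBigO_sub.norm_left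
  have hlip : ∀ r : ℂ → ℝ → Fin 2 → ℂ, (∀ x, ∃ K : ℝ, ∀ z' : ℂ, 0 < z'.im →
      (diagParam z₀).im / 2 ≤ (diagParam z').im → ‖diagParam z'‖ + ‖offDiagParam z'‖ ≤ M →
      ∀ i, ‖r z' x i - r z₀ x i‖ ≤
        K * (‖diagParam z' - diagParam z₀‖ + ‖offDiagParam z' - offDiagParam z₀‖)) →
      ∀ i x, (fun z => r z x i - r z₀ x i) =O[𝓝 z₀] fun z => z - z₀ := by
    intro r hr i x
    obtain ⟨K, hK⟩ := hr x
    refine Asymptotics.IsBigO.trans (Asymptotics.IsBigO.of_bound K ?_) hpar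
    filter_upwards [hnhds] with z hz
    rw [Real.norm_of_nonneg (by positivity)]
    exact hK z hz.1 hz.2.1 hz.2.2 i
  have hexp : ∀ (C : ℝ) (z : ℂ) (x : ℝ), 0 ≤ C → 0 < z.im →
      C * Real.exp (-((diagParam z).im * |x|)) ≤ C := by
    intro C z x hC hz
    refine mul_le_of_le_one_right hC (Real.exp_le_one_iff.2 ?_)
    have := mul_nonneg (diagParam_im_pos hz).le (abs_nonneg x)
    linarith
  have hder := hasDerivAt_wronskian (C := max Cp Cq) (p₁ := fun z x => p z x 0)
    (p₂ := fun z x => p z x 1) (q₁ := fun z x => q z x 0) (q₂ := fun z x => q z x 1)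
    hcc hsc hc1 hs1 hda hdb
    (hnhds.mono fun z hz => isSolution_iff.1 (hp z hz.1 hz.2.2).1.1)
    (hnhds.mono fun z hz => isSolution_iff.1 (hq z hz.1 hz.2.2).1.1)
    (hnhds.mono fun z hz x hx => by
      have h := (hp z hz.1 hz.2.2).2.1 x hx
      have h' := (hexp Cp z x hCp hz.1).trans (le_max_left Cp Cq)
      exact ⟨(h 0).trans h', (h 1).trans h'⟩)
    (hnhds.mono fun z hz x hx => by
      have h := (hq z hz.1 hz.2.2).2.1 x hx
      have h' := (hexp Cq z x hCq hz.1).trans (le_max_right Cp Cq)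
      exact ⟨(h 0).trans h', (h 1).trans h'⟩)
    (hlip p hpl 0) (hlip p hpl 1) (hlip q hql 0) (hlip q hql 1)
    (fun x => hpq x 0) (fun x => hpq x 1) hi₁ hi₂ (hm 0) (hm 1) hbot₁ hbot₂ htop₁ htop₂
  obtain ⟨t, ht, hre, him⟩ := exists_param_ratio hz₀
  have hpos := hK _ _ t ht him hqsol hqx (hsq 0) (hsq 1) hbot₁ hbot₂ htop₁ htop₂
  have hkint := integrable_kreinDensity (a := diagParam z₀) (b := offDiagParam z₀)
    hcc hsc hc1 hs1 hqc₁ hqc₂ (hsq 0) (hsq 1)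
  -- The eigenvalue lies on the unit circle, so the conjugation symmetry becomes available.
  have ht0 : t = 0 := hqsol.eq_zero_of_integral_ne_zero hre him hkint hpos.ne'
    hbot₁ hbot₂ htop₁ htop₂
  rw [ht0, zero_mul] at hre him
  -- The conjugated function is again a square integrable solution for `z₀`, hence in the
  -- one-dimensional eigenspace.
  obtain ⟨k, hk⟩ : ∃ k : ℂ, (fun x => ![star (q z₀ x 0), -star (q z₀ x 1)]) = k • q z₀ := by
    refine hR.eq_smul z₀ hz₀ _ hq0 _ ⟨isSolution_iff.2 (hqsol.conj_neg_conj hre him), ?_⟩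
    refine MemLp.of_le hqE.2 (Continuous.aestronglyMeasurable (by fun_prop))
      (Eventually.of_forall fun x => (pi_norm_le_iff_of_nonneg (norm_nonneg _)).2 ?_)
    simp only [Fin.forall_fin_two, cons_val_zero, cons_val_one, norm_neg, norm_star]
    exact ⟨norm_le_pi_norm _ 0, norm_le_pi_norm _ 1⟩
  have hk₁ : ∀ x, star (q z₀ x 0) = k * q z₀ x 0 := fun x => congrFun (congrFun hk x) 0
  have hk₂ : ∀ x, -star (q z₀ x 1) = k * q z₀ x 1 := fun x => congrFun (congrFun hk x) 1
  obtain ⟨W, hW, -⟩ := exists_isJostWronskian hL hR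
  have hderW := hder.congr_of_eventuallyEq (f₁ := W) (by
    filter_upwards [hnhds] with z hz
    rw [← (hW z hz.1.ne').2.2 _ _ (hp z hz.1 hz.2.2).1 (hq z hz.1 hz.2.2).1 0, wronskian])
  refine ⟨hev, hz₀.ne', ?_, W, hW, ?_, _, ?_, hderW⟩
  · refine finrank_eq_one (⟨q z₀, hqE⟩ : eigenspace u z₀) (fun h => hqne (congrArg Subtype.val h))
      fun w => ?_
    obtain ⟨m, hm⟩ := hR.eq_smul z₀ hz₀ _ hq0 w w.2
    exact ⟨m, Subtype.ext hm.symm⟩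
  · rw [← (hW z₀ hz₀.ne').2.2 _ _ hp0 hq0 0, wronskian, hpq, hpq]
    ring
  · refine mul_ne_zero hl0 fun h0 => hpos.ne' ?_
    -- The factor z₀ clears the denominators of the parameter derivatives, and k makes the integrand
    -- Hermitian.
    have e : (k * z₀) * ∫ x, (offDiagParam z₀ / z₀ *
        (-Complex.I * cosHalf u x * (2 * (q z₀ x 0 * q z₀ x 1))) +
        diagParam z₀ / z₀ * (Complex.I * sinHalf u x * (q z₀ x 1 ^ 2 - q z₀ x 0 ^ 2))) =
        ((∫ x, kreinDensity (cosHalf u) (sinHalf u) (diagParam z₀) (offDiagParam z₀)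
          (fun x => q z₀ x 0) (fun x => q z₀ x 1) x : ℝ) : ℂ) := by
      rw [← integral_const_mul, ← integral_complex_ofReal]
      congr 1
      funext x
      rw [kreinDensity, ← krein_pointwise_eq hre him (hk₁ x) (hk₂ x)]
      field_simp
    rw [h0, mul_zero] at e
    exact_mod_cast e.symm

/-- Simplicity is invariant under inversion of the spectral parameter. -/
theorem isSimpleEigenvalue_of_inv (hL : HasJostTheory u (IsLeftJost u) (Iic 0))
    (hR : HasJostTheory u (IsRightJost u Q) (Ici 0)) (hz : z.im ≠ 0) (hev : IsEigenvalue u z)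
    (h : IsSimpleEigenvalue u Q (1 / z)) : IsSimpleEigenvalue u Q z := by
  have hinv : 1 / (1 / z) = z := one_div_one_div z
  obtain ⟨W, hW, hWinv⟩ := exists_isJostWronskian hL hR
  obtain ⟨W', hW', h0, d, hd, hder⟩ := h.wronskian_deriv
  have heq : ∀ w : ℂ, w.im ≠ 0 → W' w = W w := by
    intro w hw
    obtain ⟨⟨Ψ, hΨ⟩, ⟨Φ, hΦ⟩, h1⟩ := hW w hw
    rw [← h1 Ψ Φ hΨ hΦ 0, (hW' w hw).2.2 Ψ Φ hΨ hΦ 0]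
  have hz' : (1 / z).im ≠ 0 := im_inv_ne_zero hz
  have hrel : ∀ w : ℂ, w.im ≠ 0 → W w = -W' (w⁻¹) := by
    intro w hw
    rw [← one_div, heq _ (im_inv_ne_zero hw), hWinv w hw, neg_neg]
  refine ⟨hev, hz, ?_, W, hW, ?_, -(d * -(z ^ 2)⁻¹), ?_, ?_⟩
  · obtain ⟨v, hv, hspan⟩ := finrank_eq_one_iff'.1 h.finrank_eq_one
    have hsv : (fun x => swapVec (v.1 x)) ∈ eigenspace u z := by
      have := mem_eigenspace_swap v.2
      rwa [hinv] at this
    refine finrank_eq_one (⟨_, hsv⟩ : eigenspace u z) (fun h0 => hv ?_) fun w => ?_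
    · apply Subtype.ext
      funext x
      have := congrFun (congrArg Subtype.val h0) x
      rw [← swapVec_swapVec (v.1 x)]
      change swapVec (v.1 x) = 0 at this
      rw [this]
      ext i; fin_cases i <;> rfl
    · obtain ⟨m, hm⟩ := hspan ⟨_, mem_eigenspace_swap w.2⟩
      refine ⟨m, Subtype.ext ?_⟩
      funext x
      have := congrFun (congrArg Subtype.val hm) x
      change m • v.1 x = swapVec (w.1 x) at this
      change m • swapVec (v.1 x) = w.1 x
      rw [← swapVec_swapVec (w.1 x), ← this]
      ext i; fin_cases i <;> rfl
  · rw [hrel z hz, ← one_div, h0, neg_zero]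
  · exact neg_ne_zero.2 (mul_ne_zero hd (neg_ne_zero.2 (inv_ne_zero (pow_ne_zero 2 hev.1))))
  · have h1 : HasDerivAt (fun w : ℂ => -W' (w⁻¹)) (-(d * -(z ^ 2)⁻¹)) z := by
      rw [one_div] at hder
      exact (hder.comp z (hasDerivAt_inv hev.1)).neg
    refine h1.congr_of_eventuallyEq ?_
    filter_upwards [(Complex.continuous_im.continuousAt).eventually_ne hz] with w hw
    exact hrel w hw

/-- There are no real eigenvalues. -/
theorem IsEigenvalue.im_ne_zero (h : IsEigenvalue u z) : z.im ≠ 0 := by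
  intro hz
  obtain ⟨h0, Z, hZ, hne⟩ := h
  have hzr : z = z.re := by apply Complex.ext <;> simp [hz]
  have ha : (diagParam z).im = 0 := by
    rw [hzr]; simp [diagParam, Complex.inv_im]
  have hb : (offDiagParam z).im = 0 := by
    rw [hzr]; simp [offDiagParam, Complex.inv_im]
  have hs := isSolution_iff.1 hZ.1
  -- For real z the coefficient matrix is skew-Hermitian, so the Euclidean norm of a solution is
  -- constant, and a nonzero constant is not integrable on the line.
  have hd : ∀ x, HasDerivAt (fun x => ‖Z x 0‖ ^ 2 + ‖Z x 1‖ ^ 2) 0 x := by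
    intro x
    simp only [norm_sq_eq]
    refine ((((hasDerivAt_complex_re (hs.1 x)).pow 2).add
      ((hasDerivAt_complex_im (hs.1 x)).pow 2)).add
      (((hasDerivAt_complex_re (hs.2 x)).pow 2).add
      ((hasDerivAt_complex_im (hs.2 x)).pow 2))).congr_deriv ?_
    simp [ha, hb]
    ring
  have hconst := is_const_of_deriv_eq_zero (fun x => (hd x).differentiableAt)
    (fun x => (hd x).deriv)
  have hm := memLp_component hZ.2
  have hi : Integrable fun x => ‖Z x 0‖ ^ 2 + ‖Z x 1‖ ^ 2 :=
    ((memLp_two_iff_integrable_sq_norm (hm 0).1).1 (hm 0)).add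
      ((memLp_two_iff_integrable_sq_norm (hm 1).1).1 (hm 1))
  simp only [fun x => hconst x 0] at hi
  rw [integrable_const_iff] at hi
  have hzero : ‖Z 0 0‖ ^ 2 + ‖Z 0 1‖ ^ 2 = 0 := by
    refine hi.resolve_right fun h => ?_
    simpa using h.measure_univ_lt_top
  apply hne
  funext x i
  have hx := (hconst x 0).trans hzero
  have e0 : ‖Z x 0‖ = 0 := by nlinarith [sq_nonneg ‖Z x 0‖, sq_nonneg ‖Z x 1‖]
  have e1 : ‖Z x 1‖ = 0 := by nlinarith [sq_nonneg ‖Z x 0‖, sq_nonneg ‖Z x 1‖]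
  fin_cases i
  exacts [norm_eq_zero.1 e0, norm_eq_zero.1 e1]

end Simplicity

/-! ### Monotone kinks and single humps -/

section Potentials

variable {u : ℝ → ℝ}

theorem IsPotential.hasDerivAt (h : IsPotential u) (x : ℝ) : HasDerivAt u (deriv u x) x :=
  (h.contDiff.differentiable one_ne_zero x).hasDerivAt

theorem IsPotential.continuous_deriv (h : IsPotential u) : Continuous (deriv u) :=
  h.contDiff.continuous_deriv le_rfl

theorem IsPotential.hasDerivAt_cosHalf (h : IsPotential u) (x : ℝ) :
    HasDerivAt (cosHalf u) (-(deriv u x / 2 * sinHalf u x)) x :=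
  ((h.hasDerivAt x).div_const 2).cos.congr_deriv (by simp only [sinHalf]; ring)

theorem IsPotential.hasDerivAt_sinHalf (h : IsPotential u) (x : ℝ) :
    HasDerivAt (sinHalf u) (deriv u x / 2 * cosHalf u x) x :=
  ((h.hasDerivAt x).div_const 2).sin.congr_deriv (by simp only [cosHalf]; ring)

theorem IsMonotoneKink.hasJostTheory (h : IsMonotoneKink u) :
    HasJostTheory u (IsRightJost u 1) (Ici 0) :=
  hasJostTheory_right (h.toIsPotential.isRightData_one h.tendsto_atTop) id (fun _ => rfl)
    (fun _ _ hs => isSolution_iff.1 hs) fun _ hz _ => isRightJost_one_iff hz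

theorem IsSingleHump.hasJostTheory (h : IsSingleHump u) :
    HasJostTheory u (IsRightJost u 0) (Ici 0) := by
  have hσ : ∀ i : Fin 2, Equiv.swap (0 : Fin 2) 1 (Equiv.swap 0 1 i) = i :=
    fun i => by fin_cases i <;> rfl
  refine hasJostTheory_right (h.toIsPotential.isRightData_zero h.tendsto_atTop)
    (Equiv.swap (0 : Fin 2) 1) hσ (fun z Z hs => ?_) fun z hz Φ => ?_
  · rw [Equiv.swap_apply_left, Equiv.swap_apply_right]
    exact (isSolution_iff.1 hs).swap
  · rw [Equiv.swap_apply_left, Equiv.swap_apply_right]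
    exact isRightJost_zero_iff hz

/-- The line is cut where u = π. The left half needs c ≥ 0 at the cut and the right half c ≤ 0,
which forces c = 0 there; also s = 1, so the Krein form is strictly positive. -/
theorem IsMonotoneKink.isSimpleEigenvalue_of_im_pos (h : IsMonotoneKink u) {z : ℂ}
    (hz : 0 < z.im) (hev : IsEigenvalue u z) : IsSimpleEigenvalue u 1 z := by
  have hp := h.toIsPotential
  have hu0 : ∀ x, 0 ≤ u x := fun x => h.monotone.le_of_tendsto h.tendsto_atBot x
  have hu1 : ∀ x, u x ≤ 2 * Real.pi := fun x => h.monotone.ge_of_tendsto h.tendsto_atTop x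
  have hs0 : ∀ x, 0 ≤ sinHalf u x := fun x =>
    Real.sin_nonneg_of_nonneg_of_le_pi (by linarith [hu0 x]) (by linarith [hu1 x])
  obtain ⟨X, hX⟩ : ∃ x, u x = Real.pi := by
    refine mem_range_of_exists_le_of_exists_ge hp.contDiff.continuous ?_ ?_
    · exact (h.tendsto_atBot.eventually (eventually_le_nhds Real.pi_pos)).exists
    · exact (h.tendsto_atTop.eventually
        (eventually_ge_nhds (by linarith [Real.pi_pos] : Real.pi < 2 * Real.pi))).exists
  have hcX : cosHalf u X = 0 := by rw [cosHalf, hX, Real.cos_pi_div_two]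
  have hsX : sinHalf u X = 1 := by rw [sinHalf, hX, Real.sin_pi_div_two]
  have hg0 : ∀ x, 0 ≤ deriv u x / 2 := fun x => div_nonneg h.monotone.deriv_nonneg zero_le_two
  have hgc : Continuous fun x => deriv u x / 2 := hp.continuous_deriv.div_const 2
  have hc1 : ∀ x, |cosHalf u x| ≤ 1 := fun x => Real.abs_cos_le_one _
  have hs1 : ∀ x, |sinHalf u x| ≤ 1 := fun x => Real.abs_sin_le_one _
  have hcc := hp.continuous_cosHalf
  have hsc := hp.continuous_sinHalf
  refine isSimpleEigenvalue_of_krein (hasJostTheory_left (hp.isLeftData h.tendsto_atBot))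
    h.hasJostTheory hcc hsc hz hev ?_
  intro y₁ y₂ t ht him hy hne hi₁ hi₂ hbot₁ hbot₂ htop₁ htop₂
  have ha := diagParam_im_pos hz
  have hc := hy.continuous
  refine integral_pos_of_le_half_lines (X := X) (mul_pos ha (sub_pos.2 ht))
    (f := fun x => sinHalf u x * (‖y₁ x‖ ^ 2 + ‖y₂ x‖ ^ 2)) ?_
    (fun x => mul_nonneg (hs0 x) (by positivity)) ?_ (integrable_mul_norm_sq hsc hs1 hi₁ hi₂)
    (integrable_kreinDensity hcc hsc hc1 hs1 hc.1 hc.2 hi₁ hi₂) ?_ ?_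
  · have := hc.1
    have := hc.2
    fun_prop
  · rw [hsX, one_mul]
    exact hy.norm_sq_add_pos hc1 hs1 hne X
  · exact hy.le_integral_kreinDensity_Iic hp.hasDerivAt_cosHalf hp.hasDerivAt_sinHalf hgc hc1 hs1
      (fun x _ => hg0 x) (fun x _ => hs0 x) hcX.ge ha him hi₁ hi₂ hbot₂
  · exact hy.le_integral_kreinDensity_Ioi hp.hasDerivAt_cosHalf hp.hasDerivAt_sinHalf hgc hc1 hs1
      (fun x _ => hg0 x) (fun x _ => hs0 x) hcX.le ha him hi₁ hi₂ htop₂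

/-- A `C¹` function that vanishes at `-∞`, is positive at `0` and has no critical point on the
negative half-line increases there. -/
theorem deriv_nonneg_of_no_critical {v : ℝ → ℝ} (hv : ContDiff ℝ 1 v)
    (hcrit : ∀ x < 0, deriv v x ≠ 0) (h0 : deriv v 0 = 0) (hlim : Tendsto v atBot (𝓝 0))
    (hpos : 0 < v 0) : ∀ x ≤ 0, 0 ≤ deriv v x ∧ v x ≤ v 0 := by
  have hvc : Continuous (deriv v) := hv.continuous_deriv le_rfl
  have hnn : ∀ x < 0, 0 ≤ deriv v x := by
    -- By the intermediate value theorem the derivative has one sign on the negative half-line; if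
    -- it were negative, v would decrease from its limit 0 and v(0) ≤ 0.
    by_contra! hneg
    obtain ⟨x₁, hx₁, hd₁⟩ := hneg
    have hall : ∀ x < 0, deriv v x < 0 := by
      intro x hx
      by_contra! hx0
      obtain ⟨y, hy, hy0⟩ := (isPreconnected_Iio (a := (0 : ℝ))).intermediate_value hx₁ hx
        hvc.continuousOn ⟨hd₁.le, hx0⟩
      exact hcrit y hy hy0
    have hanti : AntitoneOn v (Iic 0) := by
      refine antitoneOn_of_deriv_nonpos (convex_Iic 0) hv.continuous.continuousOn
        (hv.differentiable one_ne_zero).differentiableOn fun x hx => ?_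
      rw [interior_Iic] at hx
      exact (hall x hx).le
    have hge : v 0 ≤ 0 := by
      refine ge_of_tendsto hlim ?_
      filter_upwards [eventually_le_atBot 0] with x hx
      exact hanti hx self_mem_Iic hx
    exact absurd hpos hge.not_gt
  have hmono : MonotoneOn v (Iic 0) := by
    refine monotoneOn_of_deriv_nonneg (convex_Iic 0) hv.continuous.continuousOn
      (hv.differentiable one_ne_zero).differentiableOn fun x hx => ?_
    rw [interior_Iic] at hx
    exact hnn x hx
  intro x hx
  refine ⟨?_, hmono hx self_mem_Iic hx⟩
  rcases hx.lt_or_eq with hx | rfl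
  exacts [hnn x hx, h0.ge]

/-- The line is cut at the maximum. On the left the boundary term is built from y₂ and on the right,
where u decreases, from y₁; both have the right sign because u(0) < π makes c(0) nonnegative. -/
theorem IsSingleHump.isSimpleEigenvalue_of_im_pos (h : IsSingleHump u) {z : ℂ}
    (hz : 0 < z.im) (hev : IsEigenvalue u z) : IsSimpleEigenvalue u 0 z := by
  have hp := h.toIsPotential
  have hleft := deriv_nonneg_of_no_critical hp.contDiff
    (fun x hx h0 => hx.ne ((h.critical x).1 h0)) ((h.critical 0).2 rfl) h.tendsto_atBot h.pos
  have hdneg : ∀ x, deriv (fun y => u (-y)) x = -deriv u (-x) := fun x => deriv_comp_neg u x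
  have hright := deriv_nonneg_of_no_critical (v := fun y => u (-y))
    (hp.contDiff.comp contDiff_neg)
    (fun x hx h0 => by
      rw [hdneg, neg_eq_zero, h.critical] at h0
      linarith)
    (by rw [hdneg, neg_zero, (h.critical 0).2 rfl, neg_zero])
    (h.tendsto_atTop.comp tendsto_neg_atBot_atTop) (by simpa using h.pos)
  have hgr : ∀ x, 0 ≤ x → deriv u x ≤ 0 := by
    intro x hx
    have := (hright (-x) (by linarith)).1
    rw [hdneg, neg_neg] at this
    linarith
  have hule : ∀ x, u x ≤ u 0 := by
    intro x
    rcases le_total x 0 with hx | hx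
    · exact (hleft x hx).2
    · simpa using (hright (-x) (by linarith)).2
  have hs0 : ∀ x, 0 ≤ sinHalf u x := fun x =>
    Real.sin_nonneg_of_nonneg_of_le_pi (by linarith [h.nonneg x])
      (by linarith [hule x, h.lt_pi, Real.pi_pos])
  have hc0 : 0 ≤ cosHalf u 0 :=
    Real.cos_nonneg_of_neg_pi_div_two_le_of_le (by linarith [h.pos, Real.pi_pos])
      (by linarith [h.lt_pi])
  have hsX : 0 < sinHalf u 0 :=
    Real.sin_pos_of_pos_of_lt_pi (by linarith [h.pos]) (by linarith [h.lt_pi, Real.pi_pos])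
  have hgc : Continuous fun x => deriv u x / 2 := hp.continuous_deriv.div_const 2
  have hc1 : ∀ x, |cosHalf u x| ≤ 1 := fun x => Real.abs_cos_le_one _
  have hs1 : ∀ x, |sinHalf u x| ≤ 1 := fun x => Real.abs_sin_le_one _
  have hcc := hp.continuous_cosHalf
  have hsc := hp.continuous_sinHalf
  refine isSimpleEigenvalue_of_krein (hasJostTheory_left (hp.isLeftData h.tendsto_atBot))
    h.hasJostTheory hcc hsc hz hev ?_
  intro y₁ y₂ t ht him hy hne hi₁ hi₂ hbot₁ hbot₂ htop₁ htop₂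
  have ha := diagParam_im_pos hz
  have hc := hy.continuous
  refine integral_pos_of_le_half_lines (X := 0) (mul_pos ha (sub_pos.2 ht))
    (f := fun x => sinHalf u x * (‖y₁ x‖ ^ 2 + ‖y₂ x‖ ^ 2)) ?_
    (fun x => mul_nonneg (hs0 x) (by positivity)) ?_ (integrable_mul_norm_sq hsc hs1 hi₁ hi₂)
    (integrable_kreinDensity hcc hsc hc1 hs1 hc.1 hc.2 hi₁ hi₂) ?_ ?_
  · have := hc.1
    have := hc.2
    fun_prop
  · exact mul_pos hsX (hy.norm_sq_add_pos hc1 hs1 hne 0)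
  · exact hy.le_integral_kreinDensity_Iic hp.hasDerivAt_cosHalf hp.hasDerivAt_sinHalf hgc hc1 hs1
      (fun x hx => div_nonneg (hleft x hx).1 zero_le_two) (fun x _ => hs0 x) hc0 ha him hi₁ hi₂
      hbot₂
  · exact hy.le_integral_kreinDensity_Ioi' hp.hasDerivAt_cosHalf hp.hasDerivAt_sinHalf hgc hc1 hs1
      (fun x hx => div_nonpos_of_nonpos_of_nonneg (hgr x hx) zero_le_two) (fun x _ => hs0 x) hc0
      ha him hi₁ hi₂ htop₁

end Potentials

end SineGordon
end

theorem mainTheorem5 :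
    (∀ u : ℝ → ℝ, SineGordon.IsMonotoneKink u →
      ∀ z : ℂ, SineGordon.IsEigenvalue u z → SineGordon.IsSimpleEigenvalue u 1 z) ∧
    (∀ u : ℝ → ℝ, SineGordon.IsSingleHump u →
      ∀ z : ℂ, SineGordon.IsEigenvalue u z →
        0 < z.arg → z.arg ≤ (Real.pi - u 0) / 2 →
          SineGordon.IsSimpleEigenvalue u 0 z) := by
  refine ⟨fun u h z hev => ?_, fun u h z hev hpos hle => ?_⟩
  · by_cases hz : 0 < z.im
    · exact h.isSimpleEigenvalue_of_im_pos hz hev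
    -- The eigenvalue lies in the lower half plane, as real ones do not occur, and 1/z is an
    -- eigenvalue in the upper half plane.
    · exact SineGordon.isSimpleEigenvalue_of_inv
        (SineGordon.hasJostTheory_left (h.toIsPotential.isLeftData h.tendsto_atBot))
        h.hasJostTheory hev.im_ne_zero hev (h.isSimpleEigenvalue_of_im_pos
          ((SineGordon.im_inv_pos_iff_not hev.im_ne_zero).2 hz) (SineGordon.isEigenvalue_inv hev))
  -- The angular bounds are used to place z in the open upper half plane, where the Krein argument
  -- applies.
  · have hlt : z.arg < Real.pi := by linarith [h.pos, Real.pi_pos]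
    have him : 0 < z.im := by
      rw [← Complex.norm_mul_sin_arg]
      exact mul_pos (norm_pos_iff.2 hev.1) (Real.sin_pos_of_pos_of_lt_pi hpos hlt)
    exact h.isSimpleEigenvalue_of_im_pos him hev
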